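/- Let $d\ge 2$, and let $\mu_n$ be the normalized Haar measure on $\mathbb{T}^n=\mathbb{R}^n/\mathbb{Z}^n$ and $\mathscr{H}_n=L^2(\mathbb{T}^n,\mu_n)$ (complex-valued functions). Let $y\in\mathbb{R}\setminus\mathbb{Q}$, let $b_{j,k}\in\mathbb{Z}$ for $1\le k<j\le d$ with $b_{l,l-1}\ne 0$ for all $l\in\{2,\dots,d\}$, and for $1\le j\le d-1$ let $h_j:\mathbb{T}^j\to\mathbb{R}$ be of class $C^2$ and Lipschitz in its last variable $x_j$, uniformly in the other variables. Let $T_d:\mathbb{T}^d\to\mathbb{T}^d$ be the Furstenberg transformation $$T_d(x_1,\dots,x_d)=\bigl(x_1+y,\;x_2+b_{2,1}x_1+h_1(x_1),\;\dots,\;x_d+b_{d,1}x_1+\cdots+b_{d,d-1}x_{d-1}+h_{d-1}(x_1,\dots,x_{d-1})\bigr)\bmod\mathbb{Z}^d,$$ and let $W_d:\mathscr{H}_d\to\mathscr{H}_d$, $W_df=f\circ T_d$, be its Koopman operator. Regard $\mathscr{H}_1$ as the closed subspace of $\mathscr{H}_d$ of the functions that depend only on $x_1$. Then $W_d$ has countable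 Lebesgue spectrum on the orthocomplement $\mathscr{H}_1^{\perp}$ of $\mathscr{H}_1$ in $\mathscr{H}_d$: there is an orthonormal basis $(e_{j,n})_{j\in\mathbb{N},\,n\in\mathbb{Z}}$ of $\mathscr{H}_1^{\perp}$ such that $W_de_{j,n}=e_{j,n+1}$ for all $j\in\mathbb{N}$, $n\in\mathbb{Z}$. (Equivalently, $W_d$ restricted to $\mathscr{H}_1^{\perp}$ is unitarily equivalent to the direct sum of countably infinitely many copies of multiplication by $z$ on $L^2(S^1,\mathrm{Lebesgue})$.) -/

import Mathlib

open MeasureTheory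
open scoped ENNReal

noncomputable section

namespace Furstenberg

/-- The `n`-dimensional torus `𝕋ⁿ = ℝⁿ / ℤⁿ`. -/
abbrev Torus (n : ℕ) : Type := UnitAddTorus (Fin n)

/-- The normalized Haar measure `μₙ` on `𝕋ⁿ`. -/
abbrev haar (n : ℕ) : Measure (Torus n) :=
  Measure.pi fun _ : Fin n => (AddCircle.haarAddCircle : Measure UnitAddCircle)

/-- The Hilbert space `ℋₙ = L²(𝕋ⁿ, μₙ)` of complex-valued functions. -/
abbrev L2 (n : ℕ) : Type := Lp ℂ 2 (haar n)

/-- `h : 𝕋ⁿ → ℝ` is of class `C²`: its `ℤⁿ`-periodic lift to `ℝⁿ` is of class `C²`. -/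
def IsC2 {n : ℕ} (h : Torus n → ℝ) : Prop :=
  ContDiff ℝ 2 fun x : Fin n → ℝ => h fun i => (x i : UnitAddCircle)

/-- `h : 𝕋ⁿ → ℝ` is Lipschitz in its last variable, with a constant that does not depend
on the other variables. -/
def IsUniformlyLipschitzInLast {n : ℕ} (h : Torus n → ℝ) : Prop :=
  ∃ C : ℝ, ∀ x x' : Torus n, (∀ i : Fin n, (i : ℕ) + 1 < n → x i = x' i) →
    |h x - h x'| ≤ C * dist x x'

/-- The first `m` coordinates of a point of `𝕋ⁿ`, for `m ≤ n`. -/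
def initial {m n : ℕ} (hmn : m ≤ n) (x : Torus n) : Torus m := fun k => x (Fin.castLE hmn k)

/-- The increment of the `(m + 1)`-st coordinate as a function of the first `m` coordinates:
`y` for `m = 0`, and
`b_{m+1,1} x₁ + ⋯ + b_{m+1,m} xₘ + h_m(x₁, …, xₘ)` modulo `1` for `m ≥ 1`.
The coordinates `x₁, …, xₘ` are `x 0, …, x (m - 1)`. -/
def increment (y : ℝ) (b : ℕ → ℕ → ℤ) (h : ∀ j : ℕ, Torus j → ℝ) (m : ℕ) (x : Torus m) :
    UnitAddCircle :=
  if m = 0 then (y : UnitAddCircle)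
  else (∑ k : Fin m, b (m + 1) ((k : ℕ) + 1) • x k) + ((h m x : ℝ) : UnitAddCircle)

/-- The transformation `T_d` of `𝕋ᵈ`. -/
def furstenbergMap (d : ℕ) (y : ℝ) (b : ℕ → ℕ → ℤ) (h : ∀ j : ℕ, Torus j → ℝ) (x : Torus d) :
    Torus d :=
  fun i => x i + increment y b h i (initial i.is_lt.le x)

lemma IsC2.continuous {n : ℕ} {h : Torus n → ℝ} (hh : IsC2 h) : Continuous h := by
  have hq : IsOpenQuotientMap
      (Pi.map fun (_ : Fin n) (t : ℝ) => (t : UnitAddCircle)) :=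
    IsOpenQuotientMap.piMap fun _ => QuotientAddGroup.isOpenQuotientMap_mk
  exact hq.isQuotientMap.continuous_iff.2 (ContDiff.continuous hh)

lemma measurable_increment (y : ℝ) (b : ℕ → ℕ → ℤ) (h : ∀ j : ℕ, Torus j → ℝ) (m : ℕ)
    (hm : 1 ≤ m → IsC2 (h m)) : Measurable (increment y b h m) := by
  rcases Nat.eq_zero_or_pos m with rfl | hpos
  · have : increment y b h 0 = fun _ => (y : UnitAddCircle) := by
      funext x; simp [increment]
    rw [this]; exact measurable_const
  · have hc : Continuous (increment y b h m) := by
      have h1 : Continuous (h m) := (hm hpos).continuous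
      have h2 : Continuous fun x : Torus m => ((h m x : ℝ) : UnitAddCircle) :=
        (AddCircle.continuous_mk' 1).comp h1
      have : increment y b h m = fun x =>
          (∑ k : Fin m, b (m + 1) ((k : ℕ) + 1) • x k) + ((h m x : ℝ) : UnitAddCircle) := by
        funext x; simp [increment, hpos.ne']
      rw [this]
      refine Continuous.add (continuous_finsetSum _ fun k _ => ?_) h2
      exact (continuous_apply k).zsmul _
    exact hc.measurable

lemma measurePreserving_triangular (g : ∀ m : ℕ, Torus m → UnitAddCircle) (d : ℕ)
    (hg : ∀ m < d, Measurable (g m)) :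
    MeasurePreserving (fun (x : Torus d) (i : Fin d) => x i + g i (initial i.is_lt.le x))
      (haar d) (haar d) := by
  induction d with
  | zero =>
    have : (fun (x : Torus 0) (i : Fin 0) => x i + g i (initial i.is_lt.le x)) = id := by
      funext x i; exact i.elim0
    rw [this]; exact MeasurePreserving.id _
  | succ n ih =>
    have ih' := ih fun m hm => hg m (hm.trans n.lt_succ_self)
    have hgn : Measurable (g n) := hg n n.lt_succ_self
    let e := MeasurableEquiv.piFinSuccAbove (fun _ : Fin (n + 1) => UnitAddCircle) (Fin.last n)
    have he : MeasurePreserving e (haar (n + 1))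
        ((AddCircle.haarAddCircle : Measure UnitAddCircle).prod (haar n)) :=
      measurePreserving_piFinSuccAbove
        (fun _ : Fin (n + 1) => (AddCircle.haarAddCircle : Measure UnitAddCircle)) (Fin.last n)
    have hskew := MeasurePreserving.skew_product (μc := (AddCircle.haarAddCircle :
        Measure UnitAddCircle)) (μd := (AddCircle.haarAddCircle : Measure UnitAddCircle)) ih'
      (g := fun (x : Torus n) (t : UnitAddCircle) => t + g n x)
      (measurable_snd.add (hgn.comp measurable_fst))
      (Filter.Eventually.of_forall fun x => map_add_right_eq_self _ (g n x))
    have hsw1 := Measure.measurePreserving_swap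
      (μ := (AddCircle.haarAddCircle : Measure UnitAddCircle)) (ν := haar n)
    have hsw2 := Measure.measurePreserving_swap
      (μ := haar n) (ν := (AddCircle.haarAddCircle : Measure UnitAddCircle))
    have key := (he.symm e).comp (hsw2.comp (hskew.comp (hsw1.comp he)))
    convert key using 1
    have hev : ∀ x : Torus (n + 1), e x = (x (Fin.last n), fun k : Fin n => x k.castSucc) := by
      intro x
      refine Prod.ext rfl ?_
      funext k
      change x ((Fin.last n).succAbove k) = x k.castSucc
      rw [Fin.succAbove_last]
    funext x
    apply e.injective
    simp only [Function.comp_apply, MeasurableEquiv.apply_symm_apply]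
    rw [hev, hev]
    rfl

lemma measurePreserving_furstenbergMap (d : ℕ) (y : ℝ) (b : ℕ → ℕ → ℤ)
    (h : ∀ j : ℕ, Torus j → ℝ) (hC2 : ∀ j, 1 ≤ j → j < d → IsC2 (h j)) :
    MeasurePreserving (furstenbergMap d y b h) (haar d) (haar d) :=
  measurePreserving_triangular (increment y b h) d fun m hm =>
    measurable_increment y b h m fun h1 => hC2 m h1 hm

/-- The Koopman operator `f ↦ f ∘ T` on `L²(𝕋ᵈ)` of a measure preserving map `T`. -/
def koopman {d : ℕ} {T : Torus d → Torus d} (hT : MeasurePreserving T (haar d) (haar d)) :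
    L2 d →ₗᵢ[ℂ] L2 d :=
  Lp.compMeasurePreservingₗᵢ ℂ T hT

/-- The copy of `ℋ₁ = L²(𝕋)` in `ℋ_d`: the classes of the functions
`(x₁, …, x_d) ↦ g(x₁)` with `g` square integrable. -/
def firstCoordinateSubspace (d : ℕ) (hd : 0 < d) : Submodule ℂ (L2 d) :=
  LinearMap.range (Lp.compMeasurePreservingₗᵢ (E := ℂ) (p := 2) ℂ
    (Function.eval (⟨0, hd⟩ : Fin d))
    (measurePreserving_eval
      (fun _ : Fin d => (AddCircle.haarAddCircle : Measure UnitAddCircle)) ⟨0, hd⟩)).toLinearMap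

/-- The isometry `W` has countable Lebesgue spectrum on the closed subspace `K`: there is an
orthonormal basis `(e_{j,n})_{j ∈ ℕ, n ∈ ℤ}` of `K` with `W e_{j,n} = e_{j,n+1}`. Equivalently,
`K` reduces `W` and `W` on `K` is unitarily equivalent to the direct sum of countably infinitely
many copies of multiplication by `z` on `L²(S¹, Lebesgue)`. -/
def HasCountableLebesgueSpectrumOn {H : Type*} [NormedAddCommGroup H] [InnerProductSpace ℂ H]
    (W : H →ₗᵢ[ℂ] H) (K : Submodule ℂ H) : Prop :=
  ∃ e : ℕ → ℤ → H,
    Orthonormal ℂ (fun p : ℕ × ℤ => e p.1 p.2) ∧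
    (Submodule.span ℂ (Set.range fun p : ℕ × ℤ => e p.1 p.2)).topologicalClosure = K ∧
    ∀ j n, W (e j n) = e j (n + 1)

end Furstenberg

end

/-! Let U be the Koopman operator, and write e(t) = exp(2πit). If the correlations ⟨g, Uⁿg⟩ of a
vector g are square summable, its spectral measure has a density in L², so the cyclic space of g is
a copy of multiplication by z on L²(A) for some A in the circle
(`exists_intertwiner_of_squareSummable`).

Two mechanisms upgrade this to countable Lebesgue spectrum. Multiplication V by e(x₁) satisfies UV =
e(y)VU and hence rotates spectral supports. Irrational rotations are ergodic, so the rotates of a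
non-null support cover the circle, and a closed subspace that reduces U, is mapped into itself by V
and contains a nonzero vector with square summable correlations contains a full Lebesgue copy
(`exists_isometric_intertwiner_into`). The frequencies k ≥ 1 in x₂ give infinitely many orthogonal
subspaces of this kind. What these full copies leave over splits into countably many partial copies,
and each of them is absorbed by infinitely many full ones as in Hilbert's hotel
(`exists_isometric_of_partial`).

It remains to see that every character χ that does not depend on x₁ alone has square summable
correlations. They are integrals of χ(Tⁿx − x). Let k be the last nonzero frequency of χ. Along the
circle of the coordinate preceding it, the phase is 2πk(nbs + Sₙ(s)) up to a constant, with b a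
nonzero integer and Sₙ a Birkhoff sum of h. The derivative of Sₙ is a Birkhoff sum of a partial
derivative of h, which has mean zero. Uniform convergence of ergodic averages makes it at most n/2,
so the phase has slope at least n and second derivative O(n), and one integration by parts yields
O(1/n) (`exists_norm_integral_displacement_le`).

Uniform convergence (`uniformAverages_furstenberg`) comes by induction on the dimension from the
same estimate: van der Corput's inequality reduces a character with nonzero last frequency to
displacement functions of one variable fewer, whose means are O(1/n). -/

namespace Furstenberg

open Filter Topology
open scoped ComplexOrder ComplexConjugate

/-- The normalized Haar measure of the circle. -/
local notation "𝔪" => (AddCircle.haarAddCircle : Measure UnitAddCircle)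

/-! ### Fourier uniqueness and positivity on the circle -/

/-- Integration against an integrable function, as a functional on continuous functions. -/
noncomputable def integralAgainst {f : UnitAddCircle → ℂ} (hf : Integrable f 𝔪) :
    C(UnitAddCircle, ℂ) →L[ℂ] ℂ :=
  LinearMap.mkContinuous
    { toFun := fun g => ∫ t, g t * f t ∂𝔪
      map_add' := fun g g' => by
        rw [← integral_add]
        · simp [add_mul]
        · exact hf.bdd_mul g.continuous.aestronglyMeasurable (ae_of_all _ g.norm_coe_le_norm)
        · exact hf.bdd_mul g'.continuous.aestronglyMeasurable (ae_of_all _ g'.norm_coe_le_norm)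
      map_smul' := fun c g => by
        rw [RingHom.id_apply, smul_eq_mul, ← integral_const_mul]
        simp [mul_assoc] }
    (∫ t, ‖f t‖ ∂𝔪) fun g => by
      change ‖∫ t, g t * f t ∂𝔪‖ ≤ _
      rw [mul_comm, ← integral_const_mul]
      refine norm_integral_le_of_norm_le (hf.norm.const_mul _) (ae_of_all _ fun t => ?_)
      rw [norm_mul]
      exact mul_le_mul_of_nonneg_right (g.norm_coe_le_norm t) (norm_nonneg _)

lemma integralAgainst_apply {f : UnitAddCircle → ℂ} (hf : Integrable f 𝔪)
    (g : C(UnitAddCircle, ℂ)) : integralAgainst hf g = ∫ t, g t * f t ∂𝔪 := rfl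

/-- The integral over a closed set is the limit of integrals against nonnegative continuous
functions. -/
lemma setIntegral_isClosed_mem_closure {f : UnitAddCircle → ℂ} (hf : Integrable f 𝔪)
    {F : Set UnitAddCircle} (hF : IsClosed F) :
    ∫ t in F, f t ∂𝔪 ∈ closure (Set.range fun g : C(UnitAddCircle, ℝ) =>
      ∫ t, ((|g t| : ℝ) : ℂ) * f t ∂𝔪) := by
  have hpos : ∀ n : ℕ, (0 : ℝ) < 1 / ((n : ℝ) + 1) := fun n => Nat.one_div_pos_of_nat
  have hlim := thickenedIndicator_tendsto_indicator_closure hpos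
    tendsto_one_div_add_atTop_nhds_zero_nat F
  rw [hF.closure_eq, tendsto_pi_nhds] at hlim
  let g : ℕ → C(UnitAddCircle, ℝ) := fun n =>
    ⟨fun t => (thickenedIndicator (hpos n) F t : ℝ), by fun_prop⟩
  refine mem_closure_of_tendsto (f := fun n : ℕ => ∫ t, ((|g n t| : ℝ) : ℂ) * f t ∂𝔪) (b := atTop)
    ?_ (Eventually.of_forall fun n => ⟨g n, rfl⟩)
  rw [← integral_indicator hF.measurableSet]
  refine tendsto_integral_of_dominated_convergence (fun t => ‖f t‖) (fun n => ?_) hf.norm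
    (fun n => ae_of_all _ fun t => ?_) (ae_of_all _ fun t => ?_)
  · refine AEStronglyMeasurable.mul (Continuous.aestronglyMeasurable ?_) hf.1
    fun_prop
  · rw [norm_mul]
    refine mul_le_of_le_one_left (norm_nonneg _) ?_
    rw [Complex.norm_real, norm_abs_eq_norm, Real.norm_eq_abs,
      abs_of_nonneg (a := g n t) (NNReal.coe_nonneg _)]
    exact thickenedIndicator_le_one _ _ _
  · have h1 : Tendsto (fun n => ((|g n t| : ℝ) : ℂ) * f t) atTop
        (𝓝 (((|((F.indicator (fun _ => (1 : NNReal)) t : NNReal) : ℝ)| : ℝ) : ℂ) * f t)) := by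
      refine Tendsto.mul_const _ ?_
      refine (Complex.continuous_ofReal.tendsto _).comp ?_
      refine (continuous_abs.tendsto _).comp ?_
      exact (NNReal.continuous_coe.tendsto _).comp (hlim t)
    convert h1 using 2
    by_cases ht : t ∈ F <;> simp [ht]

lemma mem_closure_span_fourier (g : C(UnitAddCircle, ℂ)) :
    g ∈ closure (Submodule.span ℂ (Set.range (@fourier 1)) : Set C(UnitAddCircle, ℂ)) := by
  rw [← Submodule.topologicalClosure_coe, span_fourier_closure_eq_top]
  trivial

/-- An integrable function on the circle whose Fourier coefficients vanish is zero. -/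
lemma ae_eq_zero_of_integral_fourier_mul {f : UnitAddCircle → ℂ} (hf : Integrable f 𝔪)
    (h : ∀ n : ℤ, ∫ t, fourier n t * f t ∂𝔪 = 0) : f =ᵐ[𝔪] 0 := by
  have h0 : ∀ g, integralAgainst hf g = 0 := fun g => by
    refine closure_minimal (s := (Submodule.span ℂ (Set.range (@fourier 1)) : Set _))
      (t := {g | integralAgainst hf g = 0}) ?_ ?_ (mem_closure_span_fourier g)
    · change Submodule.span ℂ _ ≤ LinearMap.ker (integralAgainst hf).toLinearMap
      rw [Submodule.span_le]
      rintro _ ⟨n, rfl⟩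
      exact h n
    · exact isClosed_eq (integralAgainst hf).continuous continuous_const
  -- The functional vanishes on all continuous functions, hence in the limit on indicators of closed
  -- sets, and these determine an integrable function.
  refine ae_eq_zero_of_forall_setIntegral_isClosed_eq_zero hf fun F hF => ?_
  have := setIntegral_isClosed_mem_closure hf hF
  refine closure_minimal (t := {(0 : ℂ)}) ?_ isClosed_singleton this
  rintro _ ⟨g, rfl⟩
  exact h0 ⟨fun t => ((|g t| : ℝ) : ℂ), by fun_prop⟩

/-- An integrable function on the circle is nonnegative if its integrals against the functions
`|p|²` with `p` a trigonometric polynomial are. -/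
lemma ae_nonneg_of_integral_star_mul {f : UnitAddCircle → ℂ} (hf : Integrable f 𝔪)
    (h : ∀ p ∈ Submodule.span ℂ (Set.range (@fourier 1)), 0 ≤ ∫ t, (star p * p) t * f t ∂𝔪) :
    0 ≤ᵐ[𝔪] f := by
  have h0 : ∀ g, 0 ≤ integralAgainst hf (star g * g) := fun g => by
    refine closure_minimal (s := (Submodule.span ℂ (Set.range (@fourier 1)) : Set _))
      (t := {g | 0 ≤ integralAgainst hf (star g * g)}) (fun p hp => h p hp) ?_ (mem_closure_span_fourier g)
    exact isClosed_le continuous_const ((integralAgainst hf).continuous.comp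
      (continuous_star.mul continuous_id))
  have h1 : ∀ F : Set UnitAddCircle, IsClosed F → 0 ≤ ∫ t in F, f t ∂𝔪 := fun F hF => by
    refine closure_minimal (t := {z : ℂ | 0 ≤ z}) ?_ (isClosed_le continuous_const continuous_id)
      (setIntegral_isClosed_mem_closure hf hF)
    rintro _ ⟨g, rfl⟩
    -- The square root writes |g| in the form `star p * p`.
    have := h0 ⟨fun t => ((Real.sqrt |g t| : ℝ) : ℂ), by fun_prop⟩
    rw [integralAgainst_apply] at this
    refine this.trans_eq (integral_congr_ae (ae_of_all _ fun t => ?_))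
    simp only [ContinuousMap.mul_apply, ContinuousMap.star_apply, ContinuousMap.coe_mk,
      RCLike.star_def, Complex.conj_ofReal]
    rw [← Complex.ofReal_mul, Real.mul_self_sqrt (abs_nonneg _)]
  have him : (fun t => (f t).im) =ᵐ[𝔪] 0 := by
    refine ae_eq_zero_of_forall_setIntegral_isClosed_eq_zero hf.im fun F hF => ?_
    have := (Complex.le_def.1 (h1 F hF)).2
    have h3 : (∫ t in F, f t ∂𝔪).im = ∫ t in F, (f t).im ∂𝔪 :=
      (integral_im (𝕜 := ℂ) hf.integrableOn).symm
    rw [← h3, ← this, Complex.zero_im]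
  have hre : 0 ≤ᵐ[𝔪] fun t => (f t).re := by
    have hre' : Integrable (fun t => (f t).re) 𝔪 := hf.re
    have hm : NullMeasurableSet {t | (f t).re < 0} 𝔪 :=
      nullMeasurableSet_lt hre'.1.aemeasurable aemeasurable_const
    suffices 𝔪 {t | (f t).re < 0} = 0 by
      rw [EventuallyLE, ae_iff]
      simpa using this
    by_contra hne
    obtain ⟨B, hB, hBm, hBe⟩ := hm.exists_measurable_subset_ae_eq
    have hBpos : (0 : ℝ≥0∞) < 𝔪 B := by
      rw [measure_congr hBe]; exact pos_iff_ne_zero.2 hne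
    -- Inner regularity: a non-null set where the real part is negative contains a non-null closed
    -- set, over which the integral would be negative.
    obtain ⟨F, hFB, hF, hFpos⟩ := hBm.exists_lt_isClosed_of_ne_top (measure_ne_top _ _) hBpos
    have h2 : 0 ≤ ∫ t in F, (f t).re ∂𝔪 := by
      have := (Complex.le_def.1 (h1 F hF)).1
      have h3 : (∫ t in F, f t ∂𝔪).re = ∫ t in F, (f t).re ∂𝔪 :=
        (integral_re (𝕜 := ℂ) hf.integrableOn).symm
      rw [← h3]; simpa using this
    have h4 : 0 < ∫ t in F, -(f t).re ∂𝔪 := by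
      rw [setIntegral_pos_iff_support_of_nonneg_ae]
      · refine hFpos.trans_le (measure_mono fun t ht => ⟨?_, ht⟩)
        have : (f t).re < 0 := hB (hFB ht)
        simp [this.ne]
      · filter_upwards [ae_restrict_mem hF.measurableSet] with t ht
        have : (f t).re < 0 := hB (hFB ht)
        simp [this.le]
      · exact hre'.neg.integrableOn
    rw [integral_neg] at h4
    linarith
  filter_upwards [him, hre] with t h1 h2
  exact Complex.le_def.2 ⟨h2, h1.symm⟩

/-! ### Multiplication operators on L² -/

section Multiplication

variable {α : Type*} [MeasurableSpace α] (μ : Measure α)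

open Classical in
/-- Multiplication by an essentially bounded function on `L²`; zero if the function is not
essentially bounded. -/
noncomputable def mulL (m : α → ℂ) : Lp ℂ 2 μ →L[ℂ] Lp ℂ 2 μ :=
  if h : MemLp m ∞ μ then
    ContinuousLinearMap.holderL μ ∞ 2 2 (ContinuousLinearMap.mul ℂ ℂ) (h.toLp m)
  else 0

variable {μ}

lemma coeFn_mulL {m : α → ℂ} (h : MemLp m ∞ μ) (φ : Lp ℂ 2 μ) :
    mulL μ m φ =ᵐ[μ] fun x => m x * φ x := by
  rw [mulL, dif_pos h]
  filter_upwards [ContinuousLinearMap.coeFn_holder (r := 2) (ContinuousLinearMap.mul ℂ ℂ)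
    (h.toLp m) φ, h.coeFn_toLp] with x h1 h2
  change (ContinuousLinearMap.holder (p := ∞) (q := 2) 2 (ContinuousLinearMap.mul ℂ ℂ)
    (h.toLp m) φ) x = _
  rw [h1, h2]
  rfl

lemma mulL_mulL {m m' : α → ℂ} (h : MemLp m ∞ μ) (h' : MemLp m' ∞ μ) (φ : Lp ℂ 2 μ) :
    mulL μ m (mulL μ m' φ) = mulL μ (fun x => m x * m' x) φ := by
  have h2 : MemLp (fun x => m x * m' x) ∞ μ := h'.mul h
  refine Lp.ext ?_
  filter_upwards [coeFn_mulL h (mulL μ m' φ), coeFn_mulL h' φ, coeFn_mulL h2 φ] with x h1 h2 h3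
  rw [h1, h2, h3, mul_assoc]

lemma mulL_comm {m m' : α → ℂ} (h : MemLp m ∞ μ) (h' : MemLp m' ∞ μ) (φ : Lp ℂ 2 μ) :
    mulL μ m (mulL μ m' φ) = mulL μ m' (mulL μ m φ) := by
  rw [mulL_mulL h h', mulL_mulL h' h]
  simp_rw [mul_comm]

lemma inner_mulL_eq_integral {m : α → ℂ} (h : MemLp m ∞ μ) (φ ψ : Lp ℂ 2 μ) :
    inner ℂ ψ (mulL μ m φ) = ∫ x, m x * (φ x * conj (ψ x)) ∂μ := by
  rw [L2.inner_def]
  refine integral_congr_ae ?_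
  filter_upwards [coeFn_mulL h φ] with x hx
  rw [hx, RCLike.inner_apply, mul_assoc]

lemma integrable_mul_conj (φ ψ : Lp ℂ 2 μ) : Integrable (fun x => φ x * conj (ψ x)) μ := by
  simpa [RCLike.inner_apply] using L2.integrable_inner (𝕜 := ℂ) ψ φ

lemma inner_mulL_left {m : α → ℂ} (h : MemLp m ∞ μ) (φ ψ : Lp ℂ 2 μ) :
    inner ℂ (mulL μ m ψ) φ = inner ℂ ψ (mulL μ (fun x => conj (m x)) φ) := by
  have h' : MemLp (fun x => conj (m x)) ∞ μ := h.star
  rw [inner_mulL_eq_integral h', L2.inner_def]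
  refine integral_congr_ae ?_
  filter_upwards [coeFn_mulL h ψ] with x hx
  rw [hx, RCLike.inner_apply, map_mul]
  ring

lemma mulL_one (φ : Lp ℂ 2 μ) : mulL μ (fun _ => 1) φ = φ := by
  refine Lp.ext ?_
  filter_upwards [coeFn_mulL (memLp_top_const (μ := μ) (1 : ℂ)) φ] with x hx
  rw [hx, one_mul]

lemma norm_mulL_of_norm_eq_one {m : α → ℂ} (h : MemLp m ∞ μ) (h1 : ∀ x, ‖m x‖ = 1)
    (φ : Lp ℂ 2 μ) : ‖mulL μ m φ‖ = ‖φ‖ := by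
  rw [Lp.norm_def, Lp.norm_def]
  congr 1
  refine eLpNorm_congr_norm_ae ?_
  filter_upwards [coeFn_mulL h φ] with x hx
  rw [hx, norm_mul, h1, one_mul]

lemma memLp_top_indicator_one {B : Set α} (hB : MeasurableSet B) :
    MemLp (B.indicator (1 : α → ℂ)) ∞ μ :=
  (memLp_top_const (μ := μ) (1 : ℂ)).indicator hB

variable (μ) in
/-- Multiplication by the indicator function of a set on `L²`. -/
noncomputable def cut (B : Set α) : Lp ℂ 2 μ →L[ℂ] Lp ℂ 2 μ := mulL μ (B.indicator 1)

lemma coeFn_cut {B : Set α} (hB : MeasurableSet B) (φ : Lp ℂ 2 μ) :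
    cut μ B φ =ᵐ[μ] B.indicator φ := by
  filter_upwards [coeFn_mulL (memLp_top_indicator_one hB) φ] with x hx
  rw [cut, hx]
  by_cases h : x ∈ B <;> simp [h]

lemma cut_cut {B C : Set α} (hB : MeasurableSet B) (hC : MeasurableSet C) (φ : Lp ℂ 2 μ) :
    cut μ B (cut μ C φ) = cut μ (B ∩ C) φ := by
  refine Lp.ext ?_
  filter_upwards [coeFn_cut hB (cut μ C φ), coeFn_cut hC φ, coeFn_cut (hB.inter hC) φ]
    with x h1 h2 h3
  rw [h1, h3]
  by_cases hx : x ∈ B <;> by_cases hx' : x ∈ C <;> simp [hx, hx', h2]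

lemma cut_empty (φ : Lp ℂ 2 μ) : cut μ ∅ φ = 0 := by
  refine Lp.ext ?_
  filter_upwards [coeFn_cut MeasurableSet.empty φ, Lp.coeFn_zero ℂ 2 μ] with x h1 h2
  rw [h1, h2]; simp

lemma cut_univ (φ : Lp ℂ 2 μ) : cut μ Set.univ φ = φ := by
  refine Lp.ext ?_
  filter_upwards [coeFn_cut MeasurableSet.univ φ] with x h1
  rw [h1]; simp

lemma cut_add_cut_compl {B : Set α} (hB : MeasurableSet B) (φ : Lp ℂ 2 μ) :
    cut μ B φ + cut μ Bᶜ φ = φ := by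
  refine Lp.ext ?_
  filter_upwards [coeFn_cut hB φ, coeFn_cut hB.compl φ, Lp.coeFn_add (cut μ B φ) (cut μ Bᶜ φ)]
    with x h1 h2 h3
  rw [h3, Pi.add_apply, h1, h2]
  by_cases hx : x ∈ B <;> simp [hx]

lemma inner_cut_left {B : Set α} (hB : MeasurableSet B) (φ ψ : Lp ℂ 2 μ) :
    inner ℂ (cut μ B ψ) φ = inner ℂ ψ (cut μ B φ) := by
  rw [cut, inner_mulL_left (memLp_top_indicator_one hB)]
  congr 3
  funext x
  by_cases hx : x ∈ B <;> simp [hx]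

lemma cut_mulL {B : Set α} (hB : MeasurableSet B) {m : α → ℂ} (h : MemLp m ∞ μ)
    (φ : Lp ℂ 2 μ) : cut μ B (mulL μ m φ) = mulL μ m (cut μ B φ) :=
  mulL_comm (memLp_top_indicator_one hB) h φ

lemma inner_cut_cut_of_disjoint {B C : Set α} (hB : MeasurableSet B) (hC : MeasurableSet C)
    (hBC : Disjoint B C) (φ ψ : Lp ℂ 2 μ) : inner ℂ (cut μ B φ) (cut μ C ψ) = 0 := by
  rw [inner_cut_left hB, cut_cut hB hC, hBC.inter_eq, cut_empty, inner_zero_right]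

lemma norm_sq_cut_add_cut_compl {B : Set α} (hB : MeasurableSet B) (φ : Lp ℂ 2 μ) :
    ‖cut μ B φ‖ ^ 2 + ‖cut μ Bᶜ φ‖ ^ 2 = ‖φ‖ ^ 2 := by
  conv_rhs => rw [← cut_add_cut_compl hB φ]
  rw [@norm_add_sq ℂ, inner_cut_cut_of_disjoint hB hB.compl disjoint_compl_right]
  simp

end Multiplication

/-! ### Multiplication by characters of the circle and its commutant -/

lemma memLp_top_fourier (n : ℤ) : MemLp (fourier n : UnitAddCircle → ℂ) ∞ 𝔪 :=
  (memLp_top_const (1 : ℝ)).mono' (fourier n).continuous.aestronglyMeasurable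
    (ae_of_all _ fun t => by rw [fourier_apply, Circle.norm_coe])

/-- Multiplication by the `n`-th character on the `L²` space of the circle. -/
noncomputable def shift (n : ℤ) : Lp ℂ 2 𝔪 →L[ℂ] Lp ℂ 2 𝔪 := mulL 𝔪 (fourier n)

lemma coeFn_shift (n : ℤ) (φ : Lp ℂ 2 𝔪) : shift n φ =ᵐ[𝔪] fun t => fourier n t * φ t :=
  coeFn_mulL (memLp_top_fourier n) φ

lemma shift_shift (m n : ℤ) (φ : Lp ℂ 2 𝔪) : shift m (shift n φ) = shift (m + n) φ := by
  rw [shift, shift, shift, mulL_mulL (memLp_top_fourier m) (memLp_top_fourier n)]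
  congr 2
  funext t
  rw [fourier_add]

lemma shift_zero (φ : Lp ℂ 2 𝔪) : shift 0 φ = φ := by
  rw [shift, ← mulL_one φ]
  congr 2
  · funext t; simp
  · rw [mulL_one]

lemma shift_fourierLp (m n : ℤ) : shift m (fourierLp 2 n) = fourierLp 2 (m + n) := by
  refine Lp.ext ?_
  filter_upwards [coeFn_shift m (fourierLp 2 n), coeFn_fourierLp (T := 1) 2 n,
    coeFn_fourierLp (T := 1) 2 (m + n)] with t h1 h2 h3
  rw [h1, h2, h3, fourier_add]

lemma inner_shift_left (n : ℤ) (φ ψ : Lp ℂ 2 𝔪) :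
    inner ℂ (shift n ψ) φ = inner ℂ ψ (shift (-n) φ) := by
  rw [shift, inner_mulL_left (memLp_top_fourier n)]
  congr 3
  funext t
  rw [fourier_neg]

lemma cut_shift {B : Set UnitAddCircle} (hB : MeasurableSet B) (n : ℤ) (φ : Lp ℂ 2 𝔪) :
    cut 𝔪 B (shift n φ) = shift n (cut 𝔪 B φ) :=
  cut_mulL hB (memLp_top_fourier n) φ

/-- An operator on `L²` of the circle that commutes with multiplication by the first character
commutes with multiplication by indicator functions. -/
lemma cut_comm_of_comm_shift {S : Lp ℂ 2 𝔪 →L[ℂ] Lp ℂ 2 𝔪}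
    (hS : ∀ n φ, S (shift n φ) = shift n (S φ)) {B : Set UnitAddCircle} (hB : MeasurableSet B)
    (φ : Lp ℂ 2 𝔪) : S (cut 𝔪 B φ) = cut 𝔪 B (S φ) := by
  refine ext_inner_left ℂ fun w => ?_
  rw [← ContinuousLinearMap.adjoint_inner_left, cut, inner_mulL_eq_integral
    (memLp_top_indicator_one hB), inner_mulL_eq_integral (memLp_top_indicator_one hB)]
  have i1 := integrable_mul_conj φ (ContinuousLinearMap.adjoint S w)
  have i2 := integrable_mul_conj (S φ) w
  -- The functions φ · conj(S*w) and Sφ · conj(w) have the same Fourier coefficients, so they agree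
  -- almost everywhere and have the same integral against any bounded multiplier, in particular an
  -- indicator.
  have key := ae_eq_zero_of_integral_fourier_mul (i1.sub i2) fun n => by
    have e : ∀ φ ψ : Lp ℂ 2 𝔪, Integrable (fun t => fourier n t * (φ t * conj (ψ t))) 𝔪 :=
      fun φ ψ => (integrable_mul_conj φ ψ).bdd_mul (fourier n).continuous.aestronglyMeasurable
        (ae_of_all _ (fourier n).norm_coe_le_norm)
    simp only [Pi.sub_apply, mul_sub]
    rw [integral_sub (e _ _) (e _ _), ← inner_mulL_eq_integral (memLp_top_fourier n),
      ← inner_mulL_eq_integral (memLp_top_fourier n), ContinuousLinearMap.adjoint_inner_left,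
      sub_eq_zero]
    exact congrArg _ (hS n φ)
  refine integral_congr_ae ?_
  filter_upwards [key] with t ht
  simp only [Pi.sub_apply, Pi.zero_apply, sub_eq_zero] at ht
  rw [ht]

/-! ### Partial isometries from Gram matrices -/

section PartialIsometry

variable {E H : Type*} [NormedAddCommGroup E] [InnerProductSpace ℂ E]
  [NormedAddCommGroup H] [InnerProductSpace ℂ H]

lemma inner_linearCombination {ι : Type*} (a : ι → E) (p q : ι →₀ ℂ) :
    inner ℂ (Finsupp.linearCombination ℂ a p) (Finsupp.linearCombination ℂ a q) =
      p.sum fun i x => q.sum fun j y => conj x * (y * inner ℂ (a i) (a j)) := by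
  simp only [Finsupp.linearCombination_apply, Finsupp.sum, sum_inner, inner_sum, inner_smul_left,
    inner_smul_right, Finset.mul_sum]
  rw [Finset.sum_comm]
  simp only [mul_left_comm]

/-- Both squared norms expand in the same Gram matrix. Consequently linear relations among the `a i`
also hold among the `b i`, and `a i ↦ b i` extends to a well-defined isometry of the spans. -/
lemma norm_linearCombination_eq {ι : Type*} {a : ι → E} {b : ι → H}
    (hab : ∀ i j, inner ℂ (a i) (a j) = inner ℂ (b i) (b j)) (p : ι →₀ ℂ) :
    ‖Finsupp.linearCombination ℂ a p‖ = ‖Finsupp.linearCombination ℂ b p‖ := by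
  have h : inner ℂ (Finsupp.linearCombination ℂ a p) (Finsupp.linearCombination ℂ a p) =
      inner ℂ (Finsupp.linearCombination ℂ b p) (Finsupp.linearCombination ℂ b p) := by
    rw [inner_linearCombination, inner_linearCombination]
    simp_rw [hab]
  rw [inner_self_eq_norm_sq_to_K, inner_self_eq_norm_sq_to_K] at h
  have h2 : ‖Finsupp.linearCombination ℂ a p‖ ^ 2 = ‖Finsupp.linearCombination ℂ b p‖ ^ 2 := by
    exact_mod_cast h
  exact (pow_left_inj₀ (norm_nonneg _) (norm_nonneg _) two_ne_zero).1 h2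

/-- Two families with the same Gram matrix are intertwined by a partial isometry. -/
lemma exists_partialIsometry [CompleteSpace E] [CompleteSpace H] {ι : Type*} {a : ι → E} {b : ι → H}
    (hab : ∀ i j, inner ℂ (a i) (a j) = inner ℂ (b i) (b j)) :
    ∃ X : E →L[ℂ] H, (∀ i, X (a i) = b i) ∧
      (∀ x, (∀ i, inner ℂ (a i) x = 0) → X x = 0) ∧
      (∀ x ∈ (Submodule.span ℂ (Set.range a)).topologicalClosure, ‖X x‖ = ‖x‖) ∧
      ∀ x, X x ∈ (Submodule.span ℂ (Set.range b)).topologicalClosure := by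
  set N := (Submodule.span ℂ (Set.range a)).topologicalClosure with hN
  have hcl : IsClosed (N : Set E) := Submodule.isClosed_topologicalClosure _
  have : CompleteSpace N := hcl.completeSpace_coe
  have haN : ∀ i, a i ∈ N := fun i =>
    Submodule.le_topologicalClosure _ (Submodule.subset_span ⟨i, rfl⟩)
  have hmem : ∀ p, Finsupp.linearCombination ℂ a p ∈ N := fun p =>
    Submodule.le_topologicalClosure _ (by
      rw [← Finsupp.range_linearCombination]; exact ⟨p, rfl⟩)
  let e : (ι →₀ ℂ) →ₗ[ℂ] N := (Finsupp.linearCombination ℂ a).codRestrict N hmem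
  have he : DenseRange e := by
    intro x
    have hx : (x : E) ∈ closure (Submodule.span ℂ (Set.range a) : Set E) := x.2
    rw [Topology.IsEmbedding.subtypeVal.closure_eq_preimage_closure_image, Set.mem_preimage]
    refine closure_mono ?_ hx
    intro y hy
    rw [SetLike.mem_coe, ← Finsupp.range_linearCombination] at hy
    obtain ⟨p, rfl⟩ := hy
    exact ⟨e p, ⟨p, rfl⟩, rfl⟩
  have hnorm : ∀ p, ‖Finsupp.linearCombination ℂ b p‖ = ‖e p‖ := fun p =>
    (norm_linearCombination_eq hab p).symm
  let X0 : N →L[ℂ] H := (Finsupp.linearCombination ℂ b).extendOfNorm e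
  have hX0 : ∀ p, X0 (e p) = Finsupp.linearCombination ℂ b p :=
    LinearMap.extendOfNorm_eq he ⟨1, fun p => by rw [hnorm, one_mul]⟩
  have hX0n : ∀ x, ‖X0 x‖ = ‖x‖ := fun x =>
    he.induction_on (p := fun x => ‖X0 x‖ = ‖x‖) x
      (isClosed_eq X0.continuous.norm continuous_norm) fun p => by rw [hX0, hnorm]
  have hX0r : ∀ x, X0 x ∈ (Submodule.span ℂ (Set.range b)).topologicalClosure := fun x =>
    he.induction_on (p := fun x => X0 x ∈ (Submodule.span ℂ (Set.range b)).topologicalClosure) x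
      ((Submodule.isClosed_topologicalClosure _).preimage X0.continuous) fun p => by
        rw [hX0]
        exact Submodule.le_topologicalClosure _ (by
          rw [← Finsupp.range_linearCombination]; exact ⟨p, rfl⟩)
  have hP : ∀ x : E, ∀ hx : x ∈ N, N.orthogonalProjectionOnto x = ⟨x, hx⟩ := fun x hx =>
    Submodule.orthogonalProjectionOnto_mem_subspace_eq_self (⟨x, hx⟩ : N)
  -- The isometry `X0` lives on the closed span of the `a i`; the projection extends it by zero to
  -- the orthogonal complement.
  refine ⟨X0 ∘L N.orthogonalProjectionOnto, fun i => ?_, fun x hx => ?_, fun x hx => ?_,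
    fun x => hX0r _⟩
  · rw [ContinuousLinearMap.comp_apply, hP _ (haN i)]
    have h1 : (⟨a i, haN i⟩ : N) = e (Finsupp.single i 1) := by
      apply Subtype.ext
      simp [e]
    rw [h1, hX0]
    simp
  · have : x ∈ Nᗮ := by
      rw [hN, Submodule.orthogonal_closure, Submodule.mem_orthogonal]
      intro u hu
      induction hu using Submodule.span_induction with
      | mem u hu => obtain ⟨i, rfl⟩ := hu; exact hx i
      | zero => exact inner_zero_left _
      | add u v _ _ hu hv => rw [inner_add_left, hu, hv, add_zero]
      | smul c u _ hu => rw [inner_smul_left, hu, mul_zero]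
    rw [ContinuousLinearMap.comp_apply,
      Submodule.orthogonalProjectionOnto_eq_zero_iff.2 this, map_zero]
  · rw [ContinuousLinearMap.comp_apply, hP _ hx, hX0n]
    rfl

end PartialIsometry

/-! ### Intertwiners between the circle model and a unitary -/

section Intertwiner

variable {H : Type*} [NormedAddCommGroup H] [InnerProductSpace ℂ H] (U : H ≃ₗᵢ[ℂ] H)

/-- `X` intertwines multiplication by the first character of the circle and `U`. -/
def Intertwines (X : Lp ℂ 2 𝔪 →L[ℂ] H) : Prop := ∀ φ, X (shift 1 φ) = U (X φ)

variable {U}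

lemma zpow_add_apply (m n : ℤ) (x : H) : (U ^ (m + n)) x = (U ^ m) ((U ^ n) x) := by
  rw [zpow_add]; rfl

/-- The equivalence between consecutive exponents lets the induction run in both directions. -/
lemma zpow_apply_induction {p : ℤ → Prop} (h0 : p 0) (h1 : ∀ n, p n ↔ p (n + 1)) (n : ℤ) : p n := by
  induction n using Int.induction_on with
  | zero => exact h0
  | succ i hi => exact (h1 _).1 hi
  | pred i hi => exact (h1 _).2 (by rwa [sub_add_cancel])

lemma zpow_succ_apply (n : ℤ) (x : H) : (U ^ (n + 1)) x = U ((U ^ n) x) := by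
  rw [add_comm, zpow_add_apply, zpow_one]

lemma Intertwines.shift {X : Lp ℂ 2 𝔪 →L[ℂ] H} (hX : Intertwines U X) (n : ℤ) (φ : Lp ℂ 2 𝔪) :
    X (shift n φ) = (U ^ n) (X φ) := by
  revert φ
  refine zpow_apply_induction (p := fun n => ∀ φ, X (Furstenberg.shift n φ) = (U ^ n) (X φ))
    (fun φ => ?_) (fun n => ⟨fun h φ => ?_, fun h φ => ?_⟩) n
  · rw [shift_zero]; rfl
  · rw [zpow_succ_apply, ← h, ← hX, shift_shift, add_comm]
  · apply U.injective
    rw [← hX, shift_shift, add_comm, h, zpow_succ_apply]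

lemma inner_zpow_zpow (m n : ℤ) (x y : H) :
    inner ℂ ((U ^ m) x) ((U ^ n) y) = inner ℂ x ((U ^ (n - m)) y) := by
  conv_lhs => rw [← add_sub_cancel m n, zpow_add_apply, LinearIsometryEquiv.inner_map_map]

/-- Spectral subspaces for disjoint sets are orthogonal. -/
lemma Intertwines.inner_cut_of_disjoint [CompleteSpace H] {X Y : Lp ℂ 2 𝔪 →L[ℂ] H}
    (hX : Intertwines U X) (hY : Intertwines U Y) {B C : Set UnitAddCircle}
    (hB : MeasurableSet B) (hC : MeasurableSet C) (hBC : Disjoint B C) (φ ψ : Lp ℂ 2 𝔪) :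
    inner ℂ (X (cut 𝔪 B φ)) (Y (cut 𝔪 C ψ)) = 0 := by
  -- X*Y commutes with multiplication by characters, hence with indicators, so the inner product
  -- equals one between a function supported on B and one supported on C.
  have hS : ∀ n φ, (ContinuousLinearMap.adjoint X ∘L Y) (Furstenberg.shift n φ) =
      Furstenberg.shift n ((ContinuousLinearMap.adjoint X ∘L Y) φ) := fun n φ => by
    refine ext_inner_left ℂ fun w => ?_
    rw [← neg_neg n, ← inner_shift_left, neg_neg, ContinuousLinearMap.comp_apply,
      ContinuousLinearMap.comp_apply, ContinuousLinearMap.adjoint_inner_right,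
      ContinuousLinearMap.adjoint_inner_right, hX.shift, hY.shift]
    have := inner_zpow_zpow (U := U) (-n) 0 (X w) (Y φ)
    rw [zero_sub, neg_neg] at this
    rw [← this]; rfl
  rw [← ContinuousLinearMap.adjoint_inner_right, ← ContinuousLinearMap.comp_apply,
    cut_comm_of_comm_shift hS hC, inner_cut_cut_of_disjoint hB hC hBC]

end Intertwiner

/-! ### Spectral densities and cyclic subspaces -/

section

variable {H : Type*} [NormedAddCommGroup H] [InnerProductSpace ℂ H] {U : H ≃ₗᵢ[ℂ] H}

/-- The orbit of `g` under `U` has square summable correlations. -/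
def SquareSummable (U : H ≃ₗᵢ[ℂ] H) (g : H) : Prop :=
  Summable fun n : ℤ => ‖(inner ℂ g ((U ^ n) g) : ℂ)‖ ^ 2

/-- A function with prescribed square summable Fourier coefficients. -/
lemma exists_integral_fourier_mul_eq {c : ℤ → ℂ} (hc : Summable fun n => ‖c n‖ ^ 2) :
    ∃ r : Lp ℂ 2 𝔪, ∀ n, ∫ t, fourier n t * r t ∂𝔪 = c n := by
  -- The sign appears because the n-th Fourier coefficient is an integral against `fourier (-n)`.
  have hc' : Memℓp (fun n => c (-n)) 2 := by
    refine memℓp_gen ?_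
    simpa [Function.comp_def] using (Equiv.neg ℤ).summable_iff.2 hc
  refine ⟨fourierBasis.repr.symm ⟨_, hc'⟩, fun n => ?_⟩
  have h := fourierBasis_repr (T := 1) (fourierBasis.repr.symm ⟨_, hc'⟩) (-n)
  rw [LinearIsometryEquiv.apply_symm_apply, fourierCoeff] at h
  simpa using h.symm

lemma integrable_lp (r : Lp ℂ 2 𝔪) : Integrable r 𝔪 :=
  (Lp.memLp r).integrable (by norm_num)

/-- The spectral measure of a vector with square summable correlations has a density. -/
lemma exists_density {g : H} (hg : SquareSummable U g) :
    ∃ ρ : UnitAddCircle → ℝ, Integrable ρ 𝔪 ∧ Measurable ρ ∧ (∀ t, 0 ≤ ρ t) ∧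
      ∀ n : ℤ, ∫ t, fourier n t * (ρ t : ℂ) ∂𝔪 = inner ℂ g ((U ^ n) g) := by
  obtain ⟨r, hr⟩ := exists_integral_fourier_mul_eq hg
  have hri := integrable_lp r
  have hpos : 0 ≤ᵐ[𝔪] r := by
    -- For p = Σ aₙzⁿ the integral of |p|² r is the squared norm of Σ aₙUⁿg, hence nonnegative.
    refine ae_nonneg_of_integral_star_mul hri fun p hp => ?_
    rw [← Finsupp.range_linearCombination] at hp
    obtain ⟨a, rfl⟩ := hp
    have e : ∫ t, (star (Finsupp.linearCombination ℂ (@fourier 1) a) *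
        Finsupp.linearCombination ℂ (@fourier 1) a) t * r t ∂𝔪 =
        inner ℂ (Finsupp.linearCombination ℂ (fun n : ℤ => (U ^ n) g) a)
          (Finsupp.linearCombination ℂ (fun n : ℤ => (U ^ n) g) a) := by
      rw [← integralAgainst_apply hri, inner_linearCombination]
      simp only [Finsupp.linearCombination_apply, Finsupp.sum, star_sum, Finset.sum_mul_sum,
        map_sum]
      refine Finset.sum_congr rfl fun i _ => Finset.sum_congr rfl fun j _ => ?_
      rw [inner_zpow_zpow, ← hr, star_smul, smul_mul_smul_comm, map_smul, smul_eq_mul, mul_assoc]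
      congr 2
      rw [integralAgainst_apply]
      congr 1
      funext t
      rw [ContinuousMap.mul_apply, ContinuousMap.star_apply, RCLike.star_def, ← fourier_neg,
        ← fourier_add, neg_add_eq_sub]
    rw [e, inner_self_eq_norm_sq_to_K]
    rw [← RCLike.ofReal_pow]
    exact RCLike.ofReal_nonneg.2 (sq_nonneg _)
  -- A representative that is measurable and nonnegative everywhere, so that its square root and its
  -- support need no exceptional null set.
  obtain ⟨r', hr'm, hr'⟩ := hri.1.aemeasurable
  have hpos' : ∀ᵐ t ∂𝔪, r t = ((|(r' t).re| : ℝ) : ℂ) := by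
    filter_upwards [hpos, hr'] with t h1 h2
    rw [← h2, abs_of_nonneg (Complex.le_def.1 h1).1]
    exact Complex.ext rfl (by simpa using (Complex.le_def.1 h1).2.symm)
  refine ⟨fun t => |(r' t).re|, ?_, by fun_prop, fun t => abs_nonneg _, fun n => ?_⟩
  · exact (hri.congr hr').re.abs
  · rw [← hr]
    refine integral_congr_ae ?_
    filter_upwards [hpos'] with t ht
    rw [ht]

/-- A vector with square summable correlations is in the range of an intertwining partial
isometry. -/
theorem exists_intertwiner_of_squareSummable [CompleteSpace H] {g : H}
    (hg : SquareSummable U g) :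
    ∃ (X : Lp ℂ 2 𝔪 →L[ℂ] H) (A : Set UnitAddCircle), MeasurableSet A ∧ Intertwines U X ∧
      (∀ φ, ‖X φ‖ = ‖cut 𝔪 A φ‖) ∧ (∃ w, X w = g) ∧
      ∀ φ, X φ ∈ (Submodule.span ℂ (Set.range fun n : ℤ => (U ^ n) g)).topologicalClosure := by
  obtain ⟨ρ, hρi, hρm, hρ, hρc⟩ := exists_density hg
  have hsm : AEStronglyMeasurable (fun t => ((Real.sqrt (ρ t) : ℝ) : ℂ)) 𝔪 := by
    refine Measurable.aestronglyMeasurable ?_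
    fun_prop
  have hsL : MemLp (fun t => ((Real.sqrt (ρ t) : ℝ) : ℂ)) 2 𝔪 := by
    rw [memLp_two_iff_integrable_sq_norm hsm]
    refine hρi.congr (ae_of_all _ fun t => ?_)
    simp only [Complex.norm_real, Real.norm_eq_abs, sq_abs]
    rw [Real.sq_sqrt (hρ t)]
  set s : Lp ℂ 2 𝔪 := hsL.toLp with hs
  have hsc : s =ᵐ[𝔪] fun t => ((Real.sqrt (ρ t) : ℝ) : ℂ) := hsL.coeFn_toLp
  set a : ℤ → Lp ℂ 2 𝔪 := fun n => shift n s with ha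
  have gram : ∀ i j, inner ℂ (a i) (a j) = inner ℂ ((U ^ i) g) ((U ^ j) g) := fun i j => by
    rw [inner_zpow_zpow, ← hρc, ha]
    simp only
    rw [inner_shift_left, shift_shift, neg_add_eq_sub, shift,
      inner_mulL_eq_integral (memLp_top_fourier _)]
    refine integral_congr_ae ?_
    filter_upwards [hsc] with t ht
    rw [ht, Complex.conj_ofReal, ← Complex.ofReal_mul, Real.mul_self_sqrt (hρ t)]
  obtain ⟨X, hXa, hX0, hXn, hXr⟩ := exists_partialIsometry gram
  set A : Set UnitAddCircle := {t | ρ t ≠ 0} with hA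
  have hAm : MeasurableSet A := (measurableSet_singleton (0 : ℝ)).compl.preimage hρm
  have hcompl : ∀ φ i, inner ℂ (a i) (cut 𝔪 Aᶜ φ) = 0 := fun φ i => by
    rw [← inner_cut_left hAm.compl, ha]
    simp only
    rw [cut_shift hAm.compl]
    have : cut 𝔪 Aᶜ s = 0 := by
      refine Lp.ext ?_
      filter_upwards [coeFn_cut hAm.compl s, Lp.coeFn_zero ℂ 2 𝔪, hsc] with t h1 h2 h3
      rw [h1, h2]
      by_cases ht : t ∈ Aᶜ
      · have : ρ t = 0 := by simpa [hA] using ht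
        rw [Set.indicator_of_mem ht, h3, this]; simp
      · rw [Set.indicator_of_notMem ht]; rfl
    rw [this, map_zero, inner_zero_left]
  set N := (Submodule.span ℂ (Set.range a)).topologicalClosure with hN
  have hcl : IsClosed (N : Set (Lp ℂ 2 𝔪)) := Submodule.isClosed_topologicalClosure _
  have : CompleteSpace N := hcl.completeSpace_coe
  -- The initial space contains every function supported on A: if w is orthogonal to all zⁿ√ρ, then
  -- √ρ · conj(w) has no Fourier coefficients, so w vanishes where ρ ≠ 0.
  have hmem : ∀ φ, cut 𝔪 A φ ∈ N := fun φ => by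
    rw [← Submodule.orthogonal_orthogonal N, Submodule.mem_orthogonal']
    intro w hw
    rw [inner_cut_left hAm, ← inner_conj_symm]
    suffices cut 𝔪 A w = 0 by
      rw [this, inner_zero_left, map_zero]
    have hw0 : ∀ i, inner ℂ (a i) w = 0 := fun i =>
      (Submodule.mem_orthogonal _ _).1 hw _
        (Submodule.le_topologicalClosure _ (Submodule.subset_span ⟨i, rfl⟩))
    have key := ae_eq_zero_of_integral_fourier_mul (integrable_mul_conj s w) fun n => by
      rw [← inner_mulL_eq_integral (memLp_top_fourier n), ← inner_conj_symm]
      exact (congrArg _ (hw0 n)).trans (map_zero _)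
    refine Lp.ext ?_
    filter_upwards [key, coeFn_cut hAm w, hsc, Lp.coeFn_zero ℂ 2 𝔪] with t h1 h2 h3 h4
    rw [h2, h4]
    by_cases ht : t ∈ A
    · rw [Set.indicator_of_mem ht]
      have hρt : Real.sqrt (ρ t) ≠ 0 := fun h => ht ((Real.sqrt_eq_zero (hρ t)).1 h)
      rw [h3] at h1
      simpa [hρt] using h1
    · rw [Set.indicator_of_notMem ht]; rfl
  have hXcut : ∀ φ, X φ = X (cut 𝔪 A φ) := fun φ => by
    conv_lhs => rw [← cut_add_cut_compl hAm φ]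
    rw [map_add, hX0 _ (hcompl φ), add_zero]
  have hXN : ∀ φ ∈ N, X (shift 1 φ) = U (X φ) := fun φ hφ => by
    refine closure_minimal (s := (Submodule.span ℂ (Set.range a) : Set (Lp ℂ 2 𝔪)))
      (t := {φ | X (shift 1 φ) = U (X φ)}) ?_ ?_ hφ
    · intro φ hφ
      induction hφ using Submodule.span_induction with
      | mem u hu =>
        obtain ⟨i, rfl⟩ := hu
        change X (shift 1 (shift i s)) = U (X (a i))
        rw [hXa i, ← zpow_succ_apply, shift_shift, add_comm]
        exact hXa (i + 1)
      | zero => simp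
      | add u v _ _ hu hv =>
        simp only [Set.mem_ofPred_eq] at hu hv ⊢
        simp only [map_add, hu, hv]
      | smul c u _ hu =>
        simp only [Set.mem_ofPred_eq] at hu ⊢
        simp only [map_smul, hu]
    · exact isClosed_eq (X.continuous.comp (shift 1).continuous) (U.continuous.comp X.continuous)
  refine ⟨X, A, hAm, fun φ => ?_, fun φ => ?_, ⟨s, ?_⟩, hXr⟩
  · rw [hXcut (shift 1 φ), cut_shift hAm, hXN _ (hmem φ), ← hXcut]
  · rw [hXcut, hXn _ (hmem φ)]
  · rw [← shift_zero s]
    exact (hXa 0).trans (by simp)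

end

/-! ### Reducing subspaces and orthogonalization -/

section

variable {H : Type*} [NormedAddCommGroup H] [InnerProductSpace ℂ H] {U : H ≃ₗᵢ[ℂ] H}

lemma inner_eq_zero_of_mem_topologicalClosure_span {ι : Type*} {a : ι → H} {x : H}
    (h : ∀ i, inner ℂ x (a i) = 0) {y : H}
    (hy : y ∈ (Submodule.span ℂ (Set.range a)).topologicalClosure) : inner ℂ x y = 0 := by
  have : (Submodule.span ℂ (Set.range a)).topologicalClosure ≤
      LinearMap.ker (innerSL ℂ x).toLinearMap := by
    refine Submodule.topologicalClosure_minimal _ ?_ (innerSL ℂ x).isClosed_ker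
    rw [Submodule.span_le]
    rintro _ ⟨i, rfl⟩
    exact h i
  exact this hy

lemma eq_zero_of_inner_of_topologicalClosure_span_eq_top {ι : Type*} {a : ι → H}
    (ha : (Submodule.span ℂ (Set.range a)).topologicalClosure = ⊤) {x : H}
    (h : ∀ i, inner ℂ x (a i) = 0) : x = 0 :=
  (inner_self_eq_zero (𝕜 := ℂ)).1
    (inner_eq_zero_of_mem_topologicalClosure_span h (by rw [ha]; trivial))

/-- The subspace `R` is invariant under `U` and its inverse. -/
def Reduces (U : H ≃ₗᵢ[ℂ] H) (R : Submodule ℂ H) : Prop := ∀ x, U x ∈ R ↔ x ∈ R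

lemma Reduces.zpow {R : Submodule ℂ H} (h : Reduces U R) (n : ℤ) (x : H) :
    (U ^ n) x ∈ R ↔ x ∈ R := by
  refine zpow_apply_induction (p := fun n => (U ^ n) x ∈ R ↔ x ∈ R) Iff.rfl (fun n => ?_) n
  rw [zpow_succ_apply, h]

lemma Reduces.inf {R S : Submodule ℂ H} (hR : Reduces U R) (hS : Reduces U S) :
    Reduces U (R ⊓ S) := fun x => by
  simp only [Submodule.mem_inf, hR x, hS x]

lemma Reduces.orthogonal {R : Submodule ℂ H} (hR : Reduces U R) : Reduces U Rᗮ := fun x => by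
  simp only [Submodule.mem_orthogonal]
  refine ⟨fun h u hu => ?_, fun h u hu => ?_⟩
  · rw [← U.inner_map_map]; exact h _ ((hR u).2 hu)
  · obtain ⟨v, rfl⟩ := U.surjective u
    rw [U.inner_map_map]; exact h _ ((hR v).1 hu)

lemma Reduces.starProjection_map {R : Submodule ℂ H} [R.HasOrthogonalProjection]
    (hR : Reduces U R) (x : H) : R.starProjection (U x) = U (R.starProjection x) := by
  refine Submodule.eq_starProjection_of_mem_orthogonal ((hR _).2 (R.starProjection_apply_mem x)) ?_
  rw [← map_sub, hR.orthogonal]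
  exact Submodule.sub_starProjection_mem_orthogonal x

/-- `X` intertwines multiplication by the first character and `U`, and is a partial isometry
with initial space the functions supported on `A`. -/
structure PartialIntertwiner (U : H ≃ₗᵢ[ℂ] H) (X : Lp ℂ 2 𝔪 →L[ℂ] H) (A : Set UnitAddCircle) :
    Prop where
  measurableSet : MeasurableSet A
  intertwines : Intertwines U X
  norm_eq : ∀ φ, ‖X φ‖ = ‖cut 𝔪 A φ‖

lemma inner_eq_of_norm_eq {E F : Type*} [NormedAddCommGroup E] [InnerProductSpace ℂ E]
    [NormedAddCommGroup F] [InnerProductSpace ℂ F] {X : E →L[ℂ] H} {Y : E →L[ℂ] F}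
    (h : ∀ x, ‖X x‖ = ‖Y x‖) (x y : E) : inner ℂ (X x) (X y) = inner ℂ (Y x) (Y y) := by
  rw [inner_eq_sum_norm_sq_div_four, inner_eq_sum_norm_sq_div_four]
  simp only [← map_smul, ← map_add, ← map_sub, h]

lemma PartialIntertwiner.reduces_orthogonal_range {X : Lp ℂ 2 𝔪 →L[ℂ] H} {A : Set UnitAddCircle}
    (h : PartialIntertwiner U X A) : Reduces U (LinearMap.range X.toLinearMap)ᗮ := by
  refine Reduces.orthogonal fun x => ⟨?_, ?_⟩
  · rintro ⟨φ, hφ⟩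
    refine ⟨shift (-1) φ, U.injective ?_⟩
    rw [← hφ]
    change U (X _) = X φ
    rw [← h.intertwines, shift_shift, add_neg_cancel, shift_zero]
  · rintro ⟨φ, rfl⟩
    exact ⟨shift 1 φ, h.intertwines φ⟩

variable [CompleteSpace H]

/-- Inside a reducing subspace there is an intertwining partial isometry whose range captures
the component of a given vector with square summable correlations. -/
lemma exists_partialIntertwiner {R : Submodule ℂ H} (hR : IsClosed (R : Set H))
    (hUR : Reduces U R) {g : H} (hg : SquareSummable U g) :
    ∃ X A, PartialIntertwiner U X A ∧ (∀ φ, X φ ∈ R) ∧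
      ∀ y ∈ R, (∀ φ, inner ℂ y (X φ) = 0) → inner ℂ y g = 0 := by
  have : CompleteSpace R := hR.completeSpace_coe
  obtain ⟨X₀, -, -, hX₀, -, ⟨w₀, hw₀⟩, -⟩ := exists_intertwiner_of_squareSummable hg
  set Y : Lp ℂ 2 𝔪 →L[ℂ] H := R.starProjection ∘L X₀ with hY
  have hYi : Intertwines U Y := fun φ => by
    simp only [hY, ContinuousLinearMap.comp_apply]
    rw [hX₀, hUR.starProjection_map]
  have hYn : ∀ n : ℤ, Y (fourierLp 2 n) = (U ^ n) (Y (fourierLp 2 0)) := fun n => by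
    rw [← hYi.shift, shift_fourierLp, add_zero]
  have hYR : ∀ φ, Y φ ∈ R := fun φ => R.starProjection_apply_mem _
  -- Up to conjugation ⟨Y1, UⁿY1⟩ is a Fourier coefficient of the L² function Y*Y1, so Bessel's
  -- inequality applies.
  have hg' : SquareSummable U (Y (fourierLp 2 0)) := by
    have := orthonormal_fourier (T := 1).inner_products_summable
      (ContinuousLinearMap.adjoint Y (Y (fourierLp 2 0)))
    refine this.congr fun n => ?_
    rw [ContinuousLinearMap.adjoint_inner_right, hYn, norm_inner_symm]
  obtain ⟨X, A, hA, hXi, hXn, ⟨w, hw⟩, hXr⟩ := exists_intertwiner_of_squareSummable hg'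
  refine ⟨X, A, ⟨hA, hXi, hXn⟩, fun φ => ?_, fun y hy hyX => ?_⟩
  · refine Submodule.topologicalClosure_minimal _ ?_ hR (hXr φ)
    rw [Submodule.span_le]
    rintro _ ⟨n, rfl⟩
    exact (hUR.zpow n _).2 (hYR _)
  -- The vectors UⁿY1 = Yzⁿ span a dense part of the range of Y, and this range contains the
  -- projection `Y w₀` of g to R. For y in R, pairing with g is pairing with that projection.
  · have h1 : ContinuousLinearMap.adjoint Y y = 0 := by
      refine eq_zero_of_inner_of_topologicalClosure_span_eq_top
        (span_fourierLp_closure_eq_top (T := 1) (p := 2) (by norm_num)) fun n => ?_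
      rw [ContinuousLinearMap.adjoint_inner_left, hYn, ← hw, ← hXi.shift]
      exact hyX _
    have h2 : inner ℂ y (Y w₀) = 0 := by
      rw [← ContinuousLinearMap.adjoint_inner_left, h1, inner_zero_left]
    rw [hY, ContinuousLinearMap.comp_apply, hw₀, ← Submodule.inner_starProjection_left_eq_right,
      Submodule.starProjection_eq_self_iff.2 hy] at h2
    exact h2

/-- Gram–Schmidt orthogonalization of a sequence of vectors with square summable correlations
inside a reducing subspace. -/
lemma exists_orthogonal_partialIntertwiners {R : Submodule ℂ H} (hR : IsClosed (R : Set H))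
    (hUR : Reduces U R) {f : ℕ → H} (hf : ∀ i, SquareSummable U (f i)) :
    ∃ (X : ℕ → Lp ℂ 2 𝔪 →L[ℂ] H) (A : ℕ → Set UnitAddCircle),
      (∀ i, PartialIntertwiner U (X i) (A i)) ∧ (∀ i φ, X i φ ∈ R) ∧
      (∀ i j, i ≠ j → ∀ φ ψ, inner ℂ (X i φ) (X j ψ) = 0) ∧
      ∀ y ∈ R, (∀ i φ, inner ℂ y (X i φ) = 0) → ∀ i, inner ℂ y (f i) = 0 := by
  let S := {R : Submodule ℂ H // IsClosed (R : Set H) ∧ Reduces U R}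
  choose X A h1 h2 h3 using fun (R : S) (i : ℕ) =>
    exists_partialIntertwiner R.2.1 R.2.2 (hf i)
  -- Stage i removes from the remaining subspace the range of the partial intertwiner constructed
  -- there for `f i`.
  let next : ℕ → S → S := fun i R => ⟨R.1 ⊓ (LinearMap.range (X R i).toLinearMap)ᗮ,
    R.2.1.inter (Submodule.isClosed_orthogonal _), R.2.2.inf (h1 R i).reduces_orthogonal_range⟩
  let Q : ℕ → S := fun i => Nat.rec ⟨R, hR, hUR⟩ next i
  have hQ : ∀ i, Q (i + 1) = next i (Q i) := fun i => rfl
  have hanti : Antitone fun i => (Q i).1 := antitone_nat_of_succ_le fun i => by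
    rw [hQ]; exact inf_le_left
  have horth : ∀ i j, i < j → ∀ φ ψ, inner ℂ (X (Q i) i φ) (X (Q j) j ψ) = 0 :=
    fun i j hij φ ψ => by
      have : X (Q j) j ψ ∈ (Q (i + 1)).1 := hanti hij (h2 _ _ _)
      exact (Submodule.mem_orthogonal _ _).1 this.2 _ ⟨φ, rfl⟩
  refine ⟨fun i => X (Q i) i, fun i => A (Q i) i, fun i => h1 _ _, fun i φ => ?_,
    fun i j hij φ ψ => ?_, fun y hy hyX i => ?_⟩
  · exact hanti (Nat.zero_le i) (h2 (Q i) i φ)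
  · rcases hij.lt_or_gt with h | h
    · exact horth i j h φ ψ
    · rw [← inner_conj_symm, horth j i h ψ φ, map_zero]
  -- A vector of R orthogonal to all the ranges is never removed, so it lies in every `Q i`.
  · refine h3 (Q i) i y ?_ (hyX i)
    induction i with
    | zero => exact hy
    | succ i ih =>
      rw [hQ]
      refine ⟨ih, (Submodule.mem_orthogonal' _ _).2 ?_⟩
      rintro _ ⟨φ, rfl⟩
      exact hyX i φ

end

/-! ### Rotation of the spectrum -/

section

variable {H : Type*} [NormedAddCommGroup H] [InnerProductSpace ℂ H] {U : H ≃ₗᵢ[ℂ] H}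

/-- Translation of functions on the circle. -/
noncomputable def rotation (s : UnitAddCircle) : Lp ℂ 2 𝔪 →ₗᵢ[ℂ] Lp ℂ 2 𝔪 :=
  Lp.compMeasurePreservingₗᵢ ℂ (· + s) (measurePreserving_add_right 𝔪 s)

lemma coeFn_rotation (s : UnitAddCircle) (φ : Lp ℂ 2 𝔪) :
    rotation s φ =ᵐ[𝔪] fun t => φ (t + s) :=
  Lp.coeFn_compMeasurePreserving φ (measurePreserving_add_right 𝔪 s)

lemma rotation_shift (s : UnitAddCircle) (φ : Lp ℂ 2 𝔪) :
    rotation s (shift 1 φ) = (fourier 1 s : ℂ) • shift 1 (rotation s φ) := by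
  refine Lp.ext ?_
  filter_upwards [coeFn_rotation s (shift 1 φ), coeFn_rotation s φ,
    coeFn_shift 1 (rotation s φ), Lp.coeFn_smul (fourier 1 s : ℂ) (shift 1 (rotation s φ)),
    (measurePreserving_add_right 𝔪 s).quasiMeasurePreserving.ae (coeFn_shift 1 φ)]
    with t h1 h2 h3 h4 h5
  rw [h1, h4, Pi.smul_apply, h3, h2, h5, smul_eq_mul]
  simp only [fourier_apply, one_smul, AddCircle.toCircle_add, Circle.coe_mul]
  ring

lemma cut_rotation (s : UnitAddCircle) {A : Set UnitAddCircle} (hA : MeasurableSet A)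
    (φ : Lp ℂ 2 𝔪) :
    cut 𝔪 A (rotation s φ) = rotation s (cut 𝔪 ((· + -s) ⁻¹' A) φ) := by
  have hA' : MeasurableSet ((· + -s) ⁻¹' A) := hA.preimage (measurable_add_const _)
  refine Lp.ext ?_
  filter_upwards [coeFn_cut hA (rotation s φ), coeFn_rotation s φ,
    coeFn_rotation s (cut 𝔪 ((· + -s) ⁻¹' A) φ),
    (measurePreserving_add_right 𝔪 s).quasiMeasurePreserving.ae (coeFn_cut hA' φ)]
    with t h1 h2 h3 h4
  rw [h1, h3, h4]
  by_cases ht : t ∈ A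
  · rw [Set.indicator_of_mem ht, h2, Set.indicator_of_mem]
    simpa using ht
  · rw [Set.indicator_of_notMem ht, Set.indicator_of_notMem]
    simpa using ht

/-- A unitary that commutes with `U` up to a phase rotates the supports of partial
intertwiners. -/
lemma PartialIntertwiner.rotate {X : Lp ℂ 2 𝔪 →L[ℂ] H} {A : Set UnitAddCircle}
    (h : PartialIntertwiner U X A) {V : H ≃ₗᵢ[ℂ] H} {s : UnitAddCircle}
    (hUV : ∀ x, U (V x) = (fourier 1 s : ℂ) • V (U x)) :
    PartialIntertwiner U
      ((V.toContinuousLinearEquiv : H →L[ℂ] H) ∘L X ∘L (rotation s).toContinuousLinearMap)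
      ((· + -s) ⁻¹' A) where
  measurableSet := h.measurableSet.preimage (measurable_add_const _)
  intertwines φ := by
    change V (X (rotation s (shift 1 φ))) = U (V (X (rotation s φ)))
    rw [hUV, rotation_shift, map_smul, map_smul, h.intertwines]
  norm_eq φ := by
    change ‖V (X (rotation s φ))‖ = _
    rw [V.norm_map, h.norm_eq, cut_rotation s h.measurableSet, (rotation s).norm_map]

/-- Irrationality means that −y has infinite order in the circle (`addOrderOf` equal to 0), so
translation by it is ergodic. The union contains its own preimage and is therefore null or conull;
the term m = 0 is A, which is not null. -/
lemma iUnion_rotate_ae_eq_univ {y : ℝ} (hy : Irrational y) {A : Set UnitAddCircle}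
    (hA : MeasurableSet A) (hA0 : 𝔪 A ≠ 0) :
    (⋃ m : ℕ, (· + -(y : UnitAddCircle))^[m] ⁻¹' A) =ᵐ[𝔪] Set.univ := by
  have hinf : addOrderOf (-(y : UnitAddCircle)) = 0 := by
    rw [addOrderOf_neg, addOrderOf_eq_zero_iff']
    intro n hn h
    rw [← AddCircle.coe_nsmul, AddCircle.coe_eq_zero_iff] at h
    obtain ⟨k, hk⟩ := h
    refine (hy.natCast_mul hn.ne').ne_int k ?_
    simpa using hk.symm
  have herg : Ergodic (· + -(y : UnitAddCircle)) 𝔪 := by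
    rw [show (𝔪 : Measure UnitAddCircle) = volume by
      rw [AddCircle.volume_eq_smul_haarAddCircle]; simp]
    exact AddCircle.ergodic_add_right.2 hinf
  have hmeas : ∀ m : ℕ, MeasurableSet ((· + -(y : UnitAddCircle))^[m] ⁻¹' A) := fun m =>
    hA.preimage (herg.measurable.iterate m)
  set S : Set UnitAddCircle := ⋃ m : ℕ, (· + -(y : UnitAddCircle))^[m] ⁻¹' A with hS
  have hsub : (· + -(y : UnitAddCircle)) ⁻¹' S ⊆ S := fun t ht => by
    obtain ⟨m, hm⟩ := Set.mem_iUnion.1 (Set.mem_preimage.1 ht)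
    exact Set.mem_iUnion.2 ⟨m + 1, by rwa [Set.mem_preimage, Function.iterate_succ_apply]⟩
  refine (herg.ae_empty_or_univ_of_preimage_ae_le (MeasurableSet.iUnion hmeas).nullMeasurableSet
    hsub.eventuallyLE).resolve_left fun h => hA0 ?_
  refine measure_mono_null (Set.subset_iUnion_of_subset 0 ?_) (ae_eq_empty.1 h)
  simp

lemma inner_fourierLp_shift_cut {B : Set UnitAddCircle} (hB : MeasurableSet B) (n : ℤ) :
    inner ℂ (cut 𝔪 B (fourierLp 2 0)) (shift n (cut 𝔪 B (fourierLp 2 0))) =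
      ∫ t in B, (fourier n t : ℂ) ∂𝔪 := by
  rw [← cut_shift hB, inner_cut_left hB, cut_cut hB hB, Set.inter_self, shift_fourierLp, add_zero,
    cut, inner_mulL_eq_integral (memLp_top_indicator_one hB), ← integral_indicator hB]
  refine integral_congr_ae ?_
  filter_upwards [coeFn_fourierLp (T := 1) 2 0, coeFn_fourierLp (T := 1) 2 n] with t h1 h2
  rw [h1, h2]
  by_cases ht : t ∈ B <;> simp [ht]

variable [CompleteSpace H]

lemma summable_of_pairwise_orthogonal {x : ℕ → H} (hx : ∀ i j, i ≠ j → inner ℂ (x i) (x j) = 0)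
    (hs : Summable fun i => ‖x i‖ ^ 2) : Summable x := by
  have hO : OrthogonalFamily ℂ (fun i => Submodule.span ℂ {x i})
      fun i => (Submodule.span ℂ {x i}).subtypeₗᵢ :=
    OrthogonalFamily.of_pairwise fun i j hij => by
      rw [Function.onFun, Submodule.isOrtho_span]
      simpa using hx i j hij
  exact (hO.summable_iff_norm_sq_summable
    fun i => ⟨x i, Submodule.mem_span_singleton_self _⟩).2 hs

/-- A vector whose orbit is orthonormal generates an isometric intertwiner. -/
lemma exists_isometric_intertwiner {e : H}
    (he : ∀ n : ℤ, inner ℂ e ((U ^ n) e) = ∫ t, (fourier n t : ℂ) ∂𝔪) :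
    ∃ E : Lp ℂ 2 𝔪 →L[ℂ] H, Intertwines U E ∧ (∀ φ, ‖E φ‖ = ‖φ‖) ∧
      ∀ φ, E φ ∈ (Submodule.span ℂ (Set.range fun n : ℤ => (U ^ n) e)).topologicalClosure := by
  have hgram : ∀ i j : ℤ, inner ℂ (fourierLp (T := 1) 2 i) (fourierLp 2 j) =
      inner ℂ ((U ^ i) e) ((U ^ j) e) := fun i j => by
    rw [inner_zpow_zpow, he, ← add_zero i, ← shift_fourierLp, inner_shift_left, shift_fourierLp,
      add_zero, neg_add_eq_sub]
    have := inner_fourierLp_shift_cut MeasurableSet.univ (j - i)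
    rwa [cut_univ, shift_fourierLp, add_zero, setIntegral_univ] at this
  obtain ⟨E, hE, -, hEn, hEr⟩ := exists_partialIsometry hgram
  have htop : (Submodule.span ℂ (Set.range (fourierLp (T := 1) 2))).topologicalClosure = ⊤ :=
    span_fourierLp_closure_eq_top (by norm_num)
  refine ⟨E, fun φ => ?_, fun φ => hEn φ (by rw [htop]; trivial), hEr⟩
  have : E ∘L shift 1 = (U.toContinuousLinearEquiv : H →L[ℂ] H) ∘L E := by
    refine ContinuousLinearMap.ext_on (Submodule.dense_iff_topologicalClosure_eq_top.2 htop) ?_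
    rintro _ ⟨n, rfl⟩
    change E (shift 1 _) = U (E _)
    rw [shift_fourierLp, hE, hE, add_comm, zpow_succ_apply]
  exact DFunLike.congr_fun this φ

/-- A nonzero vector with square summable correlations yields, in the presence of a unitary that
commutes with `U` up to an irrational phase, an isometric intertwiner. -/
lemma exists_isometric_intertwiner_into {M : Submodule ℂ H} (hM : IsClosed (M : Set H))
    (hUM : Reduces U M) {V : H ≃ₗᵢ[ℂ] H} {y : ℝ} (hy : Irrational y)
    (hUV : ∀ x, U (V x) = (fourier 1 (y : UnitAddCircle) : ℂ) • V (U x))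
    (hVM : ∀ x ∈ M, V x ∈ M) {f : H} (hf : SquareSummable U f) (hfM : f ∈ M) (hf0 : f ≠ 0) :
    ∃ E : Lp ℂ 2 𝔪 →L[ℂ] H, Intertwines U E ∧ (∀ φ, ‖E φ‖ = ‖φ‖) ∧ ∀ φ, E φ ∈ M := by
  obtain ⟨X₀, A₀, h₀, h₀M, h₀f⟩ := exists_partialIntertwiner hM hUM hf
  have hA₀ : 𝔪 A₀ ≠ 0 := fun h => by
    refine hf0 (inner_self_eq_zero.1 (h₀f f hfM fun φ => ?_))
    have : cut 𝔪 A₀ φ = 0 := by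
      refine Lp.ext ?_
      filter_upwards [coeFn_cut h₀.measurableSet φ, Lp.coeFn_zero ℂ 2 𝔪,
        measure_eq_zero_iff_ae_notMem.1 h] with t h1 h2 h3
      rw [h1, h2, Set.indicator_of_notMem h3]; rfl
    rw [norm_eq_zero.1 ((h₀.norm_eq φ).trans (by rw [this, norm_zero])), inner_zero_right]
  set s : UnitAddCircle := (y : UnitAddCircle) with hs
  -- Each application of V rotates the support once more and stays in M.
  have hX : ∀ m : ℕ, ∃ X, PartialIntertwiner U X ((· + -s)^[m] ⁻¹' A₀) ∧ ∀ φ, X φ ∈ M := by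
    intro m
    induction m with
    | zero => exact ⟨X₀, h₀, h₀M⟩
    | succ m ih =>
      obtain ⟨X, h, hXM⟩ := ih
      exact ⟨_, h.rotate hUV, fun φ => hVM _ (hXM _)⟩
  choose X h hXM using hX
  set B : ℕ → Set UnitAddCircle := disjointed fun m => (· + -s)^[m] ⁻¹' A₀ with hBdef
  have hBm : ∀ m, MeasurableSet (B m) := fun m =>
    MeasurableSet.disjointed (fun m => (h m).measurableSet) m
  have hBd : Pairwise (Function.onFun Disjoint B) := disjoint_disjointed _
  have hBU : (⋃ m, B m) =ᵐ[𝔪] Set.univ := by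
    rw [hBdef, iUnion_disjointed]
    exact iUnion_rotate_ae_eq_univ hy h₀.measurableSet hA₀
  -- `x m` has as spectral measure the restriction of Haar measure to `B m`. The `B m` are disjoint
  -- and cover the circle up to a null set, so the cross terms vanish and the sum of the `x m` has
  -- exactly Haar measure as spectral measure.
  set x : ℕ → H := fun m => X m (cut 𝔪 (B m) (fourierLp 2 0)) with hx
  have hxn : ∀ m (n : ℤ), inner ℂ (x m) ((U ^ n) (x m)) = ∫ t in B m, (fourier n t : ℂ) ∂𝔪 :=
    fun m n => by
      rw [hx, ← (h m).intertwines.shift, inner_eq_of_norm_eq (h m).norm_eq,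
        cut_shift (h m).measurableSet, cut_cut (h m).measurableSet (hBm m),
        Set.inter_eq_right.2 (disjointed_subset (fun m => (· + -s)^[m] ⁻¹' A₀) m),
        inner_fourierLp_shift_cut (hBm m)]
  have hxo : ∀ i j, i ≠ j → ∀ n : ℤ, inner ℂ (x i) ((U ^ n) (x j)) = 0 := fun i j hij n => by
    rw [hx, ← (h j).intertwines.shift, ← cut_shift (hBm j)]
    exact (h i).intertwines.inner_cut_of_disjoint (h j).intertwines (hBm i) (hBm j) (hBd hij) _ _
  have hint : ∀ n : ℤ, Integrable (fun t => (fourier n t : ℂ)) 𝔪 := fun n =>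
    (memLp_top_fourier n).integrable le_top
  have hxs : ∀ n : ℤ, HasSum (fun m => inner ℂ (x m) ((U ^ n) (x m)))
      (∫ t, (fourier n t : ℂ) ∂𝔪) := fun n => by
    simp_rw [hxn]
    have := hasSum_integral_iUnion (μ := 𝔪) hBm hBd (hint n).integrableOn
    rwa [setIntegral_congr_set hBU, setIntegral_univ] at this
  have hsum : Summable x := by
    refine summable_of_pairwise_orthogonal (fun i j hij => hxo i j hij 0) ?_
    have := (hxs 0).summable.norm
    refine this.congr fun m => ?_
    rw [zpow_zero]
    change ‖inner ℂ (x m) (x m)‖ = _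
    rw [inner_self_eq_norm_sq_to_K]
    simp
  have hsumU : ∀ n : ℤ, HasSum (fun m => (U ^ n) (x m)) ((U ^ n) (∑' m, x m)) := fun n =>
    hsum.hasSum.map (U ^ n) (U ^ n).continuous
  obtain ⟨E, hEi, hEn, hEr⟩ := exists_isometric_intertwiner (U := U) (e := ∑' m, x m) fun n => by
    refine ((innerSL ℂ (∑' m, x m)).hasSum (hsumU n)).unique ?_
    have hj : ∀ j, inner ℂ (x j) ((U ^ n) (x j)) = inner ℂ (∑' m, x m) ((U ^ n) (x j)) := ?_
    · have := hxs n
      simp_rw [hj] at this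
      exact this
    intro j
    refine HasSum.unique ?_ ((innerSLFlip ℂ ((U ^ n) (x j))).hasSum hsum.hasSum)
    exact hasSum_single j fun i hij => hxo i j hij n
  refine ⟨E, hEi, hEn, fun φ => ?_⟩
  have heM : ∑' m, x m ∈ M := by
    refine hM.mem_of_tendsto hsum.hasSum (Eventually.of_forall fun F => ?_)
    exact Submodule.sum_mem _ fun m _ => hXM m _
  refine Submodule.topologicalClosure_minimal _ ?_ hM (hEr φ)
  rw [Submodule.span_le]
  rintro _ ⟨n, rfl⟩
  exact (hUM.zpow n _).2 heM

end

/-! ### The criterion for countable Lebesgue spectrum -/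

section

variable {H : Type*} [NormedAddCommGroup H] [InnerProductSpace ℂ H] {U : H ≃ₗᵢ[ℂ] H}
  [CompleteSpace H]

/-- A partial intertwiner followed by infinitely many isometric ones, all with mutually orthogonal
ranges, generate a space that is spanned by the mutually orthogonal ranges of isometric
intertwiners. The `i`-th such system is `X i, E i 0, E i 1, …`. -/
lemma exists_isometric_of_partial {X : ℕ → Lp ℂ 2 𝔪 →L[ℂ] H} {A : ℕ → Set UnitAddCircle}
    (hX : ∀ i, PartialIntertwiner U (X i) (A i)) {E : ℕ → ℕ → Lp ℂ 2 𝔪 →L[ℂ] H}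
    (hEi : ∀ i k, Intertwines U (E i k)) (hEn : ∀ i k φ, ‖E i k φ‖ = ‖φ‖)
    (hXX : ∀ i j, i ≠ j → ∀ φ ψ, inner ℂ (X i φ) (X j ψ) = 0)
    (hXE : ∀ i j k φ ψ, inner ℂ (X i φ) (E j k ψ) = 0)
    (hEE : ∀ i j k l, (i, k) ≠ (j, l) → ∀ φ ψ, inner ℂ (E i k φ) (E j l ψ) = 0)
    {K : Submodule ℂ H} (hXK : ∀ i φ, X i φ ∈ K) (hEK : ∀ i k φ, E i k φ ∈ K) :
    ∃ G : ℕ × ℕ → Lp ℂ 2 𝔪 →L[ℂ] H, (∀ p, Intertwines U (G p)) ∧ (∀ p φ, ‖G p φ‖ = ‖φ‖) ∧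
      (∀ p q, p ≠ q → ∀ φ ψ, inner ℂ (G p φ) (G q ψ) = 0) ∧ (∀ p φ, G p φ ∈ K) ∧
      ∀ x, (∀ p φ, inner ℂ x (G p φ) = 0) →
        (∀ i φ, inner ℂ x (X i φ) = 0) ∧ ∀ i k φ, inner ℂ x (E i k φ) = 0 := by
  obtain ⟨Y, hY0, hYs⟩ : ∃ Y : ℕ × ℕ → Lp ℂ 2 𝔪 →L[ℂ] H,
      (∀ i, Y (i, 0) = X i) ∧ ∀ i k, Y (i, k + 1) = E i k :=
    ⟨fun p => Nat.casesOn p.2 (X p.1) (E p.1), fun i => rfl, fun i k => rfl⟩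
  have hA := fun i => (hX i).measurableSet
  have hYi : ∀ p, Intertwines U (Y p) := by
    rintro ⟨i, _ | k⟩
    · rw [hY0]; exact (hX i).intertwines
    · rw [hYs]; exact hEi i k
  have hYA : ∀ i k φ, ‖Y (i, k) (cut 𝔪 (A i) φ)‖ = ‖cut 𝔪 (A i) φ‖ := by
    rintro i (_ | k) φ
    · rw [hY0, (hX i).norm_eq, cut_cut (hA i) (hA i), Set.inter_self]
    · rw [hYs]; exact hEn i k _
  have hYn : ∀ i k φ, ‖Y (i, k + 1) φ‖ = ‖φ‖ := fun i k φ => by rw [hYs, hEn]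
  have hYY : ∀ p q, p ≠ q → ∀ φ ψ, inner ℂ (Y p φ) (Y q ψ) = 0 := by
    rintro ⟨i, _ | k⟩ ⟨j, _ | l⟩ hpq φ ψ
    · rw [hY0, hY0]; exact hXX i j (fun h => hpq (by rw [h])) φ ψ
    · rw [hY0, hYs]; exact hXE i j l φ ψ
    · rw [hY0, hYs, ← inner_conj_symm]
      exact (congrArg _ (hXE j i k ψ φ)).trans (map_zero _)
    · rw [hYs, hYs]
      refine hEE i j k l (fun h => hpq ?_) φ ψ
      rw [Prod.mk.injEq] at h
      rw [h.1, h.2]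
  have hYK : ∀ p φ, Y p φ ∈ K := by
    rintro ⟨i, _ | k⟩ φ
    · rw [hY0]; exact hXK i φ
    · rw [hYs]; exact hEK i k φ
  have hYd : ∀ p q, ∀ B C : Set UnitAddCircle, MeasurableSet B → MeasurableSet C →
      (p = q → Disjoint B C) → ∀ φ ψ, inner ℂ (Y p (cut 𝔪 B φ)) (Y q (cut 𝔪 C ψ)) = 0 := by
    intro p q B C hB hC h φ ψ
    by_cases hpq : p = q
    · exact (hYi p).inner_cut_of_disjoint (hYi q) hB hC (h hpq) φ ψ
    · exact hYY p q hpq _ _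
  -- Hilbert's hotel: `G (i, k)` uses `Y (i, k)` over `A i` and borrows `Y (i, k + 1)` over the
  -- complement. Since `X i` lives only over `A i`, each part of each `Y (i, k)` is used exactly
  -- once.
  let G : ℕ × ℕ → Lp ℂ 2 𝔪 →L[ℂ] H := fun p =>
    Y p ∘L cut 𝔪 (A p.1) + Y (p.1, p.2 + 1) ∘L cut 𝔪 (A p.1)ᶜ
  have hG : ∀ p φ, G p φ = Y p (cut 𝔪 (A p.1) φ) + Y (p.1, p.2 + 1) (cut 𝔪 (A p.1)ᶜ φ) :=
    fun p φ => rfl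
  refine ⟨G, fun p φ => ?_, fun p φ => ?_, fun p q hpq φ ψ => ?_, fun p φ => ?_, fun x hx => ?_⟩
  · rw [hG, hG, cut_shift (hA _), cut_shift (hA _).compl, hYi, hYi, map_add]
  · refine (pow_left_inj₀ (norm_nonneg _) (norm_nonneg _) two_ne_zero).1 ?_
    rw [hG, @norm_add_sq ℂ, hYd _ _ _ _ (hA _) (hA _).compl fun _ => disjoint_compl_right,
      hYA p.1 p.2, hYn, ← norm_sq_cut_add_cut_compl (hA p.1) φ]
    simp
  · rw [hG, hG, inner_add_left, inner_add_right, inner_add_right, hYY _ _ hpq, hYd, hYd, hYY]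
    · simp
    · intro h
      rw [Prod.mk.injEq, Nat.add_right_cancel_iff] at h
      exact hpq (Prod.ext h.1 h.2)
    · exact (hA _).compl
    · exact hA _
    · intro h
      rw [← h]
      exact disjoint_compl_left
    · exact hA _
    · exact (hA _).compl
    · intro h
      rw [h]
      exact disjoint_compl_right
  · rw [hG]
    exact K.add_mem (hYK _ _) (hYK _ _)
  -- Testing against functions supported on `A i`, or on its complement, isolates the two summands
  -- of G.
  · have hYA0 : ∀ p φ, inner ℂ x (Y p (cut 𝔪 (A p.1) φ)) = 0 := fun p φ => by
      have := hx p (cut 𝔪 (A p.1) φ)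
      rwa [hG, cut_cut (hA _) (hA _), cut_cut (hA _).compl (hA _), Set.inter_self,
        Set.compl_inter_self, cut_empty, map_zero, add_zero] at this
    have hYA1 : ∀ i k φ, inner ℂ x (Y (i, k + 1) (cut 𝔪 (A i)ᶜ φ)) = 0 := fun i k φ => by
      have := hx (i, k) (cut 𝔪 (A i)ᶜ φ)
      rwa [hG, cut_cut (hA _) (hA _).compl, cut_cut (hA _).compl (hA _).compl, Set.inter_self,
        Set.inter_compl_self, cut_empty, map_zero, zero_add] at this
    refine ⟨fun i φ => ?_, fun i k φ => ?_⟩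
    · have h0 : X i (cut 𝔪 (A i)ᶜ φ) = 0 := by
        rw [← norm_eq_zero, (hX i).norm_eq, cut_cut (hA i) (hA i).compl, Set.inter_compl_self,
          cut_empty, norm_zero]
      rw [← cut_add_cut_compl (hA i) φ, map_add, h0, add_zero]
      rw [← hY0]
      exact hYA0 (i, 0) φ
    · rw [← hYs, ← cut_add_cut_compl (hA i) φ, map_add, inner_add_right]
      exact (congrArg₂ (· + ·) (hYA0 (i, k + 1) φ) (hYA1 i k φ)).trans (add_zero 0)

/-- A criterion for countable Lebesgue spectrum: a total family of vectors with square summable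
correlations, and infinitely many mutually orthogonal reducing subspaces in which the spectrum is
invariant under an irrational rotation. -/
theorem hasCountableLebesgueSpectrumOn_of_squareSummable {K : Submodule ℂ H}
    (hK : IsClosed (K : Set H)) (hUK : Reduces U K) {f : ℕ → H}
    (hf : ∀ i, SquareSummable U (f i)) (hfK : ∀ x ∈ K, (∀ i, inner ℂ x (f i) = 0) → x = 0)
    {V : H ≃ₗᵢ[ℂ] H} {y : ℝ} (hy : Irrational y)
    (hUV : ∀ x, U (V x) = (fourier 1 (y : UnitAddCircle) : ℂ) • V (U x))
    {M : ℕ → Submodule ℂ H} (hM : ∀ k, IsClosed (M k : Set H)) (hUM : ∀ k, Reduces U (M k))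
    (hVM : ∀ k, ∀ x ∈ M k, V x ∈ M k) (hMK : ∀ k, M k ≤ K)
    (hMM : ∀ k l, k ≠ l → ∀ x ∈ M k, ∀ z ∈ M l, inner ℂ x z = 0)
    {v : ℕ → H} (hv : ∀ k, SquareSummable U (v k)) (hvM : ∀ k, v k ∈ M k) (hv0 : ∀ k, v k ≠ 0) :
    HasCountableLebesgueSpectrumOn U.toLinearIsometry K := by
  choose E hEi hEn hEM using fun k => exists_isometric_intertwiner_into (hM k) (hUM k) hy hUV
    (hVM k) (hv k) (hvM k) (hv0 k)
  have hEE : ∀ k l, k ≠ l → ∀ φ ψ, inner ℂ (E k φ) (E l ψ) = 0 := fun k l hkl φ ψ =>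
    hMM k l hkl _ (hEM k φ) _ (hEM l ψ)
  have hE : ∀ k, PartialIntertwiner U (E k) Set.univ := fun k =>
    ⟨MeasurableSet.univ, hEi k, fun φ => by rw [hEn, cut_univ]⟩
  -- R is what the full Lebesgue copies leave of K; it is exhausted below by partial copies.
  set R : Submodule ℂ H := K ⊓ ⨅ k, (LinearMap.range (E k).toLinearMap)ᗮ with hR
  have hRc : IsClosed (R : Set H) := by
    rw [hR, Submodule.coe_inf, Submodule.coe_iInf]
    exact hK.inter (isClosed_iInter fun k => Submodule.isClosed_orthogonal _)
  have hUR : Reduces U R := hUK.inf fun x => by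
    simp only [Submodule.mem_iInf]
    exact forall_congr' fun k => (hE k).reduces_orthogonal_range x
  obtain ⟨X, A, hX, hXR, hXX, hXf⟩ := exists_orthogonal_partialIntertwiners hRc hUR hf
  -- `Nat.pair` distributes the single sequence of full copies into infinitely many for each partial
  -- copy `X i`.
  obtain ⟨G, hGi, hGn, hGG, hGK, hG⟩ := exists_isometric_of_partial hX
    (E := fun i k => E (Nat.pair i k)) (fun i k => hEi _) (fun i k => hEn _) hXX
    (fun i j k φ ψ => by
      rw [← inner_conj_symm]
      exact (congrArg _ ((Submodule.mem_orthogonal _ _).1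
        ((Submodule.mem_iInf _).1 (hXR i φ).2 (Nat.pair j k)) _ ⟨ψ, rfl⟩)).trans (map_zero _))
    (fun i j k l h => hEE _ _ fun h' => h (Prod.ext (Nat.pair_eq_pair.1 h').1
      (Nat.pair_eq_pair.1 h').2))
    (fun i φ => (hXR i φ).1) (fun i k φ => hMK _ (hEM _ φ))
  have hGin : ∀ p φ ψ, inner ℂ (G p φ) (G p ψ) = inner ℂ φ ψ := fun p φ ψ =>
    inner_eq_of_norm_eq (Y := ContinuousLinearMap.id ℂ _) (hGn p) φ ψ
  refine ⟨fun j n => G (Nat.unpair j) (fourierLp 2 n), ?_, ?_, fun j n => ?_⟩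
  · rw [orthonormal_iff_ite]
    rintro ⟨i, m⟩ ⟨j, n⟩
    by_cases hij : i = j
    · subst hij
      rw [hGin, orthonormal_iff_ite.1 (orthonormal_fourier (T := 1))]
      simp
    · rw [hGG _ _ fun h => hij ?_, if_neg fun h => hij (Prod.mk.inj h).1]
      rw [← Nat.pair_unpair i, ← Nat.pair_unpair j, h]
  · set S := (Submodule.span ℂ (Set.range fun p : ℕ × ℤ =>
      G (Nat.unpair p.1) (fourierLp 2 p.2))).topologicalClosure with hS
    have hSc : IsClosed (S : Set H) := Submodule.isClosed_topologicalClosure _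
    have : CompleteSpace S := hSc.completeSpace_coe
    have hSK : S ≤ K := by
      refine Submodule.topologicalClosure_minimal _ ?_ hK
      rw [Submodule.span_le]
      rintro _ ⟨p, rfl⟩
      exact hGK _ _
    refine le_antisymm hSK fun x hx => ?_
    have hz : x - S.starProjection x ∈ Sᗮ := Submodule.sub_starProjection_mem_orthogonal x
    have hzK : x - S.starProjection x ∈ K :=
      K.sub_mem hx (hSK (Submodule.starProjection_apply_mem _ _))
    set z := x - S.starProjection x with hzdef
    have hzG : ∀ p φ, inner ℂ z (G p φ) = 0 := fun p φ => by
      rw [← ContinuousLinearMap.adjoint_inner_left]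
      suffices ContinuousLinearMap.adjoint (G p) z = 0 by rw [this, inner_zero_left]
      refine eq_zero_of_inner_of_topologicalClosure_span_eq_top
        (span_fourierLp_closure_eq_top (T := 1) (p := 2) (by norm_num)) fun n => ?_
      rw [ContinuousLinearMap.adjoint_inner_left]
      refine (Submodule.mem_orthogonal' _ _).1 hz _ (Submodule.le_topologicalClosure _
        (Submodule.subset_span ⟨(Nat.pair p.1 p.2, n), ?_⟩))
      simp
    obtain ⟨hzX, hzE⟩ := hG z hzG
    -- Orthogonality to the full copies places z in R; orthogonality to the partial ones then makes
    -- it orthogonal to all `f i`, and totality gives z = 0.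
    have hzR : z ∈ R := by
      refine ⟨hzK, (Submodule.mem_iInf _).2 fun k => (Submodule.mem_orthogonal' _ _).2 ?_⟩
      rintro _ ⟨φ, rfl⟩
      have := hzE (Nat.unpair k).1 (Nat.unpair k).2 φ
      rwa [Nat.pair_unpair] at this
    have hz0 : z = 0 := hfK z hzK (hXf z hzR hzX)
    rw [sub_eq_zero.1 (hzdef.symm.trans hz0)]
    exact Submodule.starProjection_apply_mem _ _
  · change U _ = _
    rw [← hGi, shift_fourierLp, add_comm]

end

/-! ### Oscillatory integrals -/

section Oscillatory

/-- A first derivative test for oscillatory integrals. -/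
lemma norm_integral_exp_le {Φ Φ' Φ'' : ℝ → ℝ} (h1 : ∀ t, HasDerivAt Φ (Φ' t) t)
    (h2 : ∀ t, HasDerivAt Φ' (Φ'' t) t) (hc : Continuous Φ'') {a c : ℝ} (ha : 0 < a)
    (hΦ' : ∀ t, a ≤ |Φ' t|) (hΦ'' : ∀ t, |Φ'' t| ≤ c) :
    ‖∫ t in (0 : ℝ)..1, Complex.exp (Complex.I * Φ t)‖ ≤ 2 / a + c / a ^ 2 := by
  have hne : ∀ t, (Φ' t : ℂ) ≠ 0 := fun t => by
    have := ha.trans_le (hΦ' t)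
    exact_mod_cast abs_pos.1 this
  have hc0 : Continuous Φ := continuous_iff_continuousAt.2 fun t => (h1 t).continuousAt
  have hc1 : Continuous Φ' := continuous_iff_continuousAt.2 fun t => (h2 t).continuousAt
  have hexp : ∀ t, ‖Complex.exp (Complex.I * Φ t)‖ = 1 := fun t => by
    rw [mul_comm, Complex.norm_exp_ofReal_mul_I]
  have hv : ∀ t, HasDerivAt (fun t => Complex.exp (Complex.I * Φ t))
      (Complex.exp (Complex.I * Φ t) * (Complex.I * Φ' t)) t := fun t =>
    (((h1 t).ofReal_comp).const_mul Complex.I).cexp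
  have hu : ∀ t, HasDerivAt (fun t => (Complex.I * (Φ' t : ℂ))⁻¹)
      (-(Complex.I * Φ'' t) / (Complex.I * (Φ' t : ℂ)) ^ 2) t := fun t =>
    (((h2 t).ofReal_comp).const_mul Complex.I).inv (mul_ne_zero Complex.I_ne_zero (hne t))
  have hu'c : Continuous fun t => -(Complex.I * (Φ'' t : ℂ)) / (Complex.I * (Φ' t : ℂ)) ^ 2 := by
    refine Continuous.div (by fun_prop) (by fun_prop) fun t => ?_
    exact pow_ne_zero _ (mul_ne_zero Complex.I_ne_zero (hne t))
  -- Integration by parts with exp(iΦ) = (iΦ')⁻¹ · (exp(iΦ))': the two boundary terms give 2/a, and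
  -- the derivative of (iΦ')⁻¹ gives c/a².
  have hibp := intervalIntegral.integral_mul_deriv_eq_deriv_mul (a := 0) (b := 1)
    (fun t _ => hu t) (fun t _ => hv t) (hu'c.intervalIntegrable _ _)
    (Continuous.intervalIntegrable (by fun_prop) _ _)
  have e : ∀ t, (Complex.I * (Φ' t : ℂ))⁻¹ *
      (Complex.exp (Complex.I * Φ t) * (Complex.I * Φ' t)) = Complex.exp (Complex.I * Φ t) :=
    fun t => by
      rw [mul_left_comm, inv_mul_cancel₀ (mul_ne_zero Complex.I_ne_zero (hne t)), mul_one]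
  simp_rw [e] at hibp
  rw [hibp]
  have hinv : ∀ t, ‖(Complex.I * (Φ' t : ℂ))⁻¹‖ ≤ 1 / a := fun t => by
    rw [norm_inv, norm_mul, Complex.norm_I, one_mul, Complex.norm_real, Real.norm_eq_abs, ← one_div]
    exact one_div_le_one_div_of_le ha (hΦ' t)
  have hint : ‖∫ t in (0 : ℝ)..1, -(Complex.I * (Φ'' t : ℂ)) / (Complex.I * (Φ' t : ℂ)) ^ 2 *
      Complex.exp (Complex.I * Φ t)‖ ≤ c / a ^ 2 * |1 - 0| := by
    refine intervalIntegral.norm_integral_le_of_norm_le_const fun t _ => ?_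
    rw [norm_mul, hexp, mul_one, norm_div, norm_neg, norm_mul, norm_pow, norm_mul, Complex.norm_I,
      one_mul, one_mul, Complex.norm_real, Complex.norm_real, Real.norm_eq_abs, Real.norm_eq_abs]
    have h0 : 0 ≤ c := (abs_nonneg _).trans (hΦ'' t)
    gcongr
    · exact hΦ'' t
    · exact hΦ' t
  rw [sub_zero, abs_one, mul_one] at hint
  refine (norm_sub_le _ _).trans (add_le_add ?_ hint)
  refine (norm_sub_le _ _).trans ?_
  rw [norm_mul, norm_mul, hexp, hexp, mul_one, mul_one]
  refine (add_le_add (hinv 1) (hinv 0)).trans_eq (by ring)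

end Oscillatory

/-! ### Calculus and characters on the torus -/

section Torus

lemma integral_circle {E : Type*} [NormedAddCommGroup E] [NormedSpace ℝ E]
    (f : UnitAddCircle → E) : ∫ t, f t ∂𝔪 = ∫ t in (0 : ℝ)..1, f t := by
  have h := AddCircle.intervalIntegral_preimage 1 0 f
  rw [zero_add] at h
  rw [h, AddCircle.volume_eq_smul_haarAddCircle]
  simp

variable {n : ℕ}

/-- Fubini's theorem along the orbits of translations of one coordinate. -/
lemma integral_eq_integral_integral_single {E : Type*} [NormedAddCommGroup E] [NormedSpace ℝ E]
    [CompleteSpace E] {F : Torus n → E} (hF : Continuous F) (i : Fin n) :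
    ∫ x, F x ∂(haar n) = ∫ x, ∫ t, F (x + (Pi.single i t : Torus n)) ∂𝔪 ∂(haar n) := by
  have hc : Continuous fun p : Torus n × UnitAddCircle => F (p.1 + (Pi.single i p.2 : Torus n)) := by
    refine hF.comp (continuous_fst.add ?_)
    exact (continuous_single i).comp continuous_snd
  have hint : Integrable (fun p : Torus n × UnitAddCircle => F (p.1 + (Pi.single i p.2 : Torus n)))
      ((haar n).prod 𝔪) :=
    hc.integrable_of_hasCompactSupport (HasCompactSupport.of_compactSpace _)
  rw [integral_integral_swap hint]
  simp_rw [integral_add_right_eq_self]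
  simp

/-- This reduces estimates of correlations to one-dimensional oscillatory integrals along circles;
no factor is lost because the torus has measure one. -/
lemma norm_integral_le_of_norm_integral_single_le {F : Torus n → ℂ} (hF : Continuous F)
    (i : Fin n) {C : ℝ} (hC : ∀ x, ‖∫ t, F (x + (Pi.single i t : Torus n)) ∂𝔪‖ ≤ C) :
    ‖∫ x, F x ∂(haar n)‖ ≤ C := by
  rw [integral_eq_integral_integral_single hF i]
  simpa using norm_integral_le_of_norm_le_const (μ := haar n) (ae_of_all _ hC)

/-- The lift of a function on the torus to the Euclidean space. -/
def lift (h : Torus n → ℝ) (x : Fin n → ℝ) : ℝ := h fun i => (x i : UnitAddCircle)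

/-- The partial derivative of a function on the torus. -/
noncomputable def partialDeriv (i : Fin n) (h : Torus n → ℝ) (x : Torus n) : ℝ :=
  deriv (fun t : ℝ => h (x + Pi.single i (t : UnitAddCircle))) 0

lemma exists_lift (x : Torus n) : ∃ z : Fin n → ℝ, (fun i => (z i : UnitAddCircle)) = x := by
  choose z hz using fun i => QuotientAddGroup.mk_surjective (x i)
  exact ⟨z, funext hz⟩

lemma lift_add_smul_single (h : Torus n → ℝ) (z : Fin n → ℝ) (i : Fin n) (t : ℝ) :
    lift h (z + t • Pi.single i 1) =
      h ((fun k => (z k : UnitAddCircle)) + Pi.single i (t : UnitAddCircle)) := by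
  rw [lift]
  congr 1
  funext k
  by_cases hk : k = i
  · subst hk; simp
  · simp [hk]

lemma hasDerivAt_lift {h : Torus n → ℝ} (hh : Differentiable ℝ (lift h)) (z : Fin n → ℝ)
    (i : Fin n) (t : ℝ) :
    HasDerivAt (fun t : ℝ => lift h (z + t • Pi.single i 1))
      (fderiv ℝ (lift h) (z + t • Pi.single i 1) (Pi.single i 1)) t := by
  have h1 : HasDerivAt (fun t : ℝ => z + t • (Pi.single i 1 : Fin n → ℝ)) (Pi.single i 1) t := by
    simpa using ((hasDerivAt_id t).smul_const (Pi.single i (1 : ℝ) : Fin n → ℝ)).const_add z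
  exact (hh _).hasFDerivAt.comp_hasDerivAt t h1

lemma lift_partialDeriv {h : Torus n → ℝ} (hh : Differentiable ℝ (lift h)) (i : Fin n) :
    lift (partialDeriv i h) = fun z => fderiv ℝ (lift h) z (Pi.single i 1) := by
  funext z
  have := hasDerivAt_lift hh z i 0
  rw [zero_smul, add_zero] at this
  rw [← this.deriv]
  simp_rw [lift_add_smul_single]
  rfl

lemma contDiff_lift_partialDeriv {h : Torus n → ℝ} {k : ℕ} (hh : ContDiff ℝ (k + 1) (lift h))
    (i : Fin n) : ContDiff ℝ k (lift (partialDeriv i h)) := by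
  rw [lift_partialDeriv (hh.differentiable (by simp))]
  exact (hh.fderiv_right le_rfl).clm_apply contDiff_const

lemma hasDerivAt_partialDeriv {h : Torus n → ℝ} (hh : Differentiable ℝ (lift h)) (i : Fin n)
    (x : Torus n) (t : ℝ) :
    HasDerivAt (fun t : ℝ => h (x + Pi.single i (t : UnitAddCircle)))
      (partialDeriv i h (x + Pi.single i (t : UnitAddCircle))) t := by
  obtain ⟨z, rfl⟩ := exists_lift x
  rw [← lift_add_smul_single (partialDeriv i h), lift_partialDeriv hh]
  simp_rw [← lift_add_smul_single h]
  exact hasDerivAt_lift hh z i t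

lemma continuous_of_continuous_lift {h : Torus n → ℝ} (hh : Continuous (lift h)) :
    Continuous h := by
  have hq : IsOpenQuotientMap
      (Pi.map fun (_ : Fin n) (t : ℝ) => (t : UnitAddCircle)) :=
    IsOpenQuotientMap.piMap fun _ => QuotientAddGroup.isOpenQuotientMap_mk
  exact hq.isQuotientMap.continuous_iff.2 hh

/-- The derivative of a periodic function integrates to zero over a period. Mean zero is what keeps
the Birkhoff sums of this derivative below the linear part of the phase. -/
lemma integral_partialDeriv {h : Torus n → ℝ} (hh : ContDiff ℝ 1 (lift h)) (i : Fin n) :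
    ∫ x, partialDeriv i h x ∂(haar n) = 0 := by
  have hc : Continuous (partialDeriv i h) :=
    continuous_of_continuous_lift (contDiff_lift_partialDeriv (k := 0) (by simpa using hh) i).continuous
  rw [integral_eq_integral_integral_single hc i]
  refine integral_eq_zero_of_ae (ae_of_all _ fun x => ?_)
  simp only [Pi.zero_apply]
  rw [integral_circle, intervalIntegral.integral_eq_sub_of_hasDerivAt
    (fun t _ => hasDerivAt_partialDeriv (hh.differentiable (by simp)) i x t)]
  · have h1 : ((1 : ℝ) : UnitAddCircle) = 0 := AddCircle.coe_period 1
    simp [h1]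
  · refine Continuous.intervalIntegrable ?_ _ _
    refine hc.comp (continuous_const.add ((continuous_single i).comp ?_))
    exact AddCircle.continuous_mk' 1

lemma exists_forall_abs_le {F : Torus n → ℝ} (hF : Continuous F) : ∃ C, ∀ x, |F x| ≤ C := by
  obtain ⟨C, hC⟩ := isCompact_univ.exists_bound_of_continuousOn hF.continuousOn
  exact ⟨C, fun x => hC x trivial⟩

lemma mFourier_apply (m : Fin n → ℤ) (x : Torus n) :
    UnitAddTorus.mFourier m x = ∏ i, (fourier (m i) (x i) : ℂ) := rfl

lemma norm_mFourier_apply (m : Fin n → ℤ) (x : Torus n) : ‖UnitAddTorus.mFourier m x‖ = 1 := by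
  rw [mFourier_apply, norm_prod]
  refine Finset.prod_eq_one fun i _ => ?_
  rw [fourier_apply, Circle.norm_coe]

lemma fourier_add_arg (k : ℤ) (s t : UnitAddCircle) :
    (fourier k (s + t) : ℂ) = fourier k s * fourier k t := by
  simp only [fourier_apply, smul_add, AddCircle.toCircle_add, Circle.coe_mul]

lemma mFourier_add_arg (m : Fin n → ℤ) (x z : Torus n) :
    UnitAddTorus.mFourier m (x + z) = UnitAddTorus.mFourier m x * UnitAddTorus.mFourier m z := by
  simp only [mFourier_apply, Pi.add_apply, fourier_add_arg, Finset.prod_mul_distrib]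

lemma mFourier_mul_conj (m : Fin n → ℤ) (x : Torus n) :
    UnitAddTorus.mFourier m x * conj (UnitAddTorus.mFourier m x) = 1 := by
  rw [Complex.mul_conj, Complex.normSq_eq_norm_sq, norm_mFourier_apply]
  simp

lemma mFourier_sub_arg (m : Fin n → ℤ) (x z : Torus n) :
    UnitAddTorus.mFourier m (x - z) =
      UnitAddTorus.mFourier m x * conj (UnitAddTorus.mFourier m z) := by
  conv_rhs => rw [← sub_add_cancel x z, mFourier_add_arg, mul_assoc, mFourier_mul_conj, mul_one]

end Torus

/-! ### Iterates of triangular maps -/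

section Triangular

/-- The triangular map that adds `g i (x 0, …, x (i - 1))` to the coordinate `x i`. -/
def triangular (g : ∀ m : ℕ, Torus m → UnitAddCircle) (d : ℕ) (x : Torus d) : Torus d :=
  fun i => x i + g i (initial i.is_lt.le x)

variable (g : ∀ m : ℕ, Torus m → UnitAddCircle)

lemma initial_triangular_iterate {m n : ℕ} (hmn : m ≤ n) (l : ℕ) (x : Torus n) :
    initial hmn ((triangular g n)^[l] x) = (triangular g m)^[l] (initial hmn x) :=
  (Function.Semiconj.iterate_right (f := initial hmn) (ga := triangular g n)
    (gb := triangular g m) (fun _ => rfl) l) x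

lemma triangular_iterate_apply {n : ℕ} (l : ℕ) (x : Torus n) (i : Fin n) :
    (triangular g n)^[l] x i =
      x i + ∑ k ∈ Finset.range l, g i ((triangular g i)^[k] (initial i.is_lt.le x)) := by
  induction l with
  | zero => simp
  | succ l ih =>
    rw [Function.iterate_succ_apply', Finset.sum_range_succ, ← add_assoc, ← ih,
      ← initial_triangular_iterate]
    rfl

lemma initial_add_single_of_le {m n : ℕ} (hmn : m ≤ n) {i : Fin n} (hi : m ≤ i) (x : Torus n)
    (t : UnitAddCircle) : initial hmn (x + (Pi.single i t : Torus n)) = initial hmn x := by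
  funext k
  have : Fin.castLE hmn k ≠ i := fun h => by
    have := congrArg Fin.val h
    have := k.is_lt
    simp at *
    omega
  simp [initial, this]

lemma initial_add_single {m n : ℕ} (hmn : m ≤ n) (i : Fin m) (x : Torus n)
    (t : UnitAddCircle) :
    initial hmn (x + (Pi.single (Fin.castLE hmn i) t : Torus n)) =
      initial hmn x + (Pi.single i t : Torus m) := by
  funext k
  by_cases hk : k = i
  · subst hk; simp [initial]
  · simp [initial, hk]

/-- No increment involves the last coordinate, so translations in it commute with the map. -/
lemma triangular_iterate_add_single_last {r : ℕ} (l : ℕ) (x : Torus (r + 1))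
    (t : UnitAddCircle) :
    (triangular g (r + 1))^[l] (x + (Pi.single (Fin.last r) t : Torus (r + 1))) =
      (triangular g (r + 1))^[l] x + (Pi.single (Fin.last r) t : Torus (r + 1)) := by
  funext i
  rw [Pi.add_apply, triangular_iterate_apply, triangular_iterate_apply, Pi.add_apply,
    initial_add_single_of_le _ (by rw [Fin.val_last]; omega)]
  abel

lemma continuous_initial {m n : ℕ} (hmn : m ≤ n) : Continuous (initial hmn) :=
  continuous_pi fun _ => continuous_apply _

variable {g}

lemma continuous_triangular {d : ℕ} (hg : ∀ m < d, Continuous (g m)) :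
    Continuous (triangular g d) :=
  continuous_pi fun i => (continuous_apply i).add
    ((hg i i.is_lt).comp (continuous_initial i.is_lt.le))

/-- The character `m` evaluated at the displacement of `x` under `l` steps. -/
lemma mFourier_displacement {n : ℕ} (m : Fin n → ℤ) (l : ℕ) (x : Torus n) :
    UnitAddTorus.mFourier m ((triangular g n)^[l] x - x) =
      ∏ i : Fin n, (fourier (m i)
        (∑ k ∈ Finset.range l, g i ((triangular g i)^[k] (initial i.is_lt.le x))) : ℂ) := by
  rw [mFourier_apply]
  refine Finset.prod_congr rfl fun i _ => ?_
  rw [Pi.sub_apply, triangular_iterate_apply, add_sub_cancel_left]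

end Triangular

/-! ### Decay of correlations of characters -/

section Decay

variable (y : ℝ) (b : ℕ → ℕ → ℤ) (h : ∀ j : ℕ, Torus j → ℝ)

/-- Isolates the term linear in t, which grows to n times its coefficient over n steps, from the
periodic term in h. -/
lemma increment_add_single_last (r : ℕ) (z : Torus (r + 1)) (t : UnitAddCircle) :
    increment y b h (r + 1) (z + (Pi.single (Fin.last r) t : Torus (r + 1))) =
      (increment y b h (r + 1) z - ((h (r + 1) z : ℝ) : UnitAddCircle)) + b (r + 2) (r + 1) • t +
        ((h (r + 1) (z + (Pi.single (Fin.last r) t : Torus (r + 1))) : ℝ) : UnitAddCircle) := by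
  simp only [increment, Nat.add_one_ne_zero, if_false, Pi.add_apply, smul_add,
    Finset.sum_add_distrib, add_sub_cancel_right]
  congr 2
  rw [Finset.sum_eq_single (Fin.last r)]
  · simp
  · intro k _ hk
    simp [hk]
  · simp

variable {y b h}

/-- Decay of the correlations of a character, uniformly along the circles in the direction of the
last but one coordinate. -/
lemma exists_norm_integral_displacement_le {r : ℕ} (hb : b (r + 2) (r + 1) ≠ 0)
    (hC2 : IsC2 (h (r + 1)))
    (hD : ∃ N : ℕ, ∀ n ≥ N, ∀ z : Torus (r + 1), |∑ l ∈ Finset.range n,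
      partialDeriv (Fin.last r) (h (r + 1)) ((triangular (increment y b h) (r + 1))^[l] z)| ≤
        n / 2)
    {m : Fin (r + 2) → ℤ} (hm : m (Fin.last (r + 1)) ≠ 0) :
    ∃ (C : ℝ) (N : ℕ), ∀ n ≥ N, ∀ x : Torus (r + 2),
      ‖∫ t, UnitAddTorus.mFourier m ((triangular (increment y b h) (r + 2))^[n]
        (x + (Pi.single (Fin.last r).castSucc t : Torus (r + 2))) -
          (x + (Pi.single (Fin.last r).castSucc t : Torus (r + 2)))) ∂𝔪‖ ≤ C / n := by
  obtain ⟨N, hN⟩ := hD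
  set H := h (r + 1) with hH
  set i := Fin.last r with hi
  set g := increment y b h with hg
  set k := m (Fin.last (r + 1)) with hk
  set B := b (r + 2) (r + 1) with hB
  have hC2' : ContDiff ℝ ((1 : ℕ) + 1) (lift H) := by
    have := hC2
    norm_num at this ⊢
    exact this
  have hd1 : Differentiable ℝ (lift H) := hC2'.differentiable (by simp)
  have hC1 : ContDiff ℝ (1 : ℕ) (lift (partialDeriv i H)) := contDiff_lift_partialDeriv hC2' i
  have hd2 : Differentiable ℝ (lift (partialDeriv i H)) := hC1.differentiable (by simp)
  have hC0 : Continuous (partialDeriv i (partialDeriv i H)) :=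
    continuous_of_continuous_lift (contDiff_lift_partialDeriv (k := 0) (by simpa using hC1) i).continuous
  obtain ⟨C, hC⟩ := exists_forall_abs_le hC0
  -- The derivative test is used with a = n and c = 2π|k|nC, where C bounds the second partial
  -- derivative; `max N 1` keeps n positive.
  refine ⟨2 + 2 * Real.pi * |k| * C, max N 1, fun n hn x => ?_⟩
  have hnN : N ≤ n := (le_max_left _ _).trans hn
  have hn1 : 1 ≤ n := (le_max_right _ _).trans hn
  have hn0 : (0 : ℝ) < n := by exact_mod_cast hn1
  set x' : Torus (r + 1) := initial (Nat.le_succ _) x with hx'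
  let z : ℕ → Torus (r + 1) := fun l => (triangular g (r + 1))^[l] x'
  let S : ℝ → ℝ := fun s => ∑ l ∈ Finset.range n, H (z l + Pi.single i (s : UnitAddCircle))
  let S' : ℝ → ℝ := fun s =>
    ∑ l ∈ Finset.range n, partialDeriv i H (z l + Pi.single i (s : UnitAddCircle))
  let S'' : ℝ → ℝ := fun s => ∑ l ∈ Finset.range n,
    partialDeriv i (partialDeriv i H) (z l + Pi.single i (s : UnitAddCircle))
  have hS : ∀ s, HasDerivAt S (S' s) s := fun s =>
    HasDerivAt.fun_sum fun l _ => hasDerivAt_partialDeriv hd1 i (z l) s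
  have hS' : ∀ s, HasDerivAt S' (S'' s) s := fun s =>
    HasDerivAt.fun_sum fun l _ => hasDerivAt_partialDeriv hd2 i (z l) s
  let c : UnitAddCircle := ∑ l ∈ Finset.range n, (g (r + 1) (z l) - (H (z l) : UnitAddCircle))
  let P : ℂ := ∏ j : Fin (r + 1), (fourier (m j.castSucc) (∑ l ∈ Finset.range n,
      g j ((triangular g j)^[l] (initial (j.is_lt.le.trans (Nat.le_succ _)) x))) : ℂ)
  have hP : ‖P‖ = 1 := by
    rw [norm_prod]
    refine Finset.prod_eq_one fun j _ => ?_
    rw [fourier_apply, Circle.norm_coe]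
  -- The displacements of all coordinates but the last involve only coordinates before the one being
  -- moved, so they contribute the constant P. The last displacement carries all the dependence on
  -- s.
  have key : ∀ s : ℝ, UnitAddTorus.mFourier m ((triangular g (r + 2))^[n]
        (x + (Pi.single i.castSucc (s : UnitAddCircle) : Torus (r + 2))) -
          (x + (Pi.single i.castSucc (s : UnitAddCircle) : Torus (r + 2)))) =
      P * (fourier k c : ℂ) *
        Complex.exp (Complex.I * ((2 * Real.pi * k * (n * B * s + S s) : ℝ) : ℂ)) := fun s => by
    rw [mFourier_displacement, Fin.prod_univ_castSucc, mul_assoc]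
    congr 1
    · refine Finset.prod_congr rfl fun j _ => ?_
      congr 1
      refine Finset.sum_congr rfl fun l _ => ?_
      rw [initial_add_single_of_le _ (by simpa [hi] using Nat.lt_succ_iff.1 j.is_lt)]
      rfl
    · have e1 : initial (Fin.last (r + 1)).is_lt.le
          (x + (Pi.single i.castSucc (s : UnitAddCircle) : Torus (r + 2))) =
          x' + (Pi.single i (s : UnitAddCircle) : Torus (r + 1)) :=
        initial_add_single (Nat.le_succ _) i x s
      have e2 : ∑ l ∈ Finset.range n, g (Fin.last (r + 1)) ((triangular g (Fin.last (r + 1)))^[l]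
          (initial (Fin.last (r + 1)).is_lt.le
            (x + (Pi.single i.castSucc (s : UnitAddCircle) : Torus (r + 2))))) =
          c + ((n * B * s + S s : ℝ) : UnitAddCircle) := by
        rw [e1]
        have e3 : ∀ l, g (r + 1) ((triangular g (r + 1))^[l]
            (x' + (Pi.single i (s : UnitAddCircle) : Torus (r + 1)))) =
            (g (r + 1) (z l) - (H (z l) : UnitAddCircle)) + B • (s : UnitAddCircle) +
            ((H (z l + Pi.single i (s : UnitAddCircle)) : ℝ) : UnitAddCircle) := fun l => by
          rw [hi, triangular_iterate_add_single_last]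
          exact increment_add_single_last y b h r (z l) s
        refine (Finset.sum_congr rfl fun l _ => e3 l).trans ?_
        rw [Finset.sum_add_distrib, Finset.sum_add_distrib, Finset.sum_const, Finset.card_range,
          add_assoc, AddCircle.coe_add]
        congr 2
        · rw [← AddCircle.coe_zsmul, ← AddCircle.coe_nsmul]
          congr 1
          simp [mul_assoc]
        · exact (map_sum (QuotientAddGroup.mk' (AddSubgroup.zmultiples (1 : ℝ))) _ _).symm
      rw [e2, fourier_add_arg, fourier_coe_apply]
      congr 2
      push_cast
      ring
  rw [integral_circle]
  simp_rw [key]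
  rw [intervalIntegral.integral_const_mul, norm_mul, norm_mul, hP, fourier_apply,
    Circle.norm_coe, one_mul, one_mul]
  have hk1 : (1 : ℝ) ≤ |(k : ℝ)| := by exact_mod_cast Int.one_le_abs hm
  have hB1 : (1 : ℝ) ≤ |(B : ℝ)| := by exact_mod_cast Int.one_le_abs hb
  have hpi := Real.pi_gt_three
  refine (norm_integral_exp_le (Φ := fun s => 2 * Real.pi * k * (n * B * s + S s))
    (Φ' := fun s => 2 * Real.pi * k * (n * B + S' s)) (Φ'' := fun s => 2 * Real.pi * k * S'' s)
    (a := n) (c := 2 * Real.pi * |(k : ℝ)| * (n * C)) (fun s => ?_) (fun s => ?_) ?_ hn0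
    (fun s => ?_) fun s => ?_).trans_eq ?_
  · have := ((hasDerivAt_id s).const_mul ((n : ℝ) * B)).add (hS s)
    simpa using this.const_mul (2 * Real.pi * k)
  · exact ((hS' s).const_add _).const_mul _
  · refine continuous_const.mul (continuous_finsetSum _ fun l _ => hC0.comp ?_)
    refine continuous_const.add ((continuous_single i).comp ?_)
    exact AddCircle.continuous_mk' 1
  -- The linear slope |nB| is at least n and the perturbation at most n/2; the factor 2π|k| ≥ 2
  -- restores the bound n.
  · have h1 : |S' s| ≤ n / 2 := by
      have := hN n hnN (x' + (Pi.single i (s : UnitAddCircle) : Torus (r + 1)))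
      rw [hi] at this
      simp_rw [triangular_iterate_add_single_last] at this
      exact this
    have h2 : (n : ℝ) ≤ |(n : ℝ) * B| := by
      rw [abs_mul, abs_of_pos hn0]
      exact le_mul_of_one_le_right hn0.le hB1
    have h3 : (n : ℝ) / 2 ≤ |(n : ℝ) * B + S' s| := by
      have := abs_sub_abs_le_abs_sub ((n : ℝ) * B) (-S' s)
      rw [abs_neg, sub_neg_eq_add] at this
      linarith
    rw [abs_mul, abs_mul, abs_of_pos (by positivity : (0 : ℝ) < 2 * Real.pi)]
    have h4 : (2 : ℝ) ≤ 2 * Real.pi * |(k : ℝ)| := by nlinarith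
    nlinarith
  · rw [abs_mul, abs_mul, abs_of_pos (by positivity : (0 : ℝ) < 2 * Real.pi)]
    refine mul_le_mul_of_nonneg_left ?_ (by positivity)
    refine (Finset.abs_sum_le_sum_abs _ _).trans ?_
    refine (Finset.sum_le_sum fun l _ => hC _).trans_eq ?_
    simp
  · push_cast
    field_simp

end Decay

/-! ### Van der Corput's inequality -/

section VanDerCorput

lemma norm_sum_range_add_sub_le {u : ℕ → ℂ} (hu : ∀ l, ‖u l‖ ≤ 1) (n a : ℕ) :
    ‖∑ l ∈ Finset.range n, u (l + a) - ∑ l ∈ Finset.range n, u l‖ ≤ 2 * a := by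
  induction a with
  | zero => simp
  | succ a ih =>
    have h1 := Finset.sum_range_succ (fun l => u (l + a)) n
    rw [Finset.sum_range_succ'] at h1
    have h2 : ∑ l ∈ Finset.range n, u (l + (a + 1)) =
        ∑ l ∈ Finset.range n, u (l + a) + (u (n + a) - u (0 + a)) := by
      rw [add_sub, eq_sub_iff_add_eq, ← h1]
      congr 1
      exact Finset.sum_congr rfl fun l _ => by congr 1; ring
    rw [h2, add_sub_right_comm]
    refine (norm_add_le _ _).trans ?_
    have := (norm_sub_le (u (n + a)) (u (0 + a))).trans (add_le_add (hu _) (hu _))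
    push_cast
    linarith

/-- Van der Corput's inequality with shifts in an arithmetic progression. -/
lemma van_der_corput {u : ℕ → ℂ} (hu : ∀ l, ‖u l‖ ≤ 1) {n P s : ℕ} {δ : ℝ}
    (h : ∀ p < P, ∀ q < P, p ≠ q →
      ‖∑ l ∈ Finset.range n, u (l + p * s) * conj (u (l + q * s))‖ ≤ δ * n) (hδ : 0 ≤ δ) :
    P * ‖∑ l ∈ Finset.range n, u l‖ ≤ n * Real.sqrt (P + P ^ 2 * δ) + 2 * P ^ 2 * s := by
  have h1 : ‖∑ p ∈ Finset.range P, (∑ l ∈ Finset.range n, u (l + p * s) -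
      ∑ l ∈ Finset.range n, u l)‖ ≤ 2 * P ^ 2 * s := by
    refine (norm_sum_le _ _).trans ((Finset.sum_le_sum (g := fun _ => 2 * (P : ℝ) * s)
      fun p hp => ?_).trans_eq ?_)
    · refine (norm_sum_range_add_sub_le hu n (p * s)).trans ?_
      have : (p : ℝ) ≤ P := by exact_mod_cast (Finset.mem_range.1 hp).le
      push_cast
      rw [mul_assoc]
      gcongr
    · rw [Finset.sum_const, Finset.card_range, nsmul_eq_mul]
      ring
  rw [Finset.sum_sub_distrib, Finset.sum_const, Finset.card_range, nsmul_eq_mul,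
    Finset.sum_comm] at h1
  -- Averaging over P shifts costs the error in `h1`. Cauchy–Schwarz then leaves Σ‖v l‖², in which
  -- the P diagonal correlations are at most n each and the at most P² others at most δn each.
  set v : ℕ → ℂ := fun l => ∑ p ∈ Finset.range P, u (l + p * s) with hv
  have h2 : ‖∑ l ∈ Finset.range n, v l‖ ^ 2 ≤ n * ∑ l ∈ Finset.range n, ‖v l‖ ^ 2 := by
    refine (pow_le_pow_left₀ (norm_nonneg _) (norm_sum_le _ _) 2).trans ?_
    simpa using sq_sum_le_card_mul_sum_sq (s := Finset.range n) (f := fun l => ‖v l‖)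
  have h3 : ∑ l ∈ Finset.range n, ‖v l‖ ^ 2 ≤ n * (P + P ^ 2 * δ) := by
    have e : ((∑ l ∈ Finset.range n, ‖v l‖ ^ 2 : ℝ) : ℂ) =
        ∑ p ∈ Finset.range P, ∑ q ∈ Finset.range P, ∑ l ∈ Finset.range n,
          u (l + p * s) * conj (u (l + q * s)) := by
      push_cast
      simp_rw [← Complex.mul_conj', hv, map_sum, Finset.sum_mul_sum]
      rw [Finset.sum_comm]
      refine Finset.sum_congr rfl fun p _ => ?_
      rw [Finset.sum_comm]
    have e2 : ∑ l ∈ Finset.range n, ‖v l‖ ^ 2 =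
        ‖((∑ l ∈ Finset.range n, ‖v l‖ ^ 2 : ℝ) : ℂ)‖ := by
      rw [Complex.norm_real, Real.norm_of_nonneg (Finset.sum_nonneg fun _ _ => sq_nonneg _)]
    rw [e2, e]
    have h4 : ∀ p ∈ Finset.range P, ‖∑ q ∈ Finset.range P, ∑ l ∈ Finset.range n,
        u (l + p * s) * conj (u (l + q * s))‖ ≤ n + P * (δ * n) := fun p hp => by
      refine (norm_sum_le _ _).trans ((Finset.sum_le_sum
        (g := fun q => (if p = q then (n : ℝ) else 0) + δ * n) fun q hq => ?_).trans_eq ?_)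
      · split_ifs with hpq
        · refine (norm_sum_le _ _).trans ((Finset.sum_le_sum (g := fun _ => (1 : ℝ))
            fun l _ => ?_).trans ?_)
          · rw [norm_mul, RCLike.norm_conj]
            exact mul_le_one₀ (hu _) (norm_nonneg _) (hu _)
          · have : 0 ≤ δ * n := by positivity
            simpa using this
        · rw [zero_add]
          exact h p (Finset.mem_range.1 hp) q (Finset.mem_range.1 hq) hpq
      · rw [Finset.sum_add_distrib, Finset.sum_ite_eq, if_pos hp]
        simp
    refine (norm_sum_le _ _).trans ((Finset.sum_le_sum h4).trans_eq ?_)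
    rw [Finset.sum_const, Finset.card_range, nsmul_eq_mul]
    ring
  have h5 : ‖∑ l ∈ Finset.range n, v l‖ ≤ n * Real.sqrt (P + P ^ 2 * δ) := by
    refine abs_le_of_sq_le_sq' ?_ (by positivity) |>.2
    rw [mul_pow, Real.sq_sqrt (by positivity)]
    refine h2.trans ((mul_le_mul_of_nonneg_left h3 (Nat.cast_nonneg n)).trans_eq (by ring))
  have h6 : (P : ℂ) * ∑ l ∈ Finset.range n, u l = ∑ l ∈ Finset.range n, v l -
      (∑ l ∈ Finset.range n, v l - P * ∑ l ∈ Finset.range n, u l) := by ring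
  calc (P : ℝ) * ‖∑ l ∈ Finset.range n, u l‖ = ‖(P : ℂ) * ∑ l ∈ Finset.range n, u l‖ := by
        rw [norm_mul, Complex.norm_natCast]
    _ ≤ _ := by rw [h6]; exact (norm_sub_le _ _).trans (add_le_add h5 h1)

end VanDerCorput

/-! ### Uniform convergence of ergodic averages -/

section UniformAverages

/-- The ergodic averages of `F` along `T` converge uniformly to the integral of `F`. -/
def UniformAverages {d : ℕ} (T : Torus d → Torus d) (F : Torus d → ℂ) : Prop :=
  ∀ ε > 0, ∃ N : ℕ, ∀ n ≥ N, ∀ x,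
    ‖∑ l ∈ Finset.range n, F (T^[l] x) - n * ∫ x, F x ∂(haar d)‖ ≤ ε * n

variable {d : ℕ} {T : Torus d → Torus d}

lemma integrable_continuousMap (F : C(Torus d, ℂ)) : Integrable F (haar d) :=
  F.continuous.integrable_of_hasCompactSupport (HasCompactSupport.of_compactSpace _)

lemma UniformAverages.add {F G : C(Torus d, ℂ)} (hF : UniformAverages T F)
    (hG : UniformAverages T G) : UniformAverages T (F + G : C(Torus d, ℂ)) := fun ε hε => by
  obtain ⟨N, hN⟩ := hF (ε / 2) (half_pos hε)
  obtain ⟨N', hN'⟩ := hG (ε / 2) (half_pos hε)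
  refine ⟨max N N', fun n hn x => ?_⟩
  have h1 := hN n ((le_max_left _ _).trans hn) x
  have h2 := hN' n ((le_max_right _ _).trans hn) x
  have : ∑ l ∈ Finset.range n, (F + G : C(Torus d, ℂ)) (T^[l] x) -
      n * ∫ x, (F + G : C(Torus d, ℂ)) x ∂(haar d) =
      (∑ l ∈ Finset.range n, F (T^[l] x) - n * ∫ x, F x ∂(haar d)) +
      (∑ l ∈ Finset.range n, G (T^[l] x) - n * ∫ x, G x ∂(haar d)) := by
    simp only [ContinuousMap.add_apply]
    rw [Finset.sum_add_distrib, integral_add (integrable_continuousMap F)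
      (integrable_continuousMap G)]
    ring
  rw [this]
  refine (norm_add_le _ _).trans ?_
  linarith

lemma UniformAverages.smul {F : C(Torus d, ℂ)} (hF : UniformAverages T F) (c : ℂ) :
    UniformAverages T (c • F : C(Torus d, ℂ)) := fun ε hε => by
  obtain ⟨N, hN⟩ := hF (ε / (‖c‖ + 1)) (by positivity)
  refine ⟨N, fun n hn x => ?_⟩
  have : ∑ l ∈ Finset.range n, (c • F : C(Torus d, ℂ)) (T^[l] x) -
      n * ∫ x, (c • F : C(Torus d, ℂ)) x ∂(haar d) =
      c * (∑ l ∈ Finset.range n, F (T^[l] x) - n * ∫ x, F x ∂(haar d)) := by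
    simp only [ContinuousMap.smul_apply, smul_eq_mul]
    rw [← Finset.mul_sum, integral_const_mul]
    ring
  rw [this, norm_mul]
  refine (mul_le_mul_of_nonneg_left (hN n hn x) (norm_nonneg c)).trans ?_
  rw [div_mul_eq_mul_div, ← mul_div_assoc, div_le_iff₀ (by positivity)]
  have : 0 ≤ ε * n := by positivity
  nlinarith [norm_nonneg c]

lemma UniformAverages.of_forall_norm_sub_le {F : C(Torus d, ℂ)}
    (h : ∀ δ > 0, ∃ G : C(Torus d, ℂ), ‖F - G‖ ≤ δ ∧ UniformAverages T G) :
    UniformAverages T F := fun ε hε => by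
  obtain ⟨G, hFG, hG⟩ := h (ε / 4) (by positivity)
  obtain ⟨N, hN⟩ := hG (ε / 2) (half_pos hε)
  refine ⟨N, fun n hn x => ?_⟩
  have h1 : ∀ x, ‖F x - G x‖ ≤ ε / 4 := fun x => ((F - G).norm_coe_le_norm x).trans hFG
  have h2 : ‖∑ l ∈ Finset.range n, (F (T^[l] x) - G (T^[l] x))‖ ≤ n * (ε / 4) :=
    (norm_sum_le _ _).trans ((Finset.sum_le_sum fun l _ => h1 _).trans_eq (by simp))
  have h3 : ‖∫ x, F x - G x ∂(haar d)‖ ≤ ε / 4 := by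
    simpa using norm_integral_le_of_norm_le_const (μ := haar d) (ae_of_all _ h1)
  have : ∑ l ∈ Finset.range n, F (T^[l] x) - n * ∫ x, F x ∂(haar d) =
      ∑ l ∈ Finset.range n, (F (T^[l] x) - G (T^[l] x)) +
      (∑ l ∈ Finset.range n, G (T^[l] x) - n * ∫ x, G x ∂(haar d)) -
      n * ∫ x, F x - G x ∂(haar d) := by
    rw [Finset.sum_sub_distrib, integral_sub (integrable_continuousMap F)
      (integrable_continuousMap G)]
    ring
  rw [this]
  refine (norm_sub_le _ _).trans ((add_le_add (norm_add_le _ _) le_rfl).trans ?_)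
  rw [norm_mul, Complex.norm_natCast]
  have := mul_le_mul_of_nonneg_left h3 (Nat.cast_nonneg (α := ℝ) n)
  linarith [hN n hn x]

lemma UniformAverages.of_mFourier (h : ∀ m : Fin d → ℤ, UniformAverages T (UnitAddTorus.mFourier m))
    (F : C(Torus d, ℂ)) : UniformAverages T F := by
  refine UniformAverages.of_forall_norm_sub_le fun δ hδ => ?_
  have hF : F ∈ (Submodule.span ℂ (Set.range
      (UnitAddTorus.mFourier (d := Fin d)))).topologicalClosure := by
    rw [UnitAddTorus.span_mFourier_closure_eq_top]; trivial
  obtain ⟨G, hG, hFG⟩ := Metric.mem_closure_iff.1 hF δ hδ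
  refine ⟨G, by rw [← dist_eq_norm]; exact hFG.le, ?_⟩
  clear hFG
  induction hG using Submodule.span_induction with
  | mem u hu => obtain ⟨m, rfl⟩ := hu; exact h m
  | zero => simpa using (h 0).smul 0
  | add u v _ _ hu hv => exact hu.add hv
  | smul c u _ hu => exact hu.smul c

lemma exists_fourier_ne_one {k : ℤ} (hk : k ≠ 0) :
    ∃ t : UnitAddCircle, (fourier k t : ℂ) ≠ 1 := by
  refine ⟨((1 / 2 / (k : ℝ) : ℝ) : UnitAddCircle), ?_⟩
  have h0 : (fourier k (0 + ((1 / 2 / (k : ℝ) : ℝ) : UnitAddCircle)) : ℂ) = -1 := by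
    simpa using fourier_add_half_inv_index hk one_pos (0 : UnitAddCircle)
  rw [zero_add] at h0
  rw [h0]
  norm_num

/-- A suitable translation multiplies the integral by a number other than 1 without changing it. -/
lemma integral_mFourier {m : Fin d → ℤ} (hm : m ≠ 0) :
    ∫ x, UnitAddTorus.mFourier m x ∂(haar d) = 0 := by
  obtain ⟨i, hi⟩ : ∃ i, m i ≠ 0 := by
    by_contra! h; exact hm (funext h)
  obtain ⟨t, ht⟩ := exists_fourier_ne_one hi
  have h1 := integral_add_right_eq_self (μ := haar d) (UnitAddTorus.mFourier m)
    (Pi.single i t : Torus d)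
  have h2 : (UnitAddTorus.mFourier m (Pi.single i t : Torus d) : ℂ) = fourier (m i) t := by
    rw [mFourier_apply, Finset.prod_eq_single i]
    · simp
    · intro k _ hk; simp [hk]
    · simp
  simp_rw [mFourier_add_arg, h2] at h1
  rw [integral_mul_const] at h1
  have h3 : (∫ x, UnitAddTorus.mFourier m x ∂(haar d)) * ((fourier (m i) t : ℂ) - 1) = 0 := by
    rw [mul_sub, h1]; ring
  exact (mul_eq_zero.1 h3).resolve_right (sub_ne_zero.2 ht)

end UniformAverages

/-! ### Uniform averages for Furstenberg transformations -/

section UniformAveragesTriangular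

lemma uniformAverages_mFourier_zero {d : ℕ} (T : Torus d → Torus d) :
    UniformAverages T (UnitAddTorus.mFourier (0 : Fin d → ℤ)) := fun ε hε => by
  refine ⟨0, fun n _ x => ?_⟩
  simp only [UnitAddTorus.mFourier_zero, ContinuousMap.one_apply]
  have : (0 : ℝ) ≤ ε * n := by positivity
  simpa using this

lemma norm_sum_pow_le {z : ℂ} (hz : ‖z‖ = 1) (h1 : z ≠ 1) (n : ℕ) :
    ‖∑ l ∈ Finset.range n, z ^ l‖ ≤ 2 / ‖z - 1‖ := by
  rw [geom_sum_eq h1, norm_div]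
  refine div_le_div_of_nonneg_right ?_ (norm_nonneg _)
  refine (norm_sub_le _ _).trans ?_
  rw [norm_pow, hz, one_pow, norm_one]
  norm_num

variable {y : ℝ} {b : ℕ → ℕ → ℤ} {h : ∀ j : ℕ, Torus j → ℝ}

lemma fourier_ne_one_of_irrational (hy : Irrational y) {k : ℤ} (hk : k ≠ 0) :
    (fourier k (y : UnitAddCircle) : ℂ) ≠ 1 := by
  rw [fourier_coe_apply]
  intro he
  obtain ⟨n, hn⟩ := Complex.exp_eq_one_iff.1 he
  refine (hy.intCast_mul hk).ne_int n ?_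
  have h2 : (2 * Real.pi * Complex.I : ℂ) ≠ 0 := Complex.two_pi_I_ne_zero
  have : ((k * y : ℝ) : ℂ) = ((n : ℝ) : ℂ) := by
    refine mul_left_cancel₀ h2 ?_
    push_cast at hn ⊢
    rw [div_one] at hn
    linear_combination hn
  exact_mod_cast this

/-- In dimension one the sums are geometric with ratio z ≠ 1, hence bounded by 2/|z − 1| for all n
and x. -/
lemma uniformAverages_rotation (hy : Irrational y) {m : Fin 1 → ℤ} (hm : m ≠ 0) :
    UniformAverages (triangular (increment y b h) 1) (UnitAddTorus.mFourier m) := fun ε hε => by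
  have hm0 : m 0 ≠ 0 := fun h0 => hm (funext fun i => by rw [Fin.fin_one_eq_zero i, h0]; rfl)
  set z : ℂ := fourier (m 0) (y : UnitAddCircle) with hz
  have hz1 : z ≠ 1 := fourier_ne_one_of_irrational hy hm0
  obtain ⟨N, hN⟩ := exists_nat_ge (2 / ‖z - 1‖ / ε)
  refine ⟨N, fun n hn x => ?_⟩
  have hT : ∀ l, UnitAddTorus.mFourier m ((triangular (increment y b h) 1)^[l] x) =
      z ^ l * UnitAddTorus.mFourier m x := fun l => by
    induction l with
    | zero => simp
    | succ l ih =>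
      have e : ∀ w : Torus 1, UnitAddTorus.mFourier m (triangular (increment y b h) 1 w) =
          z * UnitAddTorus.mFourier m w := fun w => by
        simp [mFourier_apply, triangular, increment, fourier_add_arg, mul_comm, hz,
          -fourier_apply]
      rw [Function.iterate_succ_apply', e, ih, pow_succ]
      ring
  simp_rw [hT]
  rw [integral_mFourier hm, mul_zero, sub_zero, ← Finset.sum_mul, norm_mul, norm_mFourier_apply,
    mul_one]
  refine (norm_sum_pow_le (by rw [hz, fourier_apply, Circle.norm_coe]) hz1 n).trans ?_
  rw [← div_le_iff₀' hε]
  exact hN.trans (by exact_mod_cast hn)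

lemma UniformAverages.of_initial {g : ∀ m : ℕ, Torus m → UnitAddCircle} {r : ℕ}
    (hr : ∀ F : C(Torus r, ℂ), UniformAverages (triangular g r) F)
    {m : Fin (r + 1) → ℤ} (hm : m ≠ 0) (hm0 : m (Fin.last r) = 0) :
    UniformAverages (triangular g (r + 1)) (UnitAddTorus.mFourier m) := fun ε hε => by
  have hm' : (fun i : Fin r => m i.castSucc) ≠ 0 := fun h0 => hm <| funext fun i => by
    refine Fin.lastCases hm0 (fun j => ?_) i
    exact congrFun h0 j
  obtain ⟨N, hN⟩ := hr (UnitAddTorus.mFourier fun i : Fin r => m i.castSucc) ε hε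
  refine ⟨N, fun n hn x => ?_⟩
  have h1 := hN n hn (initial (Nat.le_succ r) x)
  rw [integral_mFourier hm'] at h1
  rw [integral_mFourier hm]
  simp_rw [← initial_triangular_iterate] at h1
  convert h1 using 4 with l
  rw [mFourier_apply, mFourier_apply, Fin.prod_univ_castSucc, hm0]
  simp [initial, Fin.castSucc, Fin.castAdd]

/-- The partial derivative has mean zero, so its Birkhoff sums are o(n) uniformly; n/2 suffices for
the derivative test. -/
lemma exists_forall_abs_sum_partialDeriv_le {r : ℕ} {g : ∀ m : ℕ, Torus m → UnitAddCircle}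
    (hr : ∀ F : C(Torus r, ℂ), UniformAverages (triangular g r) F) {H : Torus r → ℝ}
    (hH : IsC2 H) (i : Fin r) :
    ∃ N : ℕ, ∀ n ≥ N, ∀ z : Torus r, |∑ l ∈ Finset.range n,
      partialDeriv i H ((triangular g r)^[l] z)| ≤ n / 2 := by
  have h1 : ContDiff ℝ 1 (lift H) := ContDiff.of_le hH (by norm_num)
  have hc : Continuous (partialDeriv i H) :=
    continuous_of_continuous_lift (contDiff_lift_partialDeriv (k := 0) (by simpa using h1) i).continuous
  obtain ⟨N, hN⟩ := hr ⟨fun x => (partialDeriv i H x : ℂ), by fun_prop⟩ (1 / 2) (by norm_num)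
  refine ⟨N, fun n hn z => ?_⟩
  have := hN n hn z
  simp only [ContinuousMap.coe_mk] at this
  rw [integral_complex_ofReal, integral_partialDeriv h1, ← Complex.ofReal_sum, Complex.ofReal_zero,
    mul_zero, sub_zero, Complex.norm_real, Real.norm_eq_abs] at this
  linarith

lemma continuous_increment {m : ℕ} (hm : 1 ≤ m → IsC2 (h m)) : Continuous (increment y b h m) := by
  rcases Nat.eq_zero_or_pos m with rfl | hpos
  · have : increment y b h 0 = fun _ => (y : UnitAddCircle) := by
      funext x; simp [increment]
    rw [this]
    exact continuous_const
  · have : increment y b h m = fun x =>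
        (∑ k : Fin m, b (m + 1) ((k : ℕ) + 1) • x k) + ((h m x : ℝ) : UnitAddCircle) := by
      funext x; simp [increment, hpos.ne']
    rw [this]
    refine Continuous.add (continuous_finsetSum _ fun k _ => ?_)
      ((AddCircle.continuous_mk' 1).comp (hm hpos).continuous)
    exact (continuous_apply k).zsmul _

/-- Van der Corput's inequality along multiples of a large s. For q < p the product u(l + ps) ·
conj(u(l + qs)) is the displacement character of (p − q)s steps along an orbit. It depends on the
first r + 1 coordinates only, so `hr` applies, and its mean is O(1/s) by the decay estimate. -/
lemma uniformAverages_mFourier_of_last_ne_zero {r : ℕ}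
    (hr : ∀ F : C(Torus (r + 1), ℂ), UniformAverages (triangular (increment y b h) (r + 1)) F)
    (hb : b (r + 2) (r + 1) ≠ 0) (hC2 : ∀ j, 1 ≤ j → j < r + 2 → IsC2 (h j))
    {m : Fin (r + 2) → ℤ} (hm : m (Fin.last (r + 1)) ≠ 0) :
    UniformAverages (triangular (increment y b h) (r + 2)) (UnitAddTorus.mFourier m) := by
  set g := increment y b h with hg
  have hTc : Continuous (triangular g (r + 2)) := continuous_triangular fun k hk =>
    continuous_increment fun h1 => hC2 k h1 hk
  obtain ⟨C, N₀, hN₀⟩ := exists_norm_integral_displacement_le hb (hC2 _ (by omega) (by omega))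
    (exists_forall_abs_sum_partialDeriv_le hr (hC2 _ (by omega) (by omega)) (Fin.last r)) hm
  -- The displacement ignores the last coordinate; any value, here 0, turns it into a continuous
  -- function on the smaller torus.
  let ext : Torus (r + 1) → Torus (r + 2) := fun z => Fin.snoc z 0
  have hextc : Continuous ext := Continuous.finSnoc (A := fun _ : Fin (r + 2) => UnitAddCircle)
    (f := fun z : Torus (r + 1) => z) continuous_id continuous_const
  have hext : ∀ z, initial (Nat.le_succ (r + 1)) (ext z) = z := fun z => by
    funext k
    exact Fin.snoc_castSucc (α := fun _ => UnitAddCircle) 0 z k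
  let F : ℕ → C(Torus (r + 1), ℂ) := fun s =>
    ⟨fun z => UnitAddTorus.mFourier m ((triangular g (r + 2))^[s] (ext z) - ext z),
      (UnitAddTorus.mFourier m).continuous.comp
        (((hTc.iterate s).comp hextc).sub hextc)⟩
  have hF : ∀ s x, F s (initial (Nat.le_succ (r + 1)) x) =
      UnitAddTorus.mFourier m ((triangular g (r + 2))^[s] x - x) := fun s x => by
    change UnitAddTorus.mFourier m _ = _
    rw [mFourier_displacement, mFourier_displacement]
    refine Finset.prod_congr rfl fun i _ => ?_
    have : initial i.is_lt.le (ext (initial (Nat.le_succ (r + 1)) x)) =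
        initial i.is_lt.le x := by
      have h1 : ∀ w : Torus (r + 2), initial i.is_lt.le w =
          initial (Nat.lt_succ_iff.1 i.is_lt) (initial (Nat.le_succ (r + 1)) w) := fun w => rfl
      rw [h1, hext, ← h1]
    rw [this]
  have hFint : ∀ s ≥ N₀, ‖∫ z, F s z ∂(haar (r + 1))‖ ≤ C / s := fun s hs => by
    refine norm_integral_le_of_norm_integral_single_le (F s).continuous (Fin.last r) fun z => ?_
    refine le_trans (le_of_eq ?_) (hN₀ s hs (ext z))
    congr 2
    funext t
    rw [← hF]
    congr 1
    exact ((initial_add_single (Nat.le_succ (r + 1)) (Fin.last r) (ext z) t).trans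
      (by rw [hext])).symm
  intro ε hε
  -- With P ≥ 1/δ one has P + P²δ ≤ 2P²δ = (Pε/2)². The choice s ≥ 2C/δ makes the means at most δ/2,
  -- and n ≥ 4Ps/ε makes the shift error 2P²s at most Pεn/2.
  set δ := ε ^ 2 / 8 with hδ
  have hδ0 : 0 < δ := by positivity
  obtain ⟨P, hP⟩ := exists_nat_ge (1 / δ)
  have hP0 : (0 : ℝ) < P := lt_of_lt_of_le (by positivity) hP
  obtain ⟨s₁, hs₁⟩ := exists_nat_ge (2 * C / δ)
  set s := max N₀ (max s₁ 1) with hs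
  have hFs : ∀ k ≥ 1, ‖∫ z, F (k * s) z ∂(haar (r + 1))‖ ≤ δ / 2 := fun k hk => by
    have h1 : s ≤ k * s := Nat.le_mul_of_pos_left s hk
    have h2 : s₁ ≤ k * s := ((le_max_left _ _).trans (le_max_right _ _)).trans h1
    have h3 : 1 ≤ k * s := ((le_max_right _ _).trans (le_max_right _ _)).trans h1
    have h3' : (0 : ℝ) < (k * s : ℕ) := by exact_mod_cast h3
    refine (hFint _ ((le_max_left _ _).trans h1)).trans ?_
    rw [div_le_iff₀ h3']
    have h4 : 2 * C / δ ≤ (k * s : ℕ) := hs₁.trans (by exact_mod_cast h2)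
    rw [div_le_iff₀ hδ0] at h4
    linarith
  have hev : ∀ᶠ n : ℕ in atTop, ∀ k ∈ Finset.range P, ∀ w,
      ‖∑ l ∈ Finset.range n, F (k * s) ((triangular g (r + 1))^[l] w) -
        n * ∫ z, F (k * s) z ∂(haar (r + 1))‖ ≤ δ / 2 * n := by
    rw [Filter.eventually_all_finset]
    intro k _
    obtain ⟨N, hN⟩ := hr (F (k * s)) (δ / 2) (by positivity)
    exact eventually_atTop.2 ⟨N, hN⟩
  obtain ⟨N₁, hN₁⟩ := eventually_atTop.1 hev
  obtain ⟨N₂, hN₂⟩ := exists_nat_ge (4 * P * s / ε)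
  refine ⟨max N₁ N₂, fun n hn x => ?_⟩
  have hnN₁ := hN₁ n ((le_max_left _ _).trans hn)
  have hnN₂ : 4 * P * s / ε ≤ n := hN₂.trans (by exact_mod_cast (le_max_right _ _).trans hn)
  rw [integral_mFourier (fun h0 => hm (congrFun h0 _)), mul_zero, sub_zero]
  set u : ℕ → ℂ := fun l => UnitAddTorus.mFourier m ((triangular g (r + 2))^[l] x) with hu
  have hlt : ∀ p < P, ∀ q < p,
      ‖∑ l ∈ Finset.range n, u (l + p * s) * conj (u (l + q * s))‖ ≤ δ * n := fun p hp q hq => by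
    obtain ⟨k, rfl⟩ := Nat.exists_eq_add_of_lt hq
    set w := initial (Nat.le_succ (r + 1)) ((triangular g (r + 2))^[q * s] x) with hw
    have e : ∀ l, u (l + (q + k + 1) * s) * conj (u (l + q * s)) =
        F ((k + 1) * s) ((triangular g (r + 1))^[l] w) := fun l => by
      have e1 : (triangular g (r + 2))^[l] ((triangular g (r + 2))^[q * s] x) =
          (triangular g (r + 2))^[l + q * s] x := (Function.iterate_add_apply _ _ _ _).symm
      have e2 : (triangular g (r + 2))^[(k + 1) * s] ((triangular g (r + 2))^[l + q * s] x) =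
          (triangular g (r + 2))^[l + (q + k + 1) * s] x := by
        rw [show l + (q + k + 1) * s = (k + 1) * s + (l + q * s) by ring]
        exact (Function.iterate_add_apply _ _ _ _).symm
      rw [hw, ← initial_triangular_iterate, hF, mFourier_sub_arg, e1, e2]
    simp_rw [e]
    have h1 := hnN₁ (k + 1) (Finset.mem_range.2 (by omega)) w
    have h2 := hFs (k + 1) (by omega)
    set I := ∫ z, F ((k + 1) * s) z ∂(haar (r + 1)) with hI
    have h3 : ‖(n : ℂ) * I‖ ≤ δ / 2 * n := by
      rw [norm_mul, Complex.norm_natCast, mul_comm]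
      exact mul_le_mul_of_nonneg_right h2 (Nat.cast_nonneg n)
    have := norm_add_le (∑ l ∈ Finset.range n, F ((k + 1) * s) ((triangular g (r + 1))^[l] w) -
      n * I) (n * I)
    rw [sub_add_cancel] at this
    linarith
  have hvdc := van_der_corput (u := u) (fun l => (norm_mFourier_apply _ _).le) (n := n) (P := P)
    (s := s) (δ := δ) (fun p hp q hq hpq => ?_) hδ0.le
  · have h1 : Real.sqrt (P + P ^ 2 * δ) ≤ P * (ε / 2) := by
      rw [Real.sqrt_le_left (by positivity)]
      rw [div_le_iff₀ hδ0] at hP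
      have : (P : ℝ) ≤ P ^ 2 * δ := by nlinarith
      have h8 : δ * 8 = ε ^ 2 := by rw [hδ]; ring
      nlinarith
    rw [div_le_iff₀ hε] at hnN₂
    have h2 : P * ‖∑ l ∈ Finset.range n, u l‖ ≤ P * (ε * n) := by
      refine hvdc.trans ?_
      have h3 := mul_le_mul_of_nonneg_left h1 (Nat.cast_nonneg (α := ℝ) n)
      have h4 := mul_le_mul_of_nonneg_left hnN₂ hP0.le
      nlinarith
    exact le_of_mul_le_mul_left h2 hP0
  · rcases hpq.lt_or_gt with h1 | h1
    · rw [← RCLike.norm_conj, map_sum]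
      simp_rw [map_mul, RingHomCompTriple.comp_apply, RingHom.id_apply, mul_comm (conj (u _))]
      simpa using hlt q hq p h1
    · exact hlt p hp q h1

/-- The ergodic averages of continuous functions along a Furstenberg transformation converge
uniformly. -/
theorem uniformAverages_furstenberg (hy : Irrational y) (d : ℕ)
    (hb : ∀ l, 2 ≤ l → l ≤ d → b l (l - 1) ≠ 0) (hC2 : ∀ j, 1 ≤ j → j < d → IsC2 (h j))
    (F : C(Torus d, ℂ)) : UniformAverages (triangular (increment y b h) d) F := by
  induction d with
  | zero =>
    refine UniformAverages.of_mFourier (fun m => ?_) F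
    rw [Subsingleton.elim m 0]
    exact uniformAverages_mFourier_zero _
  | succ r ih =>
    have ih' := ih (fun l h1 h2 => hb l h1 (by omega)) fun j h1 h2 => hC2 j h1 (by omega)
    refine UniformAverages.of_mFourier (fun m => ?_) F
    by_cases hm : m = 0
    · rw [hm]
      exact uniformAverages_mFourier_zero _
    by_cases hm0 : m (Fin.last r) = 0
    · exact UniformAverages.of_initial ih' hm hm0
    · cases r with
      | zero => exact uniformAverages_rotation hy hm
      | succ r =>
        exact uniformAverages_mFourier_of_last_ne_zero ih' (hb (r + 2) (by omega) le_rfl) hC2 hm0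

end UniformAveragesTriangular

/-! ### Koopman operators of triangular maps -/

section Koopman

variable {g : ∀ m : ℕ, Torus m → UnitAddCircle}

lemma triangular_injective (d : ℕ) : Function.Injective (triangular g d) := fun x z hxz => by
  have key : ∀ k, ∀ hk : k < d, x ⟨k, hk⟩ = z ⟨k, hk⟩ := fun k => by
    induction k using Nat.strong_induction_on with
    | _ k ih =>
      intro hk
      have h1 := congrFun hxz ⟨k, hk⟩
      have h2 : initial hk.le x = initial hk.le z := funext fun j =>
        ih j j.is_lt (j.is_lt.trans hk)
      simp only [triangular] at h1
      rw [h2] at h1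
      exact add_right_cancel h1
  exact funext fun i => key i i.is_lt

lemma triangular_surjective (d : ℕ) : Function.Surjective (triangular g d) := by
  induction d with
  | zero => exact fun z => ⟨z, funext fun i => i.elim0⟩
  | succ d ih =>
    intro z
    obtain ⟨x, hx⟩ := ih (initial (Nat.le_succ d) z)
    have hi : initial (Nat.le_succ d) (Fin.snoc x (z (Fin.last d) - g d x) : Torus (d + 1)) = x :=
      funext fun k => Fin.snoc_castSucc (α := fun _ => UnitAddCircle) _ _ _
    refine ⟨Fin.snoc x (z (Fin.last d) - g d x), funext fun i => ?_⟩
    refine Fin.lastCases ?_ (fun j => ?_) i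
    · change (Fin.snoc x (z (Fin.last d) - g d x) : Torus (d + 1)) (Fin.last d) +
        g d (initial (Nat.le_succ d) (Fin.snoc x (z (Fin.last d) - g d x) : Torus (d + 1))) = _
      rw [hi, Fin.snoc_last, sub_add_cancel]
    · have h1 := initial_triangular_iterate g (Nat.le_succ d) 1
        (Fin.snoc x (z (Fin.last d) - g d x) : Torus (d + 1))
      rw [hi] at h1
      exact congrFun (h1.trans hx) j

variable {d : ℕ}

lemma koopman_surjective {T : Torus d → Torus d} (hT : MeasurePreserving T (haar d) (haar d))
    (hc : Continuous T) (hb : Function.Bijective T) : Function.Surjective (koopman hT) := by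
  let e : Torus d ≃ₜ Torus d :=
    Continuous.homeoOfEquivCompactToT2 (f := Equiv.ofBijective T hb) hc
  have he : MeasurePreserving e.toMeasurableEquiv (haar d) (haar d) := hT
  intro f
  refine ⟨Lp.compMeasurePreserving _ (he.symm _) f, ?_⟩
  refine (Lp.compMeasurePreserving_comp_apply f (he.symm _) hT).symm.trans ?_
  have h2 : (e.toMeasurableEquiv.symm : Torus d → Torus d) ∘ T = id :=
    funext fun x => e.symm_apply_apply x
  refine Lp.ext ?_
  filter_upwards [Lp.coeFn_compMeasurePreserving f ((he.symm _).comp hT)] with x hx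
  rw [hx, h2, Function.comp_id]

/-- The class of a character in `L²`. -/
noncomputable def character (m : Fin d → ℤ) : L2 d :=
  ContinuousMap.toLp 2 (haar d) ℂ (UnitAddTorus.mFourier m)

lemma coeFn_character (m : Fin d → ℤ) :
    character m =ᵐ[haar d] UnitAddTorus.mFourier m := ContinuousMap.coeFn_toLp _ _

lemma span_character_closure_eq_top :
    (Submodule.span ℂ (Set.range (character (d := d)))).topologicalClosure = ⊤ :=
  UnitAddTorus.span_mFourierLp_closure_eq_top (p := 2) (by norm_num)

lemma coeFn_koopman {T : Torus d → Torus d} (hT : MeasurePreserving T (haar d) (haar d))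
    (f : L2 d) : koopman hT f =ᵐ[haar d] f ∘ T := Lp.coeFn_compMeasurePreserving f hT

lemma coeFn_pow_character {T : Torus d → Torus d} (hT : MeasurePreserving T (haar d) (haar d))
    {U : L2 d ≃ₗᵢ[ℂ] L2 d} (hU : ∀ f, U f = koopman hT f) (m : Fin d → ℤ) (n : ℕ) :
    (U ^ (n : ℤ)) (character m) =ᵐ[haar d] fun x => UnitAddTorus.mFourier m (T^[n] x) := by
  induction n with
  | zero => exact coeFn_character m
  | succ n ih =>
    push_cast
    rw [zpow_succ_apply, hU]
    filter_upwards [coeFn_koopman hT ((U ^ (n : ℤ)) (character m)),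
      hT.quasiMeasurePreserving.ae ih] with x h1 h2
    rw [h1, Function.comp_apply, h2, Function.iterate_succ_apply]

lemma inner_character_pow {T : Torus d → Torus d} (hT : MeasurePreserving T (haar d) (haar d))
    {U : L2 d ≃ₗᵢ[ℂ] L2 d} (hU : ∀ f, U f = koopman hT f) (m m' : Fin d → ℤ) (n : ℕ) :
    inner ℂ (character m) ((U ^ (n : ℤ)) (character m')) =
      ∫ x, UnitAddTorus.mFourier m' (T^[n] x) * conj (UnitAddTorus.mFourier m x) ∂(haar d) := by
  rw [L2.inner_def]
  refine integral_congr_ae ?_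
  filter_upwards [coeFn_pow_character hT hU m' n, coeFn_character m] with x h1 h2
  rw [h1, h2, RCLike.inner_apply]

lemma mFourier_eq_mFourier_initial {k : ℕ} (hk : k ≤ d) {m : Fin d → ℤ}
    (hm : ∀ i : Fin d, k ≤ i → m i = 0) (x : Torus d) :
    (UnitAddTorus.mFourier m x : ℂ) =
      UnitAddTorus.mFourier (fun i : Fin k => m (Fin.castLE hk i)) (initial hk x) := by
  rw [mFourier_apply, mFourier_apply]
  refine (Fintype.prod_of_injective (Fin.castLE hk) (Fin.castLE_injective hk) _ _ (fun i hi => ?_)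
    fun i => rfl).symm
  rw [hm i, fourier_zero]
  by_contra hlt
  exact hi ⟨⟨i, not_le.1 hlt⟩, rfl⟩

lemma inner_zpow_neg {H : Type*} [NormedAddCommGroup H] [InnerProductSpace ℂ H] (U : H ≃ₗᵢ[ℂ] H)
    (n : ℤ) (x z : H) : inner ℂ x ((U ^ (-n)) z) = conj (inner ℂ z ((U ^ n) x)) := by
  have h := inner_zpow_zpow (U := U) n 0 x z
  rw [zero_sub, zpow_zero] at h
  rw [← h, inner_conj_symm]
  rfl

/-- Squares of O(1/n) are summable, and negative exponents follow by conjugate symmetry. -/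
lemma squareSummable_of_le {H : Type*} [NormedAddCommGroup H] [InnerProductSpace ℂ H]
    {U : H ≃ₗᵢ[ℂ] H} {g : H} {C : ℝ} {N : ℕ}
    (h : ∀ n : ℕ, N ≤ n → ‖(inner ℂ g ((U ^ (n : ℤ)) g) : ℂ)‖ ≤ C / n) : SquareSummable U g := by
  have h1 : Summable fun n : ℕ => ‖(inner ℂ g ((U ^ (n : ℤ)) g) : ℂ)‖ ^ 2 := by
    refine Summable.of_norm_bounded_eventually_nat (g := fun n : ℕ => C ^ 2 * (1 / (n : ℝ) ^ 2))
      ((Real.summable_one_div_nat_pow.2 one_lt_two).mul_left _) ?_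
    filter_upwards [eventually_ge_atTop N] with n hn
    rw [norm_pow, norm_norm, mul_one_div, ← div_pow]
    exact pow_le_pow_left₀ (norm_nonneg _) (h n hn) 2
  refine Summable.of_nat_of_neg h1 ?_
  simp_rw [inner_zpow_neg, RCLike.norm_conj]
  exact h1

end Koopman

/-! ### Correlations of characters under the Koopman operator -/

section FurstenbergKoopman

variable {y : ℝ} {b : ℕ → ℕ → ℤ} {h : ∀ j : ℕ, Torus j → ℝ} {d : ℕ}

/-- Characters that do not only depend on the first coordinate have square summable
correlations. -/
lemma squareSummable_character (hy : Irrational y) (hb : ∀ l, 2 ≤ l → l ≤ d → b l (l - 1) ≠ 0)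
    (hC2 : ∀ j, 1 ≤ j → j < d → IsC2 (h j)) {U : L2 d ≃ₗᵢ[ℂ] L2 d}
    (hU : ∀ f, U f = koopman (measurePreserving_furstenbergMap d y b h hC2) f)
    {m : Fin d → ℤ} (hm : ∃ i : Fin d, (i : ℕ) ≠ 0 ∧ m i ≠ 0) :
    SquareSummable U (character m) := by
  -- The index r + 1 is the largest with nonzero frequency, positive by `hm`. Later coordinates play
  -- no role, and integration runs along coordinate r.
  obtain ⟨r, hr, hmr, hmax⟩ : ∃ (r : ℕ) (hr : r + 1 < d), m ⟨r + 1, hr⟩ ≠ 0 ∧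
      ∀ i : Fin d, r + 2 ≤ i → m i = 0 := by
    obtain ⟨i, hi0, hi⟩ := hm
    let S : Finset (Fin d) := Finset.univ.filter fun i => m i ≠ 0
    have hS : S.Nonempty := ⟨i, by simpa [S] using hi⟩
    have hj := S.max'_mem hS
    have hij : i ≤ S.max' hS := S.le_max' i (by simpa [S] using hi)
    set j := S.max' hS with hjdef
    have hj0 : (j : ℕ) ≠ 0 := by
      have : (i : ℕ) ≤ j := hij
      omega
    obtain ⟨r, hr⟩ := Nat.exists_eq_succ_of_ne_zero hj0
    refine ⟨r, by rw [← Nat.succ_eq_add_one, ← hr]; exact j.is_lt, ?_, fun k hk => ?_⟩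
    · have : (⟨r + 1, by rw [← Nat.succ_eq_add_one, ← hr]; exact j.is_lt⟩ : Fin d) = j :=
        Fin.ext hr.symm
      rw [this]
      simpa [S] using hj
    · by_contra hk0
      have : k ≤ j := S.le_max' k (by simpa [S] using hk0)
      have : (k : ℕ) ≤ j := this
      omega
  have hTc : Continuous (triangular (increment y b h) d) := continuous_triangular fun k hk =>
    continuous_increment fun h1 => hC2 k h1 hk
  obtain ⟨C, N, hN⟩ := exists_norm_integral_displacement_le (y := y) (b := b) (h := h) (r := r)
    (m := fun i => m (Fin.castLE hr i))
    (hb (r + 2) (by omega) hr) (hC2 _ (by omega) hr)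
    (exists_forall_abs_sum_partialDeriv_le (uniformAverages_furstenberg hy (r + 1)
      (fun l h1 h2 => hb l h1 (by omega)) fun j h1 h2 => hC2 j h1 (by omega))
      (hC2 _ (by omega) hr) (Fin.last r)) hmr
  refine squareSummable_of_le (C := C) (N := N) fun n hn => ?_
  rw [inner_character_pow (measurePreserving_furstenbergMap d y b h hC2) hU]
  change ‖∫ x, UnitAddTorus.mFourier m ((triangular (increment y b h) d)^[n] x) *
    conj (UnitAddTorus.mFourier m x) ∂(haar d)‖ ≤ _
  simp_rw [← mFourier_sub_arg]
  refine norm_integral_le_of_norm_integral_single_le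
    ((UnitAddTorus.mFourier m).continuous.comp ((hTc.iterate n).sub continuous_id))
    (Fin.castLE hr (Fin.last r).castSucc) fun x => ?_
  refine le_trans (le_of_eq ?_) (hN n hn (initial hr x))
  congr 2
  funext t
  rw [← initial_add_single, ← initial_triangular_iterate]
  exact mFourier_eq_mFourier_initial hr hmax _

/-- The orbits of characters in the first two variables with different frequencies in the second
one are orthogonal. -/
lemma inner_character_zpow_eq_zero {r : ℕ} {T : Torus (r + 2) → Torus (r + 2)}
    (hT : MeasurePreserving T (haar (r + 2)) (haar (r + 2)))
    {g : ∀ m : ℕ, Torus m → UnitAddCircle} (hTg : T = triangular g (r + 2))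
    {U : L2 (r + 2) ≃ₗᵢ[ℂ] L2 (r + 2)} (hU : ∀ f, U f = koopman hT f)
    {m m' : Fin (r + 2) → ℤ} (hm : ∀ i : Fin (r + 2), 2 ≤ (i : ℕ) → m i = 0)
    (hm' : ∀ i : Fin (r + 2), 2 ≤ (i : ℕ) → m' i = 0) (hmm' : m 1 ≠ m' 1) (n : ℤ) :
    inner ℂ (character m) ((U ^ n) (character m')) = 0 := by
  have key : ∀ m m' : Fin (r + 2) → ℤ, (∀ i : Fin (r + 2), 2 ≤ (i : ℕ) → m i = 0) →
      (∀ i : Fin (r + 2), 2 ≤ (i : ℕ) → m' i = 0) → m 1 ≠ m' 1 → ∀ n : ℕ,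
      inner ℂ (character m) ((U ^ (n : ℤ)) (character m')) = 0 := by
    intro m m' hm hm' hmm' n
    rw [inner_character_pow hT hU]
    -- Translating the second coordinate by t commutes with the map on the first two coordinates and
    -- multiplies the integrand by the constant `fourier (m' 1 - m 1) t`, which is not 1; so the
    -- integral vanishes.
    obtain ⟨t, ht⟩ := exists_fourier_ne_one (sub_ne_zero.2 hmm'.symm)
    have hk : 2 ≤ r + 2 := by omega
    have h1 : ∀ (m : Fin (r + 2) → ℤ), (∀ i : Fin (r + 2), 2 ≤ (i : ℕ) → m i = 0) →
        ∀ (l : ℕ) (x : Torus (r + 2)),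
        (UnitAddTorus.mFourier m (T^[l] (x + (Pi.single 1 t : Torus (r + 2)))) : ℂ) =
          UnitAddTorus.mFourier m (T^[l] x) * fourier (m 1) t := by
      intro m hm l x
      have e : (1 : Fin (r + 2)) = Fin.castLE hk (Fin.last 1) := rfl
      rw [mFourier_eq_mFourier_initial hk hm, mFourier_eq_mFourier_initial hk hm, hTg,
        initial_triangular_iterate, initial_triangular_iterate, e, initial_add_single,
        triangular_iterate_add_single_last, mFourier_add_arg]
      congr 1
      simp [mFourier_apply, -fourier_apply, fourier_eval_zero]
    have h2 := integral_add_right_eq_self (μ := haar (r + 2)) (fun x : Torus (r + 2) =>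
      (UnitAddTorus.mFourier m' (T^[n] x) * conj (UnitAddTorus.mFourier m x) : ℂ))
      (Pi.single 1 t : Torus (r + 2))
    have h3 : ∀ x : Torus (r + 2), (UnitAddTorus.mFourier m'
        (T^[n] (x + (Pi.single 1 t : Torus (r + 2)))) *
        conj (UnitAddTorus.mFourier m (x + (Pi.single 1 t : Torus (r + 2)))) : ℂ) =
        fourier (m' 1 - m 1) t *
          (UnitAddTorus.mFourier m' (T^[n] x) * conj (UnitAddTorus.mFourier m x)) := fun x => by
      have h4 := h1 m hm 0 x
      simp only [Function.iterate_zero, id] at h4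
      rw [h1 m' hm', h4, map_mul, sub_eq_add_neg, fourier_add, fourier_neg]
      ring
    simp_rw [h3] at h2
    rw [integral_const_mul] at h2
    have h5 : ((fourier (m' 1 - m 1) t : ℂ) - 1) * ∫ x, (UnitAddTorus.mFourier m' (T^[n] x) *
        conj (UnitAddTorus.mFourier m x) : ℂ) ∂(haar (r + 2)) = 0 := by
      rw [sub_mul, h2]; ring
    exact (mul_eq_zero.1 h5).resolve_left (sub_ne_zero.2 ht)
  rcases Int.eq_nat_or_neg n with ⟨n, rfl | rfl⟩
  · exact key m m' hm hm' hmm' n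
  · rw [inner_zpow_neg, key m' m hm' hm hmm'.symm n, map_zero]

end FurstenbergKoopman

lemma map_mem_topologicalClosure_span {H ι : Type*} [NormedAddCommGroup H] [InnerProductSpace ℂ H]
    {a : ι → H} {A : H →L[ℂ] H}
    (h : ∀ i, A (a i) ∈ (Submodule.span ℂ (Set.range a)).topologicalClosure) {x : H}
    (hx : x ∈ (Submodule.span ℂ (Set.range a)).topologicalClosure) :
    A x ∈ (Submodule.span ℂ (Set.range a)).topologicalClosure := by
  have : (Submodule.span ℂ (Set.range a)).topologicalClosure ≤
      (Submodule.span ℂ (Set.range a)).topologicalClosure.comap A.toLinearMap := by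
    refine Submodule.topologicalClosure_minimal _ ?_
      ((Submodule.isClosed_topologicalClosure _).preimage A.continuous)
    rw [Submodule.span_le]
    rintro _ ⟨i, rfl⟩
    exact h i
  exact this hx

/-! ### Multiplication by characters of the torus -/

section Modulation

variable {d : ℕ}

lemma memLp_top_mFourier (m : Fin d → ℤ) :
    MemLp (fun x => (UnitAddTorus.mFourier m x : ℂ)) ∞ (haar d) :=
  memLp_top_of_bound (UnitAddTorus.mFourier m).continuous.aestronglyMeasurable 1
    (Eventually.of_forall fun x => (norm_mFourier_apply m x).le)

/-- Multiplication by a character. -/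
noncomputable def modulation (m : Fin d → ℤ) : L2 d ≃ₗᵢ[ℂ] L2 d :=
  LinearIsometryEquiv.ofSurjective
    { (mulL (haar d) (fun x => (UnitAddTorus.mFourier m x : ℂ))).toLinearMap with
      norm_map' := norm_mulL_of_norm_eq_one (memLp_top_mFourier m) (norm_mFourier_apply m) }
    fun f => ⟨mulL (haar d) (fun x => (UnitAddTorus.mFourier (-m) x : ℂ)) f, by
      refine (mulL_mulL (memLp_top_mFourier m) (memLp_top_mFourier (-m)) f).trans ?_
      simp_rw [← UnitAddTorus.mFourier_add, add_neg_cancel, UnitAddTorus.mFourier_zero]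
      exact mulL_one f⟩

lemma coeFn_modulation (m : Fin d → ℤ) (f : L2 d) :
    modulation m f =ᵐ[haar d] fun x => UnitAddTorus.mFourier m x * f x :=
  coeFn_mulL (memLp_top_mFourier m) f

lemma modulation_character (m m' : Fin d → ℤ) :
    modulation m (character m') = character (m + m') := by
  refine Lp.ext ?_
  filter_upwards [coeFn_modulation m (character m'), coeFn_character m',
    coeFn_character (m + m')] with x h1 h2 h3
  rw [h1, h2, h3, UnitAddTorus.mFourier_add]

/-- For the eigenfunction e(x₁), with eigenvalue e(y), this is the commutation up to a phase that
rotates the spectrum. -/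
lemma koopman_modulation {T : Torus d → Torus d} (hT : MeasurePreserving T (haar d) (haar d))
    {m : Fin d → ℤ} {c : ℂ}
    (hm : ∀ x, (UnitAddTorus.mFourier m (T x) : ℂ) = c * UnitAddTorus.mFourier m x) (f : L2 d) :
    koopman hT (modulation m f) = c • modulation m (koopman hT f) := by
  refine Lp.ext ?_
  filter_upwards [coeFn_koopman hT (modulation m f), coeFn_modulation m (koopman hT f),
    coeFn_koopman hT f, Lp.coeFn_smul c (modulation m (koopman hT f)),
    hT.quasiMeasurePreserving.ae (coeFn_modulation m f)] with x h1 h2 h3 h4 h5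
  rw [h1, h4, Pi.smul_apply, h2, h3, Function.comp_apply, h5, hm, smul_eq_mul,
    Function.comp_apply, mul_assoc]

lemma character_ne_zero (m : Fin d → ℤ) : character m ≠ 0 := fun h0 => by
  have h1 : (UnitAddTorus.mFourier m : Torus d → ℂ) =ᵐ[haar d] 0 :=
    (coeFn_character m).symm.trans (by rw [h0]; exact Lp.coeFn_zero _ _ _)
  obtain ⟨x, hx⟩ := h1.exists
  have h2 := norm_mFourier_apply m x
  rw [hx] at h2
  simp at h2

end Modulation

/-! ### Functions of the first coordinate and the fiber subspaces -/

section FirstCoordinate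

variable {r : ℕ} {T : Torus (r + 2) → Torus (r + 2)}

/-- The embedding of `L²(𝕋)` into `L²(𝕋ᵈ)` as functions of the first coordinate. -/
noncomputable def firstCoordinateEmbedding (r : ℕ) : Lp ℂ 2 𝔪 →ₗᵢ[ℂ] L2 (r + 2) :=
  Lp.compMeasurePreservingₗᵢ ℂ (Function.eval (0 : Fin (r + 2)))
    (measurePreserving_eval (fun _ : Fin (r + 2) => 𝔪) 0)

lemma coeFn_firstCoordinateEmbedding (φ : Lp ℂ 2 𝔪) :
    firstCoordinateEmbedding r φ =ᵐ[haar (r + 2)] fun x => φ (x 0) :=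
  Lp.coeFn_compMeasurePreserving φ (measurePreserving_eval (fun _ : Fin (r + 2) => 𝔪) 0)

lemma firstCoordinateEmbedding_fourierLp (n : ℤ) :
    firstCoordinateEmbedding r (fourierLp 2 n) = character (Pi.single 0 n) := by
  refine Lp.ext ?_
  filter_upwards [coeFn_firstCoordinateEmbedding (r := r) (fourierLp 2 n),
    coeFn_character (d := r + 2) (Pi.single 0 n),
    (measurePreserving_eval (fun _ : Fin (r + 2) => 𝔪) 0).quasiMeasurePreserving.ae
      (coeFn_fourierLp 2 n)] with x h1 h2 h3
  rw [h1, h2]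
  refine h3.trans ?_
  rw [mFourier_apply, Fintype.prod_eq_single 0 fun i hi => by
    rw [Pi.single_eq_of_ne hi, fourier_zero], Pi.single_eq_same]

lemma koopman_firstCoordinateEmbedding (hT : MeasurePreserving T (haar (r + 2)) (haar (r + 2)))
    {s : UnitAddCircle} (hs : ∀ x, T x 0 = x 0 + s) (φ : Lp ℂ 2 𝔪) :
    koopman hT (firstCoordinateEmbedding r φ) = firstCoordinateEmbedding r (rotation s φ) := by
  refine Lp.ext ?_
  filter_upwards [coeFn_koopman hT (firstCoordinateEmbedding r φ),
    hT.quasiMeasurePreserving.ae (coeFn_firstCoordinateEmbedding φ),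
    coeFn_firstCoordinateEmbedding (r := r) (rotation s φ),
    (measurePreserving_eval (fun _ : Fin (r + 2) => 𝔪) 0).quasiMeasurePreserving.ae
      (coeFn_rotation s φ)] with x h1 h2 h3 h4
  rw [h1, h3, Function.comp_apply, h2, hs]
  exact h4.symm

lemma rotation_rotation_neg (s : UnitAddCircle) (φ : Lp ℂ 2 𝔪) :
    rotation s (rotation (-s) φ) = φ := by
  refine Lp.ext ?_
  filter_upwards [coeFn_rotation s (rotation (-s) φ),
    (measurePreserving_add_right 𝔪 s).quasiMeasurePreserving.ae (coeFn_rotation (-s) φ)]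
    with t h1 h2
  rw [h1, h2, add_neg_cancel_right]

lemma reduces_range_firstCoordinateEmbedding
    (hT : MeasurePreserving T (haar (r + 2)) (haar (r + 2)))
    {s : UnitAddCircle} (hs : ∀ x, T x 0 = x 0 + s) {U : L2 (r + 2) ≃ₗᵢ[ℂ] L2 (r + 2)}
    (hU : ∀ f, U f = koopman hT f) :
    Reduces U (LinearMap.range (firstCoordinateEmbedding r).toLinearMap) := fun x => by
  constructor
  · rintro ⟨φ, hφ⟩
    refine ⟨rotation (-s) φ, U.injective ?_⟩
    rw [← hφ, hU]
    refine (koopman_firstCoordinateEmbedding hT hs _).trans ?_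
    rw [rotation_rotation_neg]
    rfl
  · rintro ⟨φ, rfl⟩
    exact ⟨rotation s φ, by
      rw [hU]
      exact (koopman_firstCoordinateEmbedding hT hs φ).symm⟩

lemma mem_range_firstCoordinateEmbedding_orthogonal {x : L2 (r + 2)}
    (hx : ∀ n : ℤ, inner ℂ x (character (Pi.single 0 n)) = 0) :
    x ∈ (LinearMap.range (firstCoordinateEmbedding r).toLinearMap)ᗮ := by
  rw [Submodule.mem_orthogonal']
  rintro _ ⟨φ, rfl⟩
  have h1 : ContinuousLinearMap.adjoint (firstCoordinateEmbedding r).toContinuousLinearMap x =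
      0 := by
    refine eq_zero_of_inner_of_topologicalClosure_span_eq_top
      (span_fourierLp_closure_eq_top (p := 2) (by norm_num)) fun n => ?_
    rw [ContinuousLinearMap.adjoint_inner_left]
    refine Eq.trans ?_ (hx n)
    rw [← firstCoordinateEmbedding_fourierLp]
    rfl
  have h2 := ContinuousLinearMap.adjoint_inner_left
    (firstCoordinateEmbedding r).toContinuousLinearMap φ x
  rw [h1, inner_zero_left] at h2
  exact h2.symm

/-- The characters of frequency `k` in the second variable that depend on the first two variables
only, together with their orbits, span this subspace. -/
noncomputable def fiberSubspace (U : L2 (r + 2) ≃ₗᵢ[ℂ] L2 (r + 2)) (k : ℤ) :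
    Submodule ℂ (L2 (r + 2)) :=
  (Submodule.span ℂ (Set.range fun p : ℤ × {m : Fin (r + 2) → ℤ //
    m 1 = k ∧ ∀ i : Fin (r + 2), 2 ≤ (i : ℕ) → m i = 0} =>
      (U ^ p.1) (character p.2.1))).topologicalClosure

lemma zpow_character_mem_fiberSubspace (U : L2 (r + 2) ≃ₗᵢ[ℂ] L2 (r + 2)) (n : ℤ)
    {m : Fin (r + 2) → ℤ} (hm : ∀ i : Fin (r + 2), 2 ≤ (i : ℕ) → m i = 0) :
    (U ^ n) (character m) ∈ fiberSubspace U (m 1) :=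
  Submodule.le_topologicalClosure _ (Submodule.subset_span ⟨⟨n, ⟨m, rfl, hm⟩⟩, rfl⟩)

lemma reduces_fiberSubspace (U : L2 (r + 2) ≃ₗᵢ[ℂ] L2 (r + 2)) (k : ℤ) :
    Reduces U (fiberSubspace U k) := by
  have key : ∀ n : ℤ, ∀ x ∈ fiberSubspace U k, (U ^ n) x ∈ fiberSubspace U k := fun n x hx => by
    refine map_mem_topologicalClosure_span (A := (U ^ n).toContinuousLinearEquiv)
      (fun p => ?_) hx
    obtain ⟨l, m, rfl, hm⟩ := p
    change (U ^ n) ((U ^ l) (character m)) ∈ _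
    rw [← zpow_add_apply]
    exact zpow_character_mem_fiberSubspace U _ hm
  refine fun x => ⟨fun h => ?_, fun h => ?_⟩
  · have h1 := key (-1) _ h
    have h2 : (U ^ (-1 : ℤ)) (U x) = x := by
      rw [zpow_neg_one]
      exact U.symm_apply_apply x
    rwa [h2] at h1
  · have h1 := key 1 x h
    rwa [zpow_one] at h1

/-- Modulation commutes with Uⁿ up to the nonzero scalar cⁿ, and on characters it changes the
frequency in x₁ but not the one in x₂. -/
lemma modulation_mem_fiberSubspace {U : L2 (r + 2) ≃ₗᵢ[ℂ] L2 (r + 2)} {c : ℂ} (hc : c ≠ 0)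
    (hU : ∀ x, U (modulation (Pi.single 0 1) x) = c • modulation (Pi.single 0 1) (U x)) {k : ℤ}
    {x : L2 (r + 2)} (hx : x ∈ fiberSubspace U k) :
    modulation (Pi.single 0 1) x ∈ fiberSubspace U k := by
  have key : ∀ (n : ℤ) (x : L2 (r + 2)), (U ^ n) (modulation (Pi.single 0 1) x) =
      (c ^ n) • modulation (Pi.single 0 1) ((U ^ n) x) := fun n x => by
    refine zpow_apply_induction (p := fun n => (U ^ n) (modulation (Pi.single 0 1) x) =
      (c ^ n) • modulation (Pi.single 0 1) ((U ^ n) x)) ?_ (fun n => ?_) n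
    · rw [zpow_zero, zpow_zero, one_smul]; rfl
    · rw [zpow_succ_apply, zpow_succ_apply, zpow_add_one₀ hc, mul_smul, ← hU, ← map_smul U,
        U.injective.eq_iff]
  refine map_mem_topologicalClosure_span
    (A := (modulation (d := r + 2) (Pi.single 0 1)).toContinuousLinearEquiv) (fun p => ?_) hx
  obtain ⟨l, m, rfl, hm⟩ := p
  change modulation (Pi.single 0 1) ((U ^ l) (character m)) ∈ _
  rw [← inv_smul_smul₀ (zpow_ne_zero l hc) (modulation (Pi.single 0 1) _), ← key,
    modulation_character]
  refine Submodule.smul_mem _ _ ?_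
  have h1 : (Pi.single 0 1 + m : Fin (r + 2) → ℤ) 1 = m 1 := by simp
  have h2 := zpow_character_mem_fiberSubspace U l (m := Pi.single 0 1 + m) fun i hi => by
    have : i ≠ 0 := fun h => by simp [h] at hi
    rw [Pi.add_apply, hm i hi, Pi.single_eq_of_ne this, add_zero]
  rwa [h1] at h2

end FirstCoordinate

/-! ### Application of the criterion -/

lemma exists_enumeration_offAxis (r : ℕ) : ∃ e : ℕ → Fin (r + 2) → ℤ,
    {m | ∃ i : Fin (r + 2), (i : ℕ) ≠ 0 ∧ m i ≠ 0} = Set.range e :=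
  (Set.to_countable _).exists_eq_range ⟨Pi.single 1 1, 1, by simp, by simp⟩

theorem hasCountableLebesgueSpectrumOn_koopman {r : ℕ} {y : ℝ} (hy : Irrational y)
    {b : ℕ → ℕ → ℤ} (hb : ∀ l, 2 ≤ l → l ≤ r + 2 → b l (l - 1) ≠ 0) {h : ∀ j : ℕ, Torus j → ℝ}
    (hC2 : ∀ j, 1 ≤ j → j < r + 2 → IsC2 (h j)) :
    HasCountableLebesgueSpectrumOn
      (koopman (measurePreserving_furstenbergMap (r + 2) y b h hC2))
      (LinearMap.range (firstCoordinateEmbedding r).toLinearMap)ᗮ := by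
  have hT := measurePreserving_furstenbergMap (r + 2) y b h hC2
  have hTc : Continuous (furstenbergMap (r + 2) y b h) := continuous_triangular fun k hk =>
    continuous_increment fun h1 => hC2 k h1 hk
  let U : L2 (r + 2) ≃ₗᵢ[ℂ] L2 (r + 2) := LinearIsometryEquiv.ofSurjective (koopman hT)
    (koopman_surjective hT hTc ⟨triangular_injective _, triangular_surjective _⟩)
  have hU : ∀ f, U f = koopman hT f := fun f => rfl
  have hs : ∀ x, furstenbergMap (r + 2) y b h x 0 = x 0 + (y : UnitAddCircle) := fun x => by
    simp [furstenbergMap, increment]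
  have hUV : ∀ x, U (modulation (Pi.single 0 1) x) =
      (fourier 1 (y : UnitAddCircle) : ℂ) • modulation (Pi.single 0 1) (U x) := fun f => by
    refine koopman_modulation hT (fun x => ?_) f
    have h1 : ∀ z : Torus (r + 2),
        (UnitAddTorus.mFourier (Pi.single 0 1) z : ℂ) = fourier 1 (z 0) := fun z => by
      rw [mFourier_apply, Fintype.prod_eq_single 0 fun i hi => by
        rw [Pi.single_eq_of_ne hi, fourier_zero], Pi.single_eq_same]
    rw [h1, h1, hs, fourier_add_arg, mul_comm]
  have hc : (fourier 1 (y : UnitAddCircle) : ℂ) ≠ 0 := by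
    rw [fourier_apply]; exact Circle.coe_ne_zero _
  have hsq : ∀ m : Fin (r + 2) → ℤ, (∃ i : Fin (r + 2), (i : ℕ) ≠ 0 ∧ m i ≠ 0) →
      SquareSummable U (character m) := fun m hm => squareSummable_character hy hb hC2 hU hm
  have horth : ∀ {m m' : Fin (r + 2) → ℤ}, (∀ i : Fin (r + 2), 2 ≤ (i : ℕ) → m i = 0) →
      (∀ i : Fin (r + 2), 2 ≤ (i : ℕ) → m' i = 0) → m 1 ≠ m' 1 → ∀ n : ℤ,
      inner ℂ (character m) ((U ^ n) (character m')) = 0 :=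
    inner_character_zpow_eq_zero hT rfl hU
  have haxis : ∀ n : ℤ, ∀ i : Fin (r + 2), 2 ≤ (i : ℕ) →
      (Pi.single 0 n : Fin (r + 2) → ℤ) i = 0 := fun n i hi =>
    Pi.single_eq_of_ne (fun h0 => by simp [h0] at hi) _
  have hsingle : ∀ n : ℤ, ∀ i : Fin (r + 2), 2 ≤ (i : ℕ) →
      (Pi.single 1 n : Fin (r + 2) → ℤ) i = 0 := fun n i hi =>
    Pi.single_eq_of_ne (fun h0 => by simp [h0] at hi) _
  obtain ⟨e, he⟩ := exists_enumeration_offAxis r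
  -- The total family consists of the characters that do not depend on x₁ alone. The subspaces start
  -- at frequency k + 1 because the fiber of frequency 0 contains the functions of x₁; each contains
  -- the character e((k + 1)x₂).
  have key := hasCountableLebesgueSpectrumOn_of_squareSummable (U := U)
    (Submodule.isClosed_orthogonal (LinearMap.range (firstCoordinateEmbedding r).toLinearMap))
    (reduces_range_firstCoordinateEmbedding hT hs hU).orthogonal
    (f := fun i => character (e i)) (fun i => hsq _ (he.ge ⟨i, rfl⟩)) (fun x hx hxe => ?_)
    (V := modulation (Pi.single 0 1)) hy hUV (M := fun k => fiberSubspace U (k + 1))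
    (fun k => Submodule.isClosed_topologicalClosure _) (fun k => reduces_fiberSubspace U _)
    (fun k x hx => modulation_mem_fiberSubspace hc hUV hx) (fun k x hx => ?_)
    (fun k l hkl x hx z hz => ?_) (v := fun k => character (Pi.single 1 ((k : ℤ) + 1)))
    (fun k => hsq _ ⟨1, by simp, by rw [Pi.single_eq_same]; omega⟩) (fun k => ?_)
    (fun k => character_ne_zero _)
  · exact key
  · refine eq_zero_of_inner_of_topologicalClosure_span_eq_top span_character_closure_eq_top
      fun m => ?_
    by_cases hm : ∃ i : Fin (r + 2), (i : ℕ) ≠ 0 ∧ m i ≠ 0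
    · obtain ⟨i, rfl⟩ := he.le hm
      exact hxe i
    · push Not at hm
      have hm0 : m = Pi.single 0 (m 0) := funext fun i => by
        rcases eq_or_ne i 0 with rfl | hi
        · rw [Pi.single_eq_same]
        · rw [Pi.single_eq_of_ne hi, hm i (Fin.val_ne_zero_iff.2 hi)]
      rw [hm0, ← firstCoordinateEmbedding_fourierLp]
      exact (Submodule.mem_orthogonal' _ _).1 hx _ ⟨_, rfl⟩
  · refine mem_range_firstCoordinateEmbedding_orthogonal fun n => ?_
    rw [← inner_conj_symm, map_eq_zero]
    refine inner_eq_zero_of_mem_topologicalClosure_span (fun p => ?_) hx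
    obtain ⟨l, m, hmk, hm⟩ := p
    refine horth (haxis n) hm ?_ l
    rw [hmk, Pi.single_eq_of_ne (by simp)]
    omega
  · refine inner_eq_zero_of_mem_topologicalClosure_span (fun p => ?_) hz
    rw [← inner_conj_symm, map_eq_zero]
    refine inner_eq_zero_of_mem_topologicalClosure_span (fun q => ?_) hx
    obtain ⟨p, m, hmk, hm⟩ := p
    obtain ⟨q, m', hmk', hm'⟩ := q
    change inner ℂ ((U ^ p) (character m)) ((U ^ q) (character m')) = 0
    rw [inner_zpow_zpow]
    refine horth hm hm' ?_ _
    rw [hmk, hmk']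
    omega
  · have h1 := zpow_character_mem_fiberSubspace U 0 (hsingle ((k : ℤ) + 1))
    rwa [zpow_zero, Pi.single_eq_same] at h1

end Furstenberg

theorem mainTheorem7 (d : ℕ) (hd : 2 ≤ d)
    (y : ℝ) (hy : Irrational y)
    (b : ℕ → ℕ → ℤ) (hb : ∀ l, 2 ≤ l → l ≤ d → b l (l - 1) ≠ 0)
    (h : ∀ j : ℕ, Furstenberg.Torus j → ℝ)
    (hC2 : ∀ j, 1 ≤ j → j < d → Furstenberg.IsC2 (h j))
    (hLip : ∀ j, 1 ≤ j → j < d → Furstenberg.IsUniformlyLipschitzInLast (h j)) :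
    Furstenberg.HasCountableLebesgueSpectrumOn
      (Furstenberg.koopman (Furstenberg.measurePreserving_furstenbergMap d y b h hC2))
      (Furstenberg.firstCoordinateSubspace d (lt_of_lt_of_le two_pos hd))ᗮ := by
  obtain ⟨r, rfl⟩ := Nat.exists_eq_add_of_le' hd
  exact Furstenberg.hasCountableLebesgueSpectrumOn_koopman hy hb hC2
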